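/- **Setting.** Let $q>0$, $q\neq 1$ be real, $[n]=\frac{q^{n/2}-q^{-n/2}}{q^{1/2}-q^{-1/2}}$ and $[d_j]=[2j+1]$; let $\{\cdots\}_q$ be the $q$-$6j$ symbol given by the Racah formula (zero unless its four triads are admissible). Let $\Gamma_i$ be a finite trivalent graph cellularly embedded in a closed oriented surface, with arbitrarily oriented edges, such that every face visits each vertex and each edge at most once. A labelling $k$ of the edges by spins in $\frac12\mathbb N$ is admissible if the three spins at each vertex satisfy the triangle inequalities and have integral sum. A state is a family of complex coefficients $\psi(k)$, indexed by the admissible labellings (spin network basis); we put $\psi(k)=0$ if $k$ is not admissible. **Constraints.** Let $f$ be a face with edges $e_1,\dots,e_d$ in counter-clockwise order ($e_{d+1}=e_1$), and let $l_i$ be the spin of the third edge at the vertex shared by $e_{i-1}$ and $e_i$. Let $o_i=1$ if $e_i$ is oriented counter-clockwise around $f$, and $o_i=-1$ otherwise. The state $\psi$ satisfies the Hamiltonian constraints if for every face, every choice of the first edge $e_1$, every $p\in\{2,\dots,d\}$, all signs $\epsilon_1,\epsilon_p,\epsilon_{p+1},\dots,\epsilon_d$ and all admissible $k$, $$\sum_{\tilde\epsilon_2,\dots,\tilde\epsilon_{p-1}=\pm}\Bigl(\prod_{i=2}^{p}A_{o_i}^{\tilde\epsilon_i,\tilde\epsilon_{i-1}}(k_i,k_{i-1},l_i)\Bigr)\psi\bigl(k_1-\tfrac{\epsilon_1}2,k_2-\tfrac{\tilde\epsilon_2}2,\dots,k_{p-1}-\tfrac{\tilde\epsilon_{p-1}}2,k_p-\tfrac{\epsilon_p}2,\dots,k_d-\tfrac{\epsilon_d}2,\dots\bigr)$$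 $$+(-1)^{d-p}\alpha^{\epsilon_1,\epsilon_p}(k_1,k_p)\sum_{\tilde\epsilon_{p+1},\dots,\tilde\epsilon_d=\pm}\Bigl(\prod_{i=p+1}^{d+1}B_{o_i}^{\tilde\epsilon_i,\tilde\epsilon_{i-1}}(k_i-\tfrac{\epsilon_i}2,k_{i-1}-\tfrac{\epsilon_{i-1}}2,l_i)\Bigr)\psi\bigl(k_1,\dots,k_p,k_{p+1}-\tfrac{\epsilon_{p+1}}2+\tfrac{\tilde\epsilon_{p+1}}2,\dots,k_d-\tfrac{\epsilon_d}2+\tfrac{\tilde\epsilon_d}2,\dots\bigr)=0,$$ where $\tilde\epsilon_1=\epsilon_1$, $\tilde\epsilon_p=\epsilon_p$, the spins of the edges outside $f$ are unchanged, and $$A_o^{\epsilon,\epsilon'}(k,k',l)=o\,\epsilon\,[d_k](-1)^{k+k'+l}\begin{Bmatrix}k&k-\frac\epsilon2&\frac12\\k'-\frac{\epsilon'}2&k'&l\end{Bmatrix}_q,\qquad B_o^{\epsilon,\epsilon'}(k,k',l)=o\,\epsilon\,[d_k](-1)^{k+k'+l}\begin{Bmatrix}k&k+\frac\epsilon2&\frac12\\k'+\frac{\epsilon'}2&k'&l\end{Bmatrix}_q,$$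 $$\alpha^{\epsilon_1,\epsilon_p}(k_1,k_p)=\epsilon_1\epsilon_p\,\frac{[d_{k_p}]}{[d_{k_1-\epsilon_1/2}]}\,.$$ These coefficients come from the operator ordering of the quantum Hamiltonian in which the dimension operators $1/\mathbf N_{e_iv_i}$ stand to the right of the corner operators $\mathbf E_{e_ie_{i-1}}$ (and $1/\mathbf N_{e_1v_2}$, $1/\mathbf N_{e_pv_{p+1}}$ to their left). With the mirrored ordering one gets the same equations with every quantum dimension evaluated at the other of the two spins: $[d_{k-\epsilon/2}]$ in $A$, $[d_{k+\epsilon/2}]$ in $B$, and $\alpha^{\epsilon_1,\epsilon_p}(k_1,k_p)=\epsilon_1\epsilon_p[d_{k_p-\epsilon_p/2}]/[d_{k_1}]$. The theorem is asserted for each of the two orderings (the same one before and after the removal). **Edge removal.** Let $e_0$ be an edge which separates a face $F$ from a triangular face $f$, whose edges are $e_0,e_1,e_2$ in counter-clockwise order. Let $e_4$ (resp. $e_3$) be the third edge at the vertex of $e_0$ and $e_1$ (resp. of $e_0$ and $e_2$). Assume that $e_0$ is not a loop, and that none of the other ends of $e_1,e_2,e_3,e_4$ is at an end vertex of $e_0$.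 Let $\Gamma_f$ be obtained by removing $e_0$ and its two end vertices, so that $e_1$ and $e_4$ merge into one edge, $e_2$ and $e_3$ merge into one edge, and $F$ and $f$ merge into one face. The merged edges are oriented as $e_4$ and $e_3$ respectively (if $e_1,e_4$, and $e_2,e_3$, are oriented consistently, this is their common orientation); the other edges keep their orientations. Let $o_1,o_2$ be the orientations of $e_1,e_2$ relative to the counter-clockwise orientation of $f$. **Theorem.** Suppose that $\psi_i$ satisfies all the Hamiltonian constraints on $\Gamma_i$; write $\psi_i(j_0,j_1,j_2,j_3,j_4,\dots)$ for its coefficients, with $j_a$ the spin of $e_a$. Then the state on $\Gamma_f$ $$\psi_f(j_1,j_2,\dots)=(-1)^{(1+o_1)j_1+(1+o_2)j_2}\sqrt{[d_{j_1}][d_{j_2}]}\;\psi_i(0,j_1,j_2,j_2,j_1,\dots),$$ where $j_1,j_2$ are the spins of the edges merged from $e_1,e_4$ and from $e_2,e_3$, and the dots stand for the spins of the other edges, satisfies all the Hamiltonian constraints on $\Gamma_f$. -/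

import Mathlib

/-! Spins are half-integers; throughout, a spin `j` is encoded by the integer `2 j`. -/

namespace LoopGravity

/-- The `q`-number `[n] = (q^{n/2} - q^{-n/2}) / (q^{1/2} - q^{-1/2})`.
The quantum dimension of the spin encoded by `k = 2 j` is `[d_j] = [2 j + 1] = qNum q (k + 1)`. -/
noncomputable def qNum (q : ℝ) (n : ℤ) : ℝ :=
  (q ^ ((n : ℝ) / 2) - q ^ (-(n : ℝ) / 2)) / (q ^ ((1 : ℝ) / 2) - q ^ (-(1 : ℝ) / 2))

/-- The `q`-factorial `[n]! = [1] [2] ⋯ [n]` (only used for `n ≥ 0`). -/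
noncomputable def qFact (q : ℝ) (n : ℤ) : ℝ :=
  ∏ i ∈ Finset.range n.toNat, qNum q ((i : ℤ) + 1)

/-- Three (doubled) spins satisfy the triangle inequalities and have integral sum. -/
def Triad (a b c : ℤ) : Prop :=
  Even (a + b + c) ∧ a ≤ b + c ∧ b ≤ a + c ∧ c ≤ a + b

instance (a b c : ℤ) : Decidable (Triad a b c) := by
  unfold Triad; infer_instance

/-- The triangle coefficient of the Racah formula (doubled spins). -/
noncomputable def triangleCoeff (q : ℝ) (a b c : ℤ) : ℝ :=
  Real.sqrt (qFact q ((b + c - a) / 2) * qFact q ((a + c - b) / 2) * qFact q ((a + b - c) / 2)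
    / qFact q ((a + b + c) / 2 + 1))

/-- The `q`-`6j` symbol `{a b c; d e f}_q` (first row `a b c`, second row `d e f`, doubled spins),
given by the Racah formula; it vanishes unless `(a,b,c)`, `(a,e,f)`, `(d,b,f)`, `(d,e,c)`
are triads. -/
noncomputable def sixJ (q : ℝ) (a b c d e f : ℤ) : ℝ :=
  if Triad a b c ∧ Triad a e f ∧ Triad d b f ∧ Triad d e c then
    triangleCoeff q a b c * triangleCoeff q a e f * triangleCoeff q d b f * triangleCoeff q d e c *
      ∑ z ∈ Finset.Icc
          (max (max ((a + b + c) / 2) ((a + e + f) / 2)) (max ((d + b + f) / 2) ((d + e + c) / 2)))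
          (min (min ((a + b + d + e) / 2) ((a + c + d + f) / 2)) ((b + c + e + f) / 2)),
        (-1 : ℝ) ^ z * qFact q (z + 1) /
          (qFact q (z - (a + b + c) / 2) * qFact q (z - (a + e + f) / 2) *
            qFact q (z - (d + b + f) / 2) * qFact q (z - (d + e + c) / 2) *
            qFact q ((a + b + d + e) / 2 - z) * qFact q ((a + c + d + f) / 2 - z) *
            qFact q ((b + c + e + f) / 2 - z))
  else 0

/-- The ordering of the operators `N_{e v}` (multiplication by the quantum dimension of the spin
of `e`) relative to the corner operators `E` in the quantum Hamiltonian `H`, which only affects the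
quantum dimensions in the coefficients of the difference equations below. With the ordering
`right`, each corner operator `E_{e_i e_{i-1}}` in `h` is followed on its right by `1/N_{e_i v_i}`,
and `1/N_{e_1 v_2}`, `1/N_{e_p v_{p+1}}` stand on the left of the two sums in `h`. With the
ordering `left`, each of these operators is moved to the other side of the operators `E`; this
interchanges, in each quantum dimension, the unshifted spin and the shifted spin. -/
inductive Ordering
  | right
  | left

/-- The coefficient `A_{o}^{ε, ε'}(k, k', l)
  = o ε [d_k] (-1)^{k + k' + l} {k, k - ε/2, 1/2; k' - ε'/2, k', l}_q`
(with `[d_{k - ε/2}]` instead of `[d_k]` for the ordering `left`). -/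
noncomputable def coeffA (w : Ordering) (q : ℝ) (o ε ε' : ℤˣ) (k k' l : ℤ) : ℝ :=
  ((o : ℤ) : ℝ) * ((ε : ℤ) : ℝ) *
    (match w with
      | .right => qNum q (k + 1)
      | .left => qNum q (k - ε + 1)) *
    (-1 : ℝ) ^ ((k + k' + l) / 2) * sixJ q k (k - ε) 1 (k' - ε') k' l

/-- The coefficient `B_{o}^{ε, ε'}(k, k', l)
  = o ε [d_k] (-1)^{k + k' + l} {k, k + ε/2, 1/2; k' + ε'/2, k', l}_q`
(with `[d_{k + ε/2}]` instead of `[d_k]` for the ordering `left`). -/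
noncomputable def coeffB (w : Ordering) (q : ℝ) (o ε ε' : ℤˣ) (k k' l : ℤ) : ℝ :=
  ((o : ℤ) : ℝ) * ((ε : ℤ) : ℝ) *
    (match w with
      | .right => qNum q (k + 1)
      | .left => qNum q (k + ε + 1)) *
    (-1 : ℝ) ^ ((k + k' + l) / 2) * sixJ q k (k + ε) 1 (k' + ε') k' l

/-- The coefficient `α^{ε₁, ε_p}(k₁, k_p) = ε₁ ε_p [d_{k_p}] / [d_{k₁ - ε₁/2}]`
(`ε₁ ε_p [d_{k_p - ε_p/2}] / [d_{k₁}]` for the ordering `left`). In the case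
`k₁ = 0`, `ε₁ = +`, where the denominator is zero, all the terms of the difference equation
are zero anyway. -/
noncomputable def coeffAlpha (w : Ordering) (q : ℝ) (ε₁ εp : ℤˣ) (k₁ kp : ℤ) : ℝ :=
  ((ε₁ : ℤ) : ℝ) * ((εp : ℤ) : ℝ) *
    (match w with
      | .right => qNum q (kp + 1) / qNum q (k₁ - ε₁ + 1)
      | .left => qNum q (kp - εp + 1) / qNum q (k₁ + 1))

/-- A trivalent graph cellularly embedded in a closed oriented surface, as a combinatorial map.
`D` is the set of darts (edges with a direction); `rev` reverses a dart; `rot` sends a dart to the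
next dart, clockwise, with the same initial vertex. -/
structure TrivalentMap (D : Type*) where
  rev : Equiv.Perm D
  rot : Equiv.Perm D
  rev_rev : ∀ d, rev (rev d) = d
  rev_ne : ∀ d, rev d ≠ d
  rot_rot_rot : ∀ d, rot (rot (rot d)) = d
  rot_ne : ∀ d, rot d ≠ d

namespace TrivalentMap

variable {D : Type*} (G : TrivalentMap D)

/-- The next dart around the face on the left of a dart. The faces are the orbits of `next`,
each traversed counter-clockwise. -/
def next : Equiv.Perm D := G.rev.trans G.rot

/-- The number of edges of the face on the left of `d`. -/
noncomputable def faceDegree (d : D) : ℕ := Function.minimalPeriod G.next d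

/-- The `i`-th dart, counter-clockwise, around the face on the left of `d`, starting with
`d` for `i = 0`. -/
def around (d : D) (i : ℕ) : D := G.next^[i] d

/-- Every face visits each edge and each vertex at most once. -/
def FacesEmbedded : Prop :=
  ∀ d, ¬ G.next.SameCycle d (G.rev d) ∧ ¬ G.next.SameCycle d (G.rot d)

/-- An orientation of the edges: `o d = 1` if the edge is oriented along `d`, and `-1` otherwise.
For a dart `d`, the value `o d` is the orientation of the edge relative to the
counter-clockwise orientation of the face on the left of `d`. -/
def IsOrientation (o : D → ℤˣ) : Prop := ∀ d, o (G.rev d) = -o d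

/-- `k` is a labelling of the edges by (doubled) spins for which the space of intertwiners
is non-zero (thus one-dimensional) at every vertex. -/
def Admissible (k : D → ℤ) : Prop :=
  (∀ d, k (G.rev d) = k d) ∧ ∀ d, Triad (k d) (k (G.rot d)) (k (G.rot (G.rot d)))

/-- A (not necessarily normalizable) kinematical state, given by its coefficients in the spin
network basis, which is indexed by the admissible labellings. -/
def State : Type _ := {k : D → ℤ // G.Admissible k} → ℂ

variable {G}

open Classical in
/-- The spin network coefficient `ψ(k)`, which is zero if `k` is not admissible. -/
noncomputable def State.coeff (ψ : G.State) (k : D → ℤ) : ℂ :=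
  if h : G.Admissible k then ψ ⟨k, h⟩ else 0

variable (G)

section Constraints

variable [DecidableEq D]

/-- The darts around the face on the left of `d`. -/
noncomputable def face (d : D) : Finset D := (Finset.range (G.faceDegree d)).image (G.around d)

/-- Add `η e` to the label of each edge `e` of the face on the left of `d`, and keep the labels
of all other edges. -/
noncomputable def shift (d : D) (k η : D → ℤ) (x : D) : ℤ :=
  k x + (if x ∈ G.face d then η x else 0) + (if G.rev x ∈ G.face d then η (G.rev x) else 0)

/-- The sign functions that agree with `ε` outside of `S`. -/
def signsAgreeing [Fintype D] (ε : D → ℤˣ) (S : Finset D) : Finset (D → ℤˣ) :=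
  Finset.univ.filter fun η => ∀ x, x ∉ S → η x = ε x

/-- The left hand side of the difference equation that expresses
`⟨k| H_{f, e₁, e_p}^{ε₁, ε_p, ε_{p+1}, …, ε_n} |ψ⟩ = 0`,
for the face `f` on the left of `d`, whose edges are `e₁, …, e_n` counter-clockwise with
`e_{i+1} = G.around d i`, and for `p = r + 1`. The third edge at the vertex shared by `e_{i-1}`
and `e_i` is that of the dart `G.rot e_i`. -/
noncomputable def constraint [Fintype D] (w : Ordering) (q : ℝ) (o : D → ℤˣ) (ψ : G.State)
    (d : D) (r : ℕ) (ε : D → ℤˣ) (k : D → ℤ) : ℂ :=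
  let e : ℕ → D := G.around d
  let n : ℕ := G.faceDegree d
  (∑ η ∈ signsAgreeing ε ((Finset.Ioo 0 r).image e),
    ((∏ i ∈ Finset.Icc 1 r,
      coeffA w q (o (e i)) (η (e i)) (η (e (i - 1)))
        (k (e i)) (k (e (i - 1))) (k (G.rot (e i))) : ℝ) : ℂ) *
      ψ.coeff (G.shift d k fun x => -(η x : ℤ)))
  + (-1 : ℂ) ^ (n - (r + 1)) *
    ((coeffAlpha w q (ε (e 0)) (ε (e r)) (k (e 0)) (k (e r)) : ℝ) : ℂ) *
    ∑ η ∈ signsAgreeing ε ((Finset.Ioo r n).image e),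
      ((∏ i ∈ Finset.Icc (r + 1) n,
        coeffB w q (o (e i)) (η (e i)) (η (e (i - 1)))
          (k (e i) - ε (e i)) (k (e (i - 1)) - ε (e (i - 1))) (k (G.rot (e i))) : ℝ) : ℂ) *
        ψ.coeff (G.shift d k fun x => (η x : ℤ) - (ε x : ℤ))

/-- The state `ψ` satisfies all the Hamiltonian constraints: for all faces, all pairs of edges of
the face, all signs, and all spin network states `⟨k|`. -/
def IsPhysical [Fintype D] (w : Ordering) (q : ℝ) (o : D → ℤˣ) (ψ : G.State) : Prop :=
  ∀ (d : D) (r : ℕ), 0 < r → r < G.faceDegree d →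
    ∀ (ε : D → ℤˣ) (k : D → ℤ), G.Admissible k → G.constraint w q o ψ d r ε k = 0

end Constraints

section Removal

variable [DecidableEq D]

/-- The darts that start at one of the two end vertices of the edge of `d₀`. -/
def ends (d₀ : D) : Finset D :=
  {d₀, G.rot d₀, G.rot (G.rot d₀), G.rev d₀, G.rot (G.rev d₀), G.rot (G.rot (G.rev d₀))}

/-- The edge of `d₀` is not a loop, and each of the four other edge ends at its end vertices
belongs to an edge whose other end vertex is not one of the two. -/
structure Removable (d₀ : D) : Prop where
  ne_rot : G.rev d₀ ≠ G.rot d₀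
  ne_rot_rot : G.rev d₀ ≠ G.rot (G.rot d₀)
  far : ∀ x ∈ G.ends d₀, x ≠ d₀ → x ≠ G.rev d₀ → G.rev x ∉ G.ends d₀

/-- For a dart `y` which starts at an end vertex of the edge of `d₀` and does not
belong to this edge, the other dart with these two properties at the same vertex. -/
def partner (d₀ y : D) : D :=
  if G.rot y = d₀ ∨ G.rot y = G.rev d₀ then G.rot (G.rot y) else G.rot y

/-- The darts which remain after the removal of the edge of `d₀` and of its end vertices. -/
abbrev Kept (d₀ : D) : Type _ := {x : D // x ∉ G.ends d₀}

theorem rot_mem_ends (d₀ x : D) : G.rot x ∉ G.ends d₀ ↔ x ∉ G.ends d₀ := by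
  have h3 := G.rot_rot_rot
  have key : ∀ y, G.rot x = y ↔ x = G.rot (G.rot y) := fun y => by
    constructor
    · rintro rfl; exact (h3 x).symm
    · rintro rfl; exact h3 y
  simp only [ends, Finset.mem_insert, Finset.mem_singleton, key, h3]
  tauto

theorem partner_spec {d₀ y : D} (h : G.Removable d₀) (hy : y ∈ G.ends d₀) (h1 : y ≠ d₀)
    (h2 : y ≠ G.rev d₀) :
    G.partner d₀ y ∈ G.ends d₀ ∧ G.partner d₀ y ≠ d₀ ∧ G.partner d₀ y ≠ G.rev d₀ ∧
      G.partner d₀ (G.partner d₀ y) = y ∧ G.partner d₀ y ≠ y := by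
  have h3 := G.rot_rot_rot
  have hn := G.rot_ne
  have hA := h.ne_rot
  have hB := h.ne_rot_rot
  have hr := G.rev_ne d₀
  have m : ∀ z, z ∈ G.ends d₀ ↔ (z = d₀ ∨ z = G.rot d₀ ∨ z = G.rot (G.rot d₀) ∨ z = G.rev d₀ ∨
      z = G.rot (G.rev d₀) ∨ z = G.rot (G.rot (G.rev d₀))) := fun z => by simp [ends]
  have n1 : ∀ d, G.rot (G.rot d) ≠ d := fun d e => hn d (by rw [← e, h3, e])
  have n2 : G.rot (G.rev d₀) ≠ d₀ := fun e => hB (by conv_rhs => rw [← e, h3])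
  have n3 : G.rot (G.rot (G.rev d₀)) ≠ d₀ := fun e => hA (by conv_rhs => rw [← e, h3])
  rw [m] at hy ⊢
  rcases hy with rfl | rfl | rfl | rfl | rfl | rfl
  · exact absurd rfl h1
  all_goals first
    | exact absurd rfl h2
    | (simp only [partner, h3, hA.symm, hB.symm, hr, hr.symm, hn, n1, n2, n3, true_or, or_true,
        or_self, or_false, false_or, if_true, if_false, ne_eq, not_false_eq_true, and_self]
       try simp [(hn _).symm])

/-- The reversal of darts after the removal of the edge of `d₀`: at each end vertex, the
two other edges are merged into a single one. -/
def revKept {d₀ : D} (h : G.Removable d₀) (x : G.Kept d₀) : G.Kept d₀ :=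
  ⟨if G.rev x ∈ G.ends d₀ then G.rev (G.partner d₀ (G.rev x)) else G.rev x, by
    have hx := x.2
    have hd : d₀ ∈ G.ends d₀ := by simp [ends]
    have hd' : G.rev d₀ ∈ G.ends d₀ := by simp [ends]
    split_ifs with hm
    · have hp := G.partner_spec h hm
        (fun e => hx (by rw [← G.rev_rev x, e]; exact hd'))
        (fun e => hx (by rw [G.rev.injective e]; exact hd))
      exact h.far _ hp.1 hp.2.1 hp.2.2.1
    · exact hm⟩

theorem revKept_revKept {d₀ : D} (h : G.Removable d₀) (x : G.Kept d₀) :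
    G.revKept h (G.revKept h x) = x ∧ G.revKept h x ≠ x := by
  have hx := x.2
  have hd : d₀ ∈ G.ends d₀ := by simp [ends]
  have hd' : G.rev d₀ ∈ G.ends d₀ := by simp [ends]
  by_cases hm : G.rev x ∈ G.ends d₀
  · have hp := G.partner_spec h hm
      (fun e => hx (by rw [← G.rev_rev x, e]; exact hd'))
      (fun e => hx (by rw [G.rev.injective e]; exact hd))
    constructor
    · apply Subtype.ext
      simp only [revKept, if_pos hm, G.rev_rev, if_pos hp.1, hp.2.2.2.1]
    · intro e
      have e' := congrArg Subtype.val e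
      simp only [revKept, if_pos hm] at e'
      exact hp.2.2.2.2 (by conv_rhs => rw [← e', G.rev_rev])
  · constructor
    · apply Subtype.ext
      simp only [revKept, if_neg hm, G.rev_rev, if_neg hx]
    · intro e
      have e' := congrArg Subtype.val e
      simp only [revKept, if_neg hm] at e'
      exact G.rev_ne x e'

/-- The graph after the removal of the edge of `d₀` and of its two end vertices; at each of
these vertices, the two other edges are merged into one edge. -/
def removeEdge {d₀ : D} (h : G.Removable d₀) : TrivalentMap (G.Kept d₀) where
  rev := Function.Involutive.toPerm (G.revKept h) fun x => (G.revKept_revKept h x).1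
  rot := G.rot.subtypePerm fun x => G.rot_mem_ends d₀ x
  rev_rev x := (G.revKept_revKept h x).1
  rev_ne x := (G.revKept_revKept h x).2
  rot_rot_rot x := Subtype.ext (G.rot_rot_rot x)
  rot_ne x e := G.rot_ne x (congrArg Subtype.val e)

/-- The orientation of the edges after the removal, where `d₀` is the dart of the removed edge
which has the face `f` on its left. With `e₁` and `e₂` the edges which follow `d₀`
counter-clockwise around `f`, with `e₄` the third edge at the vertex of `d₀` and `e₁`, and with
`e₃` the third edge at the vertex of `d₀` and `e₂`, the edge merged from `e₁` and `e₄`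
is oriented as `e₄`, and the edge merged from `e₂` and `e₃` is oriented as `e₃`
(if `e₁` and `e₄`, or `e₂` and `e₃`, are oriented consistently, this is their common
orientation). All other edges keep their orientations. -/
def removeOrientation (d₀ : D) (o : D → ℤˣ) (x : G.Kept d₀) : ℤˣ :=
  if G.rev x = G.rot (G.rev d₀) then o (G.rot (G.rot (G.rev d₀)))
  else if G.rev x = G.rot (G.rot d₀) then o (G.rot d₀)
  else o x

/-- The labelling of the original graph which gives the label `0` to the removed edge, the label
of a merged edge to both edges from which it comes, and the same label to all other edges. -/
def extendLabels (d₀ : D) (k : G.Kept d₀ → ℤ) (x : D) : ℤ :=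
  if hx : x ∉ G.ends d₀ then k ⟨x, hx⟩
  else if x = d₀ ∨ x = G.rev d₀ then 0
  else if hx' : G.rev x ∉ G.ends d₀ then k ⟨G.rev x, hx'⟩
  else 0

end Removal

end TrivalentMap

end LoopGravity

namespace LoopGravity

open Finset

section QNumbers

variable {q : ℝ}

theorem qNum_eq_zpow (hq : 0 < q) (n : ℤ) :
    qNum q n = ((q ^ (1 / 2 : ℝ)) ^ n - ((q ^ (1 / 2 : ℝ)) ^ n)⁻¹) /
      (q ^ (1 / 2 : ℝ) - (q ^ (1 / 2 : ℝ))⁻¹) := by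
  have e : ∀ m : ℤ, q ^ ((m : ℝ) / 2) = (q ^ (1 / 2 : ℝ)) ^ m := fun m => by
    rw [← Real.rpow_intCast, ← Real.rpow_mul hq.le]; congr 1; ring
  have h1 : q ^ (-(n : ℝ) / 2) = ((q ^ (1 / 2 : ℝ)) ^ n)⁻¹ := by
    rw [← zpow_neg, ← e]; push_cast; rfl
  have h2 : q ^ (-(1 : ℝ) / 2) = (q ^ (1 / 2 : ℝ))⁻¹ := by
    rw [← Real.rpow_neg hq.le]; congr 1; ring
  rw [qNum, e, h1, h2]

theorem sqrt_base_ne_one (hq : 0 < q) (hq1 : q ≠ 1) : q ^ (1 / 2 : ℝ) ≠ 1 := by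
  intro h
  apply hq1
  rw [← Real.sqrt_eq_rpow] at h
  rw [← Real.sq_sqrt hq.le, h, one_pow]

theorem qNum_zero : qNum q 0 = 0 := by simp [qNum]

theorem sub_inv_ne_zero {t : ℝ} (ht : 0 < t) (ht1 : t ≠ 1) : t - t⁻¹ ≠ 0 := by
  intro h
  have h2 : t * t = 1 := by
    field_simp at h
    nlinarith
  exact ht1 (by nlinarith)

theorem qNum_one (hq : 0 < q) (hq1 : q ≠ 1) : qNum q 1 = 1 := by
  rw [qNum_eq_zpow hq, zpow_one,
    div_self (sub_inv_ne_zero (Real.rpow_pos_of_pos hq _) (sqrt_base_ne_one hq hq1))]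

theorem qNum_pos (hq : 0 < q) (hq1 : q ≠ 1) {n : ℤ} (hn : 0 < n) : 0 < qNum q n := by
  rw [qNum_eq_zpow hq]
  have ht : 0 < q ^ (1 / 2 : ℝ) := Real.rpow_pos_of_pos hq _
  have ht1 := sqrt_base_ne_one hq hq1
  generalize q ^ (1 / 2 : ℝ) = t at ht ht1
  rcases lt_or_gt_of_ne ht1 with h | h
  · apply div_pos_of_neg_of_neg
    · have h1 : t ^ n < 1 := zpow_lt_one₀ ht h hn
      have := (one_lt_inv₀ (zpow_pos ht n)).2 h1
      linarith
    · have := (one_lt_inv₀ ht).2 h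
      linarith
  · apply div_pos
    · have h1 : 1 < t ^ n := one_lt_zpow₀ h hn
      have := inv_lt_one_of_one_lt₀ h1
      linarith
    · have := inv_lt_one_of_one_lt₀ h
      linarith

theorem qNum_nonneg (hq : 0 < q) (hq1 : q ≠ 1) {n : ℤ} (hn : 0 ≤ n) : 0 ≤ qNum q n := by
  rcases hn.eq_or_lt with rfl | h
  · rw [qNum_zero]
  · exact (qNum_pos hq hq1 h).le

theorem qNum_two_mul (hq : 0 < q) (hq1 : q ≠ 1) (n : ℤ) :
    qNum q 2 * qNum q n = qNum q (n + 1) + qNum q (n - 1) := by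
  simp only [qNum_eq_zpow hq]
  have ht : 0 < q ^ (1 / 2 : ℝ) := Real.rpow_pos_of_pos hq _
  have hd := sub_inv_ne_zero ht (sqrt_base_ne_one hq hq1)
  generalize q ^ (1 / 2 : ℝ) = t at ht hd
  rw [zpow_add₀ ht.ne', zpow_sub₀ ht.ne', zpow_one, show (2 : ℤ) = ((2 : ℕ) : ℤ) from rfl,
    zpow_natCast, div_mul_div_comm, ← add_div, div_eq_div_iff (mul_ne_zero hd hd) hd]
  have hn := zpow_pos ht n
  generalize t ^ n = u at hn
  field_simp
  ring

/-- The quadratic relation between `q`-numbers behind the orthogonality of the `q`-`6j` symbols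
with a spin `1/2`. -/
theorem qNum_mul_add_mul (hq : 0 < q) (a b c d : ℤ) :
    qNum q (a + b + d + c) * qNum q (b + c) + qNum q a * qNum q d =
      qNum q (a + b + c) * qNum q (b + c + d) := by
  simp only [qNum_eq_zpow hq]
  have ht : 0 < q ^ (1 / 2 : ℝ) := Real.rpow_pos_of_pos hq _
  generalize q ^ (1 / 2 : ℝ) = t at ht
  simp only [div_mul_div_comm, ← add_div]
  congr 1
  simp only [zpow_add₀ ht.ne']
  have h1 := zpow_pos ht a
  have h2 := zpow_pos ht b
  have h3 := zpow_pos ht c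
  have h4 := zpow_pos ht d
  generalize t ^ a = A at *
  generalize t ^ b = B at *
  generalize t ^ c = C at *
  generalize t ^ d = D at *
  field_simp
  ring

theorem qFact_zero : qFact q 0 = 1 := by simp [qFact]

theorem qFact_succ {n : ℤ} (hn : 0 ≤ n) : qFact q (n + 1) = qFact q n * qNum q (n + 1) := by
  obtain ⟨m, rfl⟩ := Int.eq_ofNat_of_zero_le hn
  rw [qFact, qFact, show ((m : ℤ) + 1).toNat = m + 1 by omega, Finset.prod_range_succ]
  simp

theorem qFact_pos (hq : 0 < q) (hq1 : q ≠ 1) (n : ℤ) : 0 < qFact q n :=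
  Finset.prod_pos fun i _ => qNum_pos hq hq1 (by omega)

end QNumbers

section SixJ

variable {q : ℝ}

theorem Triad.swap12 {a b c : ℤ} : Triad a b c ↔ Triad b a c := by
  simp only [Triad, Int.even_iff]; omega

theorem Triad.swap23 {a b c : ℤ} : Triad a b c ↔ Triad a c b := by
  simp only [Triad, Int.even_iff]; omega

theorem triangleCoeff_swap12 (a b c : ℤ) : triangleCoeff q a b c = triangleCoeff q b a c := by
  unfold triangleCoeff; rw [add_comm a b]; congr 2; ring

theorem triangleCoeff_swap23 (a b c : ℤ) : triangleCoeff q a b c = triangleCoeff q a c b := by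
  unfold triangleCoeff; rw [add_right_comm a b c, add_comm b c]; congr 2; ring

theorem sixJ_eq_zero {a b c d e f : ℤ}
    (h : ¬ (Triad a b c ∧ Triad a e f ∧ Triad d b f ∧ Triad d e c)) : sixJ q a b c d e f = 0 :=
  if_neg h

/-- Exchange of the first two columns of a `6j` symbol. -/
theorem sixJ_swap12 (a b c d e f : ℤ) : sixJ q a b c d e f = sixJ q b a c e d f := by
  unfold sixJ
  have hc : (Triad a b c ∧ Triad a e f ∧ Triad d b f ∧ Triad d e c) ↔
      (Triad b a c ∧ Triad b d f ∧ Triad e a f ∧ Triad e d c) := by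
    rw [@Triad.swap12 b a, @Triad.swap12 b d, @Triad.swap12 e a, @Triad.swap12 e d]; tauto
  by_cases h : Triad a b c ∧ Triad a e f ∧ Triad d b f ∧ Triad d e c
  · rw [if_pos h, if_pos (hc.1 h)]
    rw [triangleCoeff_swap12 b a, triangleCoeff_swap12 b d, triangleCoeff_swap12 e a,
      triangleCoeff_swap12 e d, add_comm b a, add_comm b d, add_comm e a, add_comm e d]
    rw [show (a + b + e + d) = a + b + d + e by ring, show b + c + e + f = b + c + e + f from rfl]
    congr 1
    · ring
    · apply Finset.sum_congr
      · congr 1 <;> omega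
      · intro z _; congr 1; ring
  · rw [if_neg h, if_neg (fun h' => h (hc.2 h'))]

/-- Exchange of the last two columns of a `6j` symbol. -/
theorem sixJ_swap23 (a b c d e f : ℤ) : sixJ q a b c d e f = sixJ q a c b d f e := by
  unfold sixJ
  have hc : (Triad a b c ∧ Triad a e f ∧ Triad d b f ∧ Triad d e c) ↔
      (Triad a c b ∧ Triad a f e ∧ Triad d c e ∧ Triad d f b) := by
    rw [@Triad.swap23 a c, @Triad.swap23 a f, @Triad.swap23 d c, @Triad.swap23 d f]; tauto
  by_cases h : Triad a b c ∧ Triad a e f ∧ Triad d b f ∧ Triad d e c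
  · rw [if_pos h, if_pos (hc.1 h)]
    rw [triangleCoeff_swap23 a c, triangleCoeff_swap23 a f, triangleCoeff_swap23 d c,
      triangleCoeff_swap23 d f, add_right_comm a c b, add_right_comm a f e,
      add_right_comm d c e, add_right_comm d f b,
      show c + b + f + e = b + c + e + f by ring]
    congr 1
    · ring
    · apply Finset.sum_congr
      · congr 1 <;> omega
      · intro z _; congr 1; ring
  · rw [if_neg h, if_neg (fun h' => h (hc.2 h'))]

/-- Exchange of the upper and lower entries in the first two columns of a `6j` symbol. -/
theorem sixJ_flip12 (a b c d e f : ℤ) : sixJ q a b c d e f = sixJ q d e c a b f := by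
  unfold sixJ
  have hc : (Triad a b c ∧ Triad a e f ∧ Triad d b f ∧ Triad d e c) ↔
      (Triad d e c ∧ Triad d b f ∧ Triad a e f ∧ Triad a b c) := by tauto
  by_cases h : Triad a b c ∧ Triad a e f ∧ Triad d b f ∧ Triad d e c
  · rw [if_pos h, if_pos (hc.1 h)]
    rw [show d + e + a + b = a + b + d + e by ring, show d + c + a + f = a + c + d + f by ring,
      show e + c + b + f = b + c + e + f by ring]
    congr 1
    · ring
    · apply Finset.sum_congr
      · congr 1; omega
      · intro z _; congr 1; ring
  · rw [if_neg h, if_neg (fun h' => h (hc.2 h'))]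

theorem triangleCoeff_zero_left (hq : 0 < q) (hq1 : q ≠ 1) {b : ℤ} (hb : 0 ≤ b) :
    triangleCoeff q 0 b b = (Real.sqrt (qNum q (b + 1)))⁻¹ := by
  have h := qFact_pos hq hq1 b
  rw [triangleCoeff, ← Real.sqrt_inv, show (b + b - 0) / 2 = b by omega,
    show (0 + b - b) / 2 = 0 by omega, show (0 + b + b) / 2 + 1 = b + 1 by omega, qFact_zero,
    qFact_succ hb, mul_one, mul_one, div_mul_eq_div_div, div_self h.ne', one_div]

theorem triangleCoeff_mul_self (hq : 0 < q) (hq1 : q ≠ 1) (a b c : ℤ) :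
    triangleCoeff q a b c * triangleCoeff q a b c =
      qFact q ((b + c - a) / 2) * qFact q ((a + c - b) / 2) * qFact q ((a + b - c) / 2)
        / qFact q ((a + b + c) / 2 + 1) := by
  have h := qFact_pos hq hq1
  rw [triangleCoeff, Real.mul_self_sqrt]
  exact (div_pos (mul_pos (mul_pos (h _) (h _)) (h _)) (h _)).le

/-- The `6j` symbol with a zero entry. -/
theorem sixJ_zero_left (hq : 0 < q) (hq1 : q ≠ 1) {b d e : ℤ} (h : Triad d b e) :
    sixJ q 0 b b d e e = (-1 : ℝ) ^ ((b + d + e) / 2) *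
      (Real.sqrt (qNum q (b + 1)) * Real.sqrt (qNum q (e + 1)))⁻¹ := by
  have h0 := h
  obtain ⟨⟨m, hm⟩, h1, h2, h3⟩ := h
  have hb : 0 ≤ b := by omega
  have he : 0 ≤ e := by omega
  rw [sixJ, if_pos ⟨⟨⟨b, by ring⟩, by omega, by omega, by omega⟩,
    ⟨⟨e, by ring⟩, by omega, by omega, by omega⟩, h0, Triad.swap23.1 h0⟩,
    triangleCoeff_zero_left hq hq1 hb, triangleCoeff_zero_left hq hq1 he,
    triangleCoeff_swap23 d e b, mul_assoc, mul_assoc, ← mul_assoc (triangleCoeff q d b e),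
    triangleCoeff_mul_self hq hq1]
  rw [show max (max ((0 + b + b) / 2) ((0 + e + e) / 2)) (max ((d + b + e) / 2) ((d + e + b) / 2))
    = m by omega, show min (min ((0 + b + d + e) / 2) ((0 + b + d + e) / 2)) ((b + b + e + e) / 2)
    = m by omega, Finset.Icc_self, Finset.sum_singleton,
    show (b + d + e) / 2 = m by omega, show (0 + b + b) / 2 = b by omega,
    show (0 + e + e) / 2 = e by omega, show (d + b + e) / 2 = m by omega,
    show (d + e + b) / 2 = m by omega, show (0 + b + d + e) / 2 = m by omega,
    show (b + b + e + e) / 2 = b + e by omega, sub_self, qFact_zero,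
    show (b + e - d) / 2 = b + e - m by omega, show (d + e - b) / 2 = m - b by omega,
    show (d + b - e) / 2 = m - e by omega]
  have hF := fun n => (qFact_pos hq hq1 n).ne'
  have s1 : Real.sqrt (qNum q (b + 1)) ≠ 0 := (Real.sqrt_pos.2 (qNum_pos hq hq1 (by omega))).ne'
  have s2 : Real.sqrt (qNum q (e + 1)) ≠ 0 := (Real.sqrt_pos.2 (qNum_pos hq hq1 (by omega))).ne'
  have f1 := hF (m + 1)
  have f2 := hF (m - b)
  have f3 := hF (m - e)
  have f4 := hF (b + e - m)
  field_simp

end SixJ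

section Coefficients

variable {q : ℝ}

theorem coeffA_eq_orientation_mul (w : Ordering) (o ε ε' : ℤˣ) (k k' l : ℤ) :
    coeffA w q o ε ε' k k' l = ((o : ℤ) : ℝ) * coeffA w q 1 ε ε' k k' l := by
  simp only [coeffA, Units.val_one, Int.cast_one]; ring

theorem coeffB_eq_coeffA (w : Ordering) (o ε ε' : ℤˣ) (k k' l : ℤ) :
    coeffB w q o ε ε' k k' l = -(((o : ℤ) : ℝ) * coeffA w q 1 (-ε) (-ε') k k' l) := by
  cases w <;>
    simp only [coeffA, coeffB, Units.val_one, Int.cast_one, Units.val_neg, Int.cast_neg,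
      sub_neg_eq_add] <;> ring

theorem coeffA_eq_zero {w : Ordering} {o ε ε' : ℤˣ} {k k' l : ℤ}
    (h : ¬ (Triad k (k - ε) 1 ∧ Triad k k' l ∧ Triad (k' - ε') (k - ε) l ∧
      Triad (k' - ε') k' 1)) : coeffA w q o ε ε' k k' l = 0 := by
  unfold coeffA
  rw [sixJ_eq_zero h, mul_zero]

theorem triad_sub_unit {x : ℤ} {s : ℤˣ} (hx : 0 ≤ x) (h : 0 ≤ x - s) : Triad x (x - s) 1 := by
  rcases Int.units_eq_one_or s with rfl | rfl <;>
    simp only [Triad, Int.even_iff, Units.val_one, Units.val_neg] at h ⊢ <;> omega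

theorem sixJ_zero_last (hq : 0 < q) (hq1 : q ≠ 1) {x y : ℤ} (h : Triad x y 1) :
    sixJ q x y 1 y x 0 = (-1 : ℝ) ^ ((x + y + 1) / 2) *
      (Real.sqrt (qNum q (x + 1)) * Real.sqrt (qNum q (y + 1)))⁻¹ := by
  rw [sixJ_swap12, sixJ_swap23, sixJ_flip12, sixJ_swap12,
    sixJ_zero_left hq hq1 (Triad.swap12.1 (Triad.swap23.1 h)),
    show x + 1 + y = x + y + 1 by ring]

theorem sixJ_zero_middle (hq : 0 < q) (hq1 : q ≠ 1) {x y : ℤ} (h : Triad x y 1) :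
    sixJ q x y 1 1 0 x = (-1 : ℝ) ^ ((x + y + 1) / 2) *
      (Real.sqrt (qNum q 2) * Real.sqrt (qNum q (x + 1)))⁻¹ := by
  rw [sixJ_flip12, sixJ_swap12, sixJ_zero_left hq hq1 (Triad.swap23.1 (Triad.swap12.1 h)),
    show 1 + y + x = x + y + 1 by ring]
  rfl

theorem sixJ_zero_first (hq : 0 < q) (hq1 : q ≠ 1) {x y : ℤ} (h : Triad x y 1) :
    sixJ q 0 1 1 y x x = (-1 : ℝ) ^ ((x + y + 1) / 2) *
      (Real.sqrt (qNum q 2) * Real.sqrt (qNum q (x + 1)))⁻¹ := by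
  rw [sixJ_zero_left hq hq1 (Triad.swap23.1 (Triad.swap12.1 h)),
    show 1 + y + x = x + y + 1 by ring]
  rfl

theorem unit_mul_neg_one_zpow (s : ℤˣ) (x : ℤ) :
    ((s : ℤ) : ℝ) * (-1 : ℝ) ^ ((x + x) / 2) * (-1 : ℝ) ^ ((x + (x - s) + 1) / 2) = 1 := by
  have h1 : ((-1 : ℝ) ^ x) * (-1 : ℝ) ^ x = 1 := by
    rw [← zpow_add₀ (by norm_num), Even.neg_one_zpow ⟨x, rfl⟩]
  rw [show (x + x) / 2 = x by omega]
  rcases Int.units_eq_one_or s with rfl | rfl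
  · rw [show (x + (x - ((1 : ℤˣ) : ℤ)) + 1) / 2 = x by simp only [Units.val_one]; omega]
    simp [h1]
  · rw [show (x + (x - ((-1 : ℤˣ) : ℤ)) + 1) / 2 = x + 1 by
      simp only [Units.val_neg, Units.val_one]; omega, zpow_add₀ (by norm_num)]
    simp [h1]

/-- The coefficient at a vertex whose third edge has spin `0`, when both signs agree. -/
theorem coeffA_zero_last (hq : 0 < q) (hq1 : q ≠ 1) (s : ℤˣ) {x : ℤ} (hx : 0 ≤ x) :
    coeffA .left q 1 s s x x 0 = Real.sqrt (qNum q (x - s + 1)) / Real.sqrt (qNum q (x + 1)) := by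
  by_cases h : 0 ≤ x - s
  · have hy := qNum_pos hq hq1 (show 0 < x - s + 1 by omega)
    have hs := Real.mul_self_sqrt hy.le
    have hs0 := (Real.sqrt_pos.2 hy).ne'
    have hs1 := (Real.sqrt_pos.2 (qNum_pos hq hq1 (show 0 < x + 1 by omega))).ne'
    have key := unit_mul_neg_one_zpow s x
    rw [coeffA, sixJ_zero_last hq hq1 (triad_sub_unit hx h)]
    simp only [Units.val_one, Int.cast_one, one_mul, add_zero]
    rw [show ((s : ℤ) : ℝ) * qNum q (x - s + 1) * (-1 : ℝ) ^ ((x + x) / 2) *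
      ((-1 : ℝ) ^ ((x + (x - s) + 1) / 2) *
        (Real.sqrt (qNum q (x + 1)) * Real.sqrt (qNum q (x - s + 1)))⁻¹) =
      (((s : ℤ) : ℝ) * (-1 : ℝ) ^ ((x + x) / 2) * (-1 : ℝ) ^ ((x + (x - s) + 1) / 2)) *
      (qNum q (x - s + 1) *
        (Real.sqrt (qNum q (x + 1)) * Real.sqrt (qNum q (x - s + 1)))⁻¹) by ring, key, one_mul]
    nth_rw 1 [← hs]
    field_simp
  · have h1 : x - s = -1 := by
      rcases Int.units_eq_one_or s with rfl | rfl <;>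
        simp only [Units.val_one, Units.val_neg] at h ⊢ <;> omega
    rw [coeffA_eq_zero (fun h' => h (by have := h'.1; unfold Triad at this; omega)), h1]
    simp [qNum_zero]

end Coefficients

section Sequences

/-- The sign sequences that agree with `ε` outside of `S`. -/
noncomputable def seqSigns (ε : ℕ → ℤˣ) (S : Finset ℕ) : Finset (ℕ → ℤˣ) :=
  open Classical in S.powerset.image fun T i => if i ∈ T then -ε i else ε i

theorem mem_seqSigns {ε : ℕ → ℤˣ} {S : Finset ℕ} {σ : ℕ → ℤˣ} :
    σ ∈ seqSigns ε S ↔ ∀ i, i ∉ S → σ i = ε i := by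
  classical
  simp only [seqSigns, Finset.mem_image, Finset.mem_powerset]
  constructor
  · rintro ⟨T, hT, rfl⟩ i hi
    exact if_neg fun h => hi (hT h)
  · intro h
    refine ⟨S.filter fun i => σ i ≠ ε i, Finset.filter_subset _ _, funext fun i => ?_⟩
    by_cases hi : i ∈ S
    · rcases Int.units_eq_one_or (σ i) with h1 | h1 <;>
        rcases Int.units_eq_one_or (ε i) with h2 | h2 <;> simp [hi, h1, h2]
    · simp [hi, h i hi]

/-- The sum over the signs strictly between the positions `a` and `b` along a face with labels `K`
and third edges labelled by `l`, as it enters the difference equations. -/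
noncomputable def arcSum (w : Ordering) (q : ℝ) (l K : ℕ → ℤ) (ε : ℕ → ℤˣ) (a b : ℕ)
    (Φ : (ℕ → ℤ) → ℂ) : ℂ :=
  ∑ σ ∈ seqSigns ε (Ioo a b),
    ((∏ i ∈ Ioc a b, coeffA w q 1 (σ i) (σ (i - 1)) (K i) (K (i - 1)) (l i) : ℝ) : ℂ) *
      Φ fun i => K i - σ i

/-- Insertion of `x` at position `t + 1` into a sequence. -/
def insSeq {α : Type*} (t : ℕ) (x : α) (u : ℕ → α) (i : ℕ) : α :=
  if i ≤ t then u i else if i = t + 1 then x else u (i - 1)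

section insSeq

variable {α : Type*} {t : ℕ} {x : α} {u : ℕ → α} {i : ℕ}

theorem insSeq_of_le (h : i ≤ t) : insSeq t x u i = u i := if_pos h

theorem insSeq_self : insSeq t x u (t + 1) = x := by simp [insSeq]

theorem insSeq_of_lt (h : t < i) : insSeq t x u (i + 1) = u i := by
  simp [insSeq, show ¬ i + 1 ≤ t by omega, show i ≠ t by omega]

theorem insSeq_injective : Function.Injective (insSeq t x) := fun u v h => funext fun i => by
  by_cases hi : i ≤ t
  · simpa [insSeq_of_le hi] using congrFun h i
  · simpa [insSeq_of_lt (not_le.1 hi)] using congrFun h (i + 1)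

theorem insSeq_delete (v : ℕ → α) (h : v (t + 1) = x) :
    insSeq t x (fun i => if i ≤ t then v i else v (i + 1)) = v := funext fun i => by
  rcases le_or_gt i t with hi | hi
  · simp [insSeq_of_le hi, hi]
  · obtain ⟨j, rfl⟩ := Nat.exists_eq_add_of_lt hi
    rcases j with _ | j
    · simpa [insSeq_self] using h.symm
    · rw [insSeq_of_lt (by omega)]
      simp

end insSeq

variable {w : Ordering} {q : ℝ} {l l' K : ℕ → ℤ} {ε : ℕ → ℤˣ} {a b t : ℕ} {x : ℤ} {s₀ : ℤˣ}
  {C : ℂ} {Φ Φ' : (ℕ → ℤ) → ℂ}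

theorem prod_Ioc_add_one (c : ℕ → ℝ) (m n : ℕ) :
    ∏ i ∈ Ioc (m + 1) (n + 1), c i = ∏ i ∈ Ioc m n, c (i + 1) := by
  rw [← map_add_right_Ioc, prod_map]; rfl

theorem prod_Ioc_insert (hat : a ≤ t) (htb : t < b) {c c' : ℕ → ℝ}
    (h1 : ∀ i ∈ Ioc a b, i ≤ t → c' i = c i) (h2 : ∀ i ∈ Ioc a b, t + 1 < i → c' (i + 1) = c i) :
    ∃ R : ℝ, ∏ i ∈ Ioc a (b + 1), c' i = R * (c' (t + 1) * c' (t + 2)) ∧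
      ∏ i ∈ Ioc a b, c i = R * c (t + 1) := by
  refine ⟨(∏ i ∈ Ioc a t, c i) * ∏ i ∈ Ioc (t + 1) b, c i, ?_, ?_⟩
  · rw [← prod_Ioc_consecutive c' hat (by omega : t ≤ b + 1),
      ← prod_Ioc_consecutive c' (by omega : t ≤ t + 2) (by omega : t + 2 ≤ b + 1),
      prod_congr rfl (g := c) fun i hi => h1 i (by simp at hi ⊢; omega) (by simp at hi; omega)]
    have e1 : ∏ i ∈ Ioc t (t + 2), c' i = c' (t + 1) * c' (t + 2) := by
      rw [prod_Ioc_succ_top (by omega), prod_Ioc_succ_top (by omega)]; simp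
    have e2 : ∏ i ∈ Ioc (t + 2) (b + 1), c' i = ∏ i ∈ Ioc (t + 1) b, c i := by
      rw [prod_Ioc_add_one]
      exact prod_congr rfl fun i hi => h2 i (by simp at hi ⊢; omega) (by simp at hi; omega)
    rw [e1, e2]; ring
  · rw [← prod_Ioc_consecutive c hat htb.le,
      ← prod_Ioc_consecutive c (by omega : t ≤ t + 1) (by omega : t + 1 ≤ b),
      prod_Ioc_succ_top (by omega)]
    simp; ring

/-- Insertion of an edge into an arc. -/
theorem arcSum_insert (hat : a ≤ t) (htb : t < b) (f : ℤˣ → ℤˣ)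
    (hl : ∀ i ∈ Ioc a b, i ≤ t → l' i = l i) (hl2 : ∀ i ∈ Ioc a b, t + 1 < i → l' (i + 1) = l i)
    (H0 : ∀ σ ∈ seqSigns ε (Ioo a b), ∀ s, s ≠ f (σ t) →
      coeffA w q 1 s (σ t) x (K t) (l' (t + 1)) = 0)
    (H : ∀ σ ∈ seqSigns ε (Ioo a b),
      ((coeffA w q 1 (f (σ t)) (σ t) x (K t) (l' (t + 1)) *
        coeffA w q 1 (σ (t + 1)) (f (σ t)) (K (t + 1)) x (l' (t + 2)) : ℝ) : ℂ) *
        Φ' (fun i => insSeq t x K i - (insSeq t (f (σ t)) σ i : ℤˣ)) * C =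
      ((coeffA w q 1 (σ (t + 1)) (σ t) (K (t + 1)) (K t) (l (t + 1)) : ℝ) : ℂ) *
        Φ fun i => K i - σ i) :
    arcSum w q l' (insSeq t x K) (insSeq t s₀ ε) a (b + 1) Φ' * C = arcSum w q l K ε a b Φ := by
  have hK1 : insSeq t x K t = K t := insSeq_of_le le_rfl
  have hK2 : insSeq t x K (t + 1) = x := insSeq_self
  have hK3 : insSeq t x K (t + 2) = K (t + 1) := insSeq_of_lt (by omega)
  unfold arcSum
  rw [Finset.sum_mul]
  symm
  apply Finset.sum_of_injOn (fun σ => insSeq t (f (σ t)) σ)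
  · intro σ _ τ _ h
    have ht : σ t = τ t := by simpa [insSeq_of_le] using congrFun h t
    exact insSeq_injective (x := f (σ t)) (by simpa [ht] using h)
  · intro σ hσ
    simp only [mem_coe, mem_seqSigns, mem_Ioo, not_and, not_lt] at hσ ⊢
    intro i hi
    rcases le_or_gt i t with h | h
    · rw [insSeq_of_le h, insSeq_of_le h]; exact hσ i (by omega)
    · obtain ⟨j, rfl⟩ := Nat.exists_eq_add_of_lt h
      rcases j with _ | j
      · exfalso; have := hi (by omega); omega
      · rw [insSeq_of_lt (by omega), insSeq_of_lt (by omega)]; exact hσ _ (by omega)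
  · intro σ' hσ' hn
    set σ : ℕ → ℤˣ := fun i => if i ≤ t then σ' i else σ' (i + 1) with hσ
    have hσt : σ t = σ' t := by simp [hσ]
    have hmem : σ ∈ seqSigns ε (Ioo a b) := by
      simp only [mem_seqSigns, mem_Ioo, not_and, not_lt] at hσ' ⊢
      intro i hi
      rcases le_or_gt i t with h | h
      · simp only [hσ, h, if_true]
        rw [hσ' i (by omega), insSeq_of_le h]
      · simp only [hσ, not_le.2 h, if_false]
        rw [hσ' (i + 1) (by omega), insSeq_of_lt h]
    have hs : σ' (t + 1) ≠ f (σ t) := fun h => hn ⟨σ, hmem, insSeq_delete σ' h⟩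
    have := H0 σ hmem _ hs
    rw [Finset.prod_eq_zero (i := t + 1) (by simp; omega)]
    · simp
    · simpa only [Nat.add_sub_cancel, hK1, hK2, hσt] using this
  · intro σ hσ
    have hs1 : insSeq t (f (σ t)) σ t = σ t := insSeq_of_le le_rfl
    have hs2 : insSeq t (f (σ t)) σ (t + 1) = f (σ t) := insSeq_self
    have hs3 : insSeq t (f (σ t)) σ (t + 2) = σ (t + 1) := insSeq_of_lt (by omega)
    obtain ⟨R, e1, e2⟩ := prod_Ioc_insert hat htb
      (c := fun i => coeffA w q 1 (σ i) (σ (i - 1)) (K i) (K (i - 1)) (l i))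
      (c' := fun i => coeffA w q 1 (insSeq t (f (σ t)) σ i) (insSeq t (f (σ t)) σ (i - 1))
        (insSeq t x K i) (insSeq t x K (i - 1)) (l' i))
      (fun i hi hit => by
        have h1 : i - 1 ≤ t := by omega
        simp only [insSeq_of_le hit, insSeq_of_le h1, hl i hi hit])
      (fun i hi hit => by
        obtain ⟨j, rfl⟩ : ∃ j, i = j + 1 := ⟨i - 1, by omega⟩
        have h1 : t < j := by omega
        have h2 : t < j + 1 := by omega
        simp only [Nat.add_sub_cancel, insSeq_of_lt h1, insSeq_of_lt h2, hl2 _ hi hit])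
    rw [e1, e2]
    have := H σ hσ
    simp only [Nat.add_sub_cancel, show t + 2 - 1 = t + 1 from rfl, hK1, hK2, hK3, hs1, hs2, hs3]
    push_cast at this ⊢
    rw [mul_assoc, ← this]
    ring

/-- Insertion of an edge before an arc. -/
theorem arcSum_insert_before (hta : t < a) (hl2 : ∀ i ∈ Ioc a b, l' (i + 1) = l i)
    (H : ∀ σ ∈ seqSigns ε (Ioo a b),
      Φ' (fun i => insSeq t x K i - (insSeq t s₀ σ i : ℤˣ)) * C = Φ fun i => K i - σ i) :
    arcSum w q l' (insSeq t x K) (insSeq t s₀ ε) (a + 1) (b + 1) Φ' * C =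
      arcSum w q l K ε a b Φ := by
  unfold arcSum
  rw [Finset.sum_mul]
  symm
  apply Finset.sum_of_injOn (fun σ => insSeq t s₀ σ)
  · exact fun σ _ τ _ h => insSeq_injective h
  · intro σ hσ
    simp only [mem_coe, mem_seqSigns, mem_Ioo, not_and, not_lt] at hσ ⊢
    intro i hi
    rcases le_or_gt i t with h | h
    · rw [insSeq_of_le h, insSeq_of_le h]; exact hσ i (by omega)
    · obtain ⟨j, rfl⟩ := Nat.exists_eq_add_of_lt h
      rcases j with _ | j
      · exact insSeq_self.trans insSeq_self.symm
      · rw [insSeq_of_lt (by omega), insSeq_of_lt (by omega)]; exact hσ _ (by omega)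
  · intro σ' hσ' hn
    refine absurd ⟨fun i => if i ≤ t then σ' i else σ' (i + 1), ?_, insSeq_delete σ' ?_⟩ hn
    · simp only [mem_coe, mem_seqSigns, mem_Ioo, not_and, not_lt] at hσ' ⊢
      intro i hi
      rcases le_or_gt i t with h | h
      · simp only [h, if_true]
        rw [hσ' i (by omega), insSeq_of_le h]
      · simp only [not_le.2 h, if_false]
        rw [hσ' (i + 1) (by omega), insSeq_of_lt h]
    · simp only [mem_seqSigns, mem_Ioo, not_and, not_lt] at hσ'
      rw [hσ' (t + 1) (by omega), insSeq_self]
  · intro σ hσ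
    rw [mul_assoc, H σ hσ, prod_Ioc_add_one]
    congr 2
    refine prod_congr rfl fun i hi => ?_
    obtain ⟨j, rfl⟩ : ∃ j, i = j + 1 := ⟨i - 1, by simp at hi; omega⟩
    have h1 : t < j := by simp at hi; omega
    have h2 : t < j + 1 := by omega
    simp only [Nat.add_sub_cancel, insSeq_of_lt h1, insSeq_of_lt h2, hl2 _ hi]

/-- Insertion of an edge after an arc. -/
theorem arcSum_insert_after (hbt : b ≤ t) (hl : ∀ i ∈ Ioc a b, l' i = l i)
    (H : ∀ σ ∈ seqSigns ε (Ioo a b),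
      Φ' (fun i => insSeq t x K i - (insSeq t s₀ σ i : ℤˣ)) * C = Φ fun i => K i - σ i) :
    arcSum w q l' (insSeq t x K) (insSeq t s₀ ε) a b Φ' * C = arcSum w q l K ε a b Φ := by
  unfold arcSum
  rw [Finset.sum_mul]
  symm
  apply Finset.sum_of_injOn (fun σ => insSeq t s₀ σ)
  · exact fun σ _ τ _ h => insSeq_injective h
  · intro σ hσ
    simp only [mem_coe, mem_seqSigns, mem_Ioo, not_and, not_lt] at hσ ⊢
    intro i hi
    rcases le_or_gt i t with h | h
    · rw [insSeq_of_le h, insSeq_of_le h]; exact hσ i (by omega)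
    · obtain ⟨j, rfl⟩ := Nat.exists_eq_add_of_lt h
      rcases j with _ | j
      · exact insSeq_self.trans insSeq_self.symm
      · rw [insSeq_of_lt (by omega), insSeq_of_lt (by omega)]; exact hσ _ (by omega)
  · intro σ' hσ' hn
    refine absurd ⟨fun i => if i ≤ t then σ' i else σ' (i + 1), ?_, insSeq_delete σ' ?_⟩ hn
    · simp only [mem_coe, mem_seqSigns, mem_Ioo, not_and, not_lt] at hσ' ⊢
      intro i hi
      rcases le_or_gt i t with h | h
      · simp only [h, if_true]
        rw [hσ' i (by omega), insSeq_of_le h]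
      · simp only [not_le.2 h, if_false]
        rw [hσ' (i + 1) (by omega), insSeq_of_lt h]
    · simp only [mem_seqSigns, mem_Ioo, not_and, not_lt] at hσ'
      rw [hσ' (t + 1) (by omega), insSeq_self]
  · intro σ hσ
    rw [mul_assoc, H σ hσ]
    congr 2
    refine prod_congr rfl fun i hi => ?_
    have h1 : i ≤ t := by simp at hi; omega
    have h2 : i - 1 ≤ t := by omega
    simp only [insSeq_of_le h1, insSeq_of_le h2, hl _ hi]

/-- Comparison of two sums over the same arc. -/
theorem arcSum_mul_congr (hl : ∀ i ∈ Ioc a b, l' i = l i)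
    (H : ∀ σ ∈ seqSigns ε (Ioo a b), Φ' (fun i => K i - σ i) * C = Φ fun i => K i - σ i) :
    arcSum w q l' K ε a b Φ' * C = arcSum w q l K ε a b Φ := by
  unfold arcSum
  rw [Finset.sum_mul]
  refine sum_congr rfl fun σ hσ => ?_
  rw [mul_assoc, H σ hσ]
  congr 2
  exact prod_congr rfl fun i hi => by rw [hl i hi]

end Sequences

theorem sum_seqSigns_neg {ε : ℕ → ℤˣ} {S : Finset ℕ} (F : (ℕ → ℤˣ) → ℂ) :
    ∑ σ ∈ seqSigns ε S, F (fun i => -σ i) = ∑ σ ∈ seqSigns (fun i => -ε i) S, F σ := by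
  apply Finset.sum_nbij' (fun σ i => -σ i) (fun σ i => -σ i)
  · intro σ hσ
    rw [mem_seqSigns] at hσ ⊢
    exact fun i hi => by rw [hσ i hi]
  · intro σ hσ
    rw [mem_seqSigns] at hσ ⊢
    exact fun i hi => by rw [hσ i hi, neg_neg]
  · intro σ _; simp
  · intro σ _; simp
  · intro σ _; rfl

theorem unit_cast_mul_self (s : ℤˣ) : ((s : ℤ) : ℂ) * ((s : ℤ) : ℂ) = 1 := by
  rcases Int.units_eq_one_or s with rfl | rfl <;> simp

namespace TrivalentMap

variable {D : Type*} (G : TrivalentMap D)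

theorem around_injOn (d : D) : Set.InjOn (G.around d) (Set.Iio (G.faceDegree d)) :=
  Function.iterate_injOn_Iio_minimalPeriod

theorem around_zero (d : D) : G.around d 0 = d := rfl

theorem around_succ (d : D) (i : ℕ) : G.around d (i + 1) = G.next (G.around d i) :=
  Function.iterate_succ_apply' _ _ _

theorem around_faceDegree (d : D) : G.around d (G.faceDegree d) = d :=
  Function.iterate_minimalPeriod

theorem next_apply (d : D) : G.next d = G.rot (G.rev d) := rfl

theorem faceDegree_pos [Finite D] (d : D) : 0 < G.faceDegree d :=
  Function.minimalPeriod_pos_of_mem_periodicPts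
    (Function.Injective.mem_periodicPts G.next.injective d)

variable [DecidableEq D]

/-- The labelling obtained from `k` when the labels of the edges of the face on the left of `d`
are replaced by `κ 0, κ 1, …`. -/
noncomputable def faceLabels (d : D) (k : D → ℤ) (κ : ℕ → ℤ) (x : D) : ℤ :=
  k x + ∑ i ∈ range (G.faceDegree d),
    ((if G.around d i = x then κ i - k (G.around d i) else 0) +
      if G.around d i = G.rev x then κ i - k (G.around d i) else 0)

theorem sum_ite_around (d x : D) (u : D → ℤ) :
    (∑ i ∈ range (G.faceDegree d), if G.around d i = x then u (G.around d i) else 0) =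
      if x ∈ G.face d then u x else 0 := by
  split_ifs with h
  · obtain ⟨j, hj, rfl⟩ := Finset.mem_image.1 h
    rw [Finset.sum_eq_single_of_mem j hj]
    · simp
    · intro i hi hij
      exact if_neg fun e => hij (G.around_injOn d (by simpa using hi) (by simpa using hj) e)
  · exact Finset.sum_eq_zero fun i hi => if_neg fun e =>
      h (Finset.mem_image.2 ⟨i, hi, e⟩)

theorem shift_eq_faceLabels (d : D) (k u : D → ℤ) :
    G.shift d k u = G.faceLabels d k fun i => k (G.around d i) + u (G.around d i) := by
  funext x
  simp only [shift, faceLabels, add_sub_cancel_left, sum_add_distrib, sum_ite_around]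
  ring

theorem faceLabels_congr {d : D} {k : D → ℤ} {κ κ' : ℕ → ℤ}
    (h : ∀ i < G.faceDegree d, κ i = κ' i) : G.faceLabels d k κ = G.faceLabels d k κ' := by
  funext x
  unfold faceLabels
  congr 1
  exact Finset.sum_congr rfl fun i hi => by rw [h i (by simpa using hi)]

end TrivalentMap

variable {D : Type*} [Fintype D] [DecidableEq D]

theorem sum_signsAgreeing {e : ℕ → D} {n : ℕ} (hinj : Set.InjOn e (Set.Iio n)) (hn : e n = e 0)
    {S : Finset ℕ} (hS : S ⊆ Ioo 0 n) (ε : D → ℤˣ) (F : (ℕ → ℤˣ) → ℂ)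
    (hF : ∀ σ τ : ℕ → ℤˣ, (∀ i ≤ n, σ i = τ i) → F σ = F τ) :
    ∑ η ∈ TrivalentMap.signsAgreeing ε (S.image e), F (fun i => η (e i)) =
      ∑ σ ∈ seqSigns (fun i => ε (e i)) S, F σ := by
  have hS' : ∀ i ∈ S, i ∈ Set.Iio n := fun i hi => (Finset.mem_Ioo.1 (hS hi)).2
  have himg : ∀ i ≤ n, e i ∈ S.image e → i ∈ S := by
    intro i hi h
    obtain ⟨j, hj, hji⟩ := Finset.mem_image.1 h
    rcases hi.eq_or_lt with rfl | hi
    · rw [hn] at hji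
      have := hinj (hS' j hj) (show 0 < i from (Nat.zero_le _).trans_lt (hS' j hj)) hji
      have := Finset.mem_Ioo.1 (hS hj)
      omega
    · rwa [← hinj (hS' j hj) hi hji]
  apply Finset.sum_of_injOn fun η i => if i ∈ S then η (e i) else ε (e i)
  · intro η hη η' hη' h
    simp only [TrivalentMap.signsAgreeing, coe_filter, mem_univ, true_and, Set.mem_ofPred_eq]
      at hη hη'
    funext x
    by_cases hx : x ∈ S.image e
    · obtain ⟨j, hj, rfl⟩ := Finset.mem_image.1 hx
      simpa [hj] using congrFun h j
    · rw [hη x hx, hη' x hx]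
  · intro η hη
    rw [mem_coe, mem_seqSigns]
    exact fun i hi => if_neg hi
  · intro σ hσ hno
    rw [mem_seqSigns] at hσ
    classical
    refine absurd ⟨fun x => if h : ∃ i ∈ S, e i = x then σ h.choose else ε x, ?_, ?_⟩ hno
    · simp only [TrivalentMap.signsAgreeing, coe_filter, mem_univ, true_and, Set.mem_ofPred_eq]
      intro x hx
      exact dif_neg fun ⟨i, hi, h⟩ => hx (Finset.mem_image.2 ⟨i, hi, h⟩)
    · funext i
      by_cases hi : i ∈ S
      · have h : ∃ j ∈ S, e j = e i := ⟨i, hi, rfl⟩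
        simp only [hi, if_true]
        rw [dif_pos h, hinj (hS' _ h.choose_spec.1) (hS' i hi) h.choose_spec.2]
      · simp only [hi, if_false, hσ i hi]
  · intro η hη
    simp only [TrivalentMap.signsAgreeing, mem_filter, mem_univ, true_and] at hη
    apply hF
    intro i hi
    split_ifs with h
    · rfl
    · exact hη _ fun h' => h (himg i hi h')

namespace TrivalentMap

variable (G : TrivalentMap D)

/-- The two arcs of a difference equation, each as a sum over sign sequences. -/
theorem constraint_eq_arcSum (w : Ordering) (q : ℝ) (o : D → ℤˣ) (ψ : G.State) (d : D) {r : ℕ}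
    (hr : r < G.faceDegree d) (ε : D → ℤˣ) (k : D → ℤ) :
    G.constraint w q o ψ d r ε k =
      (∏ i ∈ Ioc 0 r, ((o (G.around d i) : ℤ) : ℂ)) *
        arcSum w q (fun i => k (G.rot (G.around d i))) (fun i => k (G.around d i))
          (fun i => ε (G.around d i)) 0 r (fun κ => ψ.coeff (G.faceLabels d k κ)) -
      ((coeffAlpha w q (ε (G.around d 0)) (ε (G.around d r)) (k (G.around d 0))
          (k (G.around d r)) : ℝ) : ℂ) *
        (∏ i ∈ Ioc r (G.faceDegree d), ((o (G.around d i) : ℤ) : ℂ)) *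
        arcSum w q (fun i => k (G.rot (G.around d i)))
          (fun i => k (G.around d i) - ε (G.around d i))
          (fun i => -ε (G.around d i)) r (G.faceDegree d)
          (fun κ => ψ.coeff (G.faceLabels d k κ)) := by
  have hn0 : G.around d (G.faceDegree d) = G.around d 0 := G.around_faceDegree d
  have hinj := G.around_injOn d
  unfold constraint
  simp only
  generalize hn : G.faceDegree d = n at *
  generalize he : G.around d = e at *
  have key : ∀ κ κ' : ℕ → ℤ, (∀ i < n, κ i = κ' i) →
      ψ.coeff (G.faceLabels d k κ) = ψ.coeff (G.faceLabels d k κ') := fun κ κ' h => by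
    rw [G.faceLabels_congr (by rwa [hn])]
  rw [sub_eq_add_neg]
  congr 1
  · have h1 := sum_signsAgreeing hinj hn0 (S := Ioo 0 r)
      (fun i hi => by simp at hi ⊢; omega) ε
      (fun σ => ((∏ i ∈ Icc 1 r, coeffA w q (o (e i)) (σ i) (σ (i - 1)) (k (e i)) (k (e (i - 1)))
        (k (G.rot (e i))) : ℝ) : ℂ) * ψ.coeff (G.faceLabels d k fun i => k (e i) - σ i))
      (fun σ τ h => by
        rw [key _ (fun i => k (e i) - τ i) fun i hi => by rw [h i hi.le]]
        congr 2
        refine prod_congr rfl fun i hi => ?_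
        rw [mem_Icc] at hi
        rw [h i (by omega), h (i - 1) (by omega)])
    have h2 : ∀ η : D → ℤˣ, G.shift d k (fun x => -(η x : ℤ)) =
        G.faceLabels d k fun i => k (e i) - η (e i) := fun η => by
      rw [shift_eq_faceLabels, he]; rfl
    simp only [h2]
    rw [h1, arcSum, Finset.mul_sum]
    refine sum_congr rfl fun σ _ => ?_
    rw [← mul_assoc]
    congr 1
    have h3 : Icc 1 r = Ioc 0 r := rfl
    rw [h3]
    simp only [coeffA_eq_orientation_mul w (o _)]
    rw [prod_mul_distrib]
    push_cast
    rfl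
  · have h1 := sum_signsAgreeing hinj hn0 (S := Ioo r n)
      (fun i hi => by simp at hi ⊢; omega) ε
      (fun σ => ((∏ i ∈ Icc (r + 1) n, coeffB w q (o (e i)) (σ i) (σ (i - 1))
        (k (e i) - ε (e i)) (k (e (i - 1)) - ε (e (i - 1)))
        (k (G.rot (e i))) : ℝ) : ℂ) *
          ψ.coeff (G.faceLabels d k fun i => k (e i) + (σ i - ε (e i))))
      (fun σ τ h => by
        rw [key _ (fun i => k (e i) + (τ i - ε (e i))) fun i hi => by rw [h i hi.le]]
        congr 2
        refine prod_congr rfl fun i hi => ?_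
        rw [mem_Icc] at hi
        rw [h i (by omega), h (i - 1) (by omega)])
    have h2 : ∀ η : D → ℤˣ, G.shift d k (fun x => (η x : ℤ) - (ε x : ℤ)) =
        G.faceLabels d k fun i => k (e i) + (η (e i) - ε (e i)) := fun η => by
      rw [shift_eq_faceLabels, he]
    simp only [h2]
    rw [h1, arcSum, ← sum_seqSigns_neg, Finset.mul_sum, Finset.mul_sum, ← sum_neg_distrib]
    refine sum_congr rfl fun σ _ => ?_
    have h3 : Icc (r + 1) n = Ioc r n := by ext; simp
    have h4 : (fun i => k (e i) + ((σ i : ℤ) - ε (e i))) =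
        fun i => k (e i) - ε (e i) - ((-σ i : ℤˣ) : ℤ) := by
      funext i; simp only [Units.val_neg]; ring
    have h5 : (-1 : ℂ) ^ (n - r) = -(-1 : ℂ) ^ (n - (r + 1)) := by
      rw [show n - r = n - (r + 1) + 1 by omega, pow_succ]; ring
    have h6 : (-1 : ℂ) ^ (n - (r + 1)) * (-1 : ℂ) ^ (n - (r + 1)) = 1 := by
      rw [← pow_add, Even.neg_one_pow ⟨_, rfl⟩]
    rw [h3, h4]
    simp only [coeffB_eq_coeffA, neg_eq_neg_one_mul (((o _ : ℤˣ) : ℝ) * _)]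
    rw [prod_mul_distrib, prod_mul_distrib, prod_const, Nat.card_Ioc]
    push_cast
    rw [h5]
    linear_combination (-((coeffAlpha w q (ε (e 0)) (ε (e r)) (k (e 0)) (k (e r)) : ℝ) : ℂ) *
      (∏ i ∈ Ioc r n, ((o (e i) : ℤ) : ℂ)) *
      (∏ i ∈ Ioc r n, ((coeffA w q 1 (-σ i) (-σ (i - 1)) (k (e i) - ε (e i))
        (k (e (i - 1)) - ε (e (i - 1))) (k (G.rot (e i))) : ℝ) : ℂ)) *
      ψ.coeff (G.faceLabels d k fun i => k (e i) - ε (e i) - ((-σ i : ℤˣ) : ℤ))) * h6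

theorem constraint_eq_zero_iff (w : Ordering) (q : ℝ) (o : D → ℤˣ) (ψ : G.State) (d : D) {r : ℕ}
    (hr : r < G.faceDegree d) (ε : D → ℤˣ) (k : D → ℤ) :
    G.constraint w q o ψ d r ε k = 0 ↔
      arcSum w q (fun i => k (G.rot (G.around d i))) (fun i => k (G.around d i))
          (fun i => ε (G.around d i)) 0 r (fun κ => ψ.coeff (G.faceLabels d k κ)) =
      ((coeffAlpha w q (ε (G.around d 0)) (ε (G.around d r)) (k (G.around d 0))
          (k (G.around d r)) : ℝ) : ℂ) *
        (∏ i ∈ range (G.faceDegree d), ((o (G.around d i) : ℤ) : ℂ)) *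
        arcSum w q (fun i => k (G.rot (G.around d i)))
          (fun i => k (G.around d i) - ε (G.around d i))
          (fun i => -ε (G.around d i)) r (G.faceDegree d)
          (fun κ => ψ.coeff (G.faceLabels d k κ)) := by
  rw [G.constraint_eq_arcSum w q o ψ d hr]
  have hP : ∏ i ∈ range (G.faceDegree d), ((o (G.around d i) : ℤ) : ℂ) =
      (∏ i ∈ Ioc 0 r, ((o (G.around d i) : ℤ) : ℂ)) *
        ∏ i ∈ Ioc r (G.faceDegree d), ((o (G.around d i) : ℤ) : ℂ) := by
    rw [prod_Ioc_consecutive _ (Nat.zero_le r) hr.le]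
    obtain ⟨m, hm⟩ : ∃ m, G.faceDegree d = m + 1 := ⟨_, (Nat.succ_pred_eq_of_pos (by omega)).symm⟩
    have h0 := G.around_faceDegree d
    rw [hm] at h0 ⊢
    rw [prod_range_succ', prod_Ioc_succ_top (by omega), h0]
    congr 1
    rw [range_eq_Ico, prod_Ico_add' (fun i => ((o (G.around d i) : ℤ) : ℂ)) 0 m 1]
    rfl
  have hR : (∏ i ∈ Ioc 0 r, ((o (G.around d i) : ℤ) : ℂ)) *
      ∏ i ∈ Ioc 0 r, ((o (G.around d i) : ℤ) : ℂ) = 1 := by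
    rw [← prod_mul_distrib]
    exact prod_eq_one fun i _ => unit_cast_mul_self _
  rw [hP]
  generalize (∏ i ∈ Ioc 0 r, ((o (G.around d i) : ℤ) : ℂ)) = p at hR ⊢
  constructor
  · intro h
    linear_combination p * h - arcSum w q (fun i => k (G.rot (G.around d i)))
      (fun i => k (G.around d i)) (fun i => ε (G.around d i)) 0 r
      (fun κ => ψ.coeff (G.faceLabels d k κ)) * hR
  · intro h
    rw [h]
    linear_combination ((coeffAlpha w q (ε (G.around d 0)) (ε (G.around d r)) (k (G.around d 0))
          (k (G.around d r)) : ℝ) : ℂ) *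
        (∏ i ∈ Ioc r (G.faceDegree d), ((o (G.around d i) : ℤ) : ℂ)) *
        arcSum w q (fun i => k (G.rot (G.around d i)))
          (fun i => k (G.around d i) - ε (G.around d i))
          (fun i => -ε (G.around d i)) r (G.faceDegree d)
          (fun κ => ψ.coeff (G.faceLabels d k κ)) * hR

end TrivalentMap

section Iterate

variable {X Y : Type*} {f : X → X} {g : Y → Y} {θ : X → Y} {P : X → Prop} {s d : X} {y₀ : Y}

theorem minimalPeriod_le_of_iterate_eq {α : Type*} {h : α → α} {x : α} {m : ℕ} (hm : 0 < m)
    (e : h^[m] x = x) : Function.minimalPeriod h x ≤ m :=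
  Function.IsPeriodicPt.minimalPeriod_le hm e

/-- An orbit that arises from another one by the insertion of the point `y₀` after the point
`s`. -/
theorem iterate_insert (hP : ∀ x, P x → P (f x))
    (h1 : ∀ x, P x → x ≠ s → g (θ x) = θ (f x)) (h2 : g (θ s) = y₀) (h3 : g y₀ = θ (f s))
    (hd : P d) {t : ℕ} (ht : f^[t] d = s) (htn : t < Function.minimalPeriod f d) (i : ℕ)
    (hi : i ≤ Function.minimalPeriod f d + 1) :
    g^[i] (θ d) = insSeq t y₀ (fun j => θ (f^[j] d)) i := by
  have hPi : ∀ i, P (f^[i] d) := fun i => by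
    induction i with
    | zero => exact hd
    | succ i ih => rw [Function.iterate_succ_apply']; exact hP _ ih
  have hne : ∀ i, i < Function.minimalPeriod f d → i ≠ t → f^[i] d ≠ s := fun i hi hit h =>
    hit (Function.iterate_injOn_Iio_minimalPeriod hi htn (h.trans ht.symm))
  induction i with
  | zero => rfl
  | succ i ih =>
    rw [Function.iterate_succ_apply', ih (by omega)]
    rcases lt_trichotomy i t with h | rfl | h
    · rw [insSeq_of_le h.le, insSeq_of_le (Nat.succ_le_of_lt h),
        h1 _ (hPi i) (hne i (by omega) h.ne), Function.iterate_succ_apply']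
    · rw [insSeq_of_le le_rfl, insSeq_self, ht, h2]
    · obtain ⟨j, rfl⟩ : ∃ j, i = j + 1 := ⟨i - 1, by omega⟩
      rcases Nat.lt_or_ge t j with h' | h'
      · rw [insSeq_of_lt h', insSeq_of_lt h, h1 _ (hPi j) (hne j (by omega) h'.ne'),
          Function.iterate_succ_apply']
      · obtain rfl : t = j := by omega
        rw [insSeq_self, insSeq_of_lt h, h3, Function.iterate_succ_apply', ht]

theorem minimalPeriod_insert (hθ : Function.Injective θ) (hy : ∀ x, θ x ≠ y₀)
    (hP : ∀ x, P x → P (f x))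
    (h1 : ∀ x, P x → x ≠ s → g (θ x) = θ (f x)) (h2 : g (θ s) = y₀) (h3 : g y₀ = θ (f s))
    (hd : P d) {t : ℕ} (ht : f^[t] d = s) (htn : t < Function.minimalPeriod f d) :
    Function.minimalPeriod g (θ d) = Function.minimalPeriod f d + 1 := by
  have key := iterate_insert hP h1 h2 h3 hd ht htn
  have hper : g^[Function.minimalPeriod f d + 1] (θ d) = θ d := by
    rw [key _ le_rfl, insSeq_of_lt htn, Function.iterate_minimalPeriod]
  apply le_antisymm (minimalPeriod_le_of_iterate_eq (Nat.succ_pos _) hper)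
  by_contra! hlt
  have hpos : 0 < Function.minimalPeriod g (θ d) :=
    Function.minimalPeriod_pos_of_mem_periodicPts ⟨_, Nat.succ_pos _, hper⟩
  have hm := key (Function.minimalPeriod g (θ d)) hlt.le
  rw [Function.iterate_minimalPeriod] at hm
  generalize Function.minimalPeriod g (θ d) = m at *
  rcases lt_trichotomy m (t + 1) with h | rfl | h
  · rw [insSeq_of_le (by omega)] at hm
    have := minimalPeriod_le_of_iterate_eq hpos (hθ hm).symm
    omega
  · rw [insSeq_self] at hm
    exact hy _ hm
  · obtain ⟨j, rfl⟩ : ∃ j, m = j + 1 := ⟨m - 1, by omega⟩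
    rw [insSeq_of_lt (by omega)] at hm
    have := minimalPeriod_le_of_iterate_eq (by omega) (hθ hm).symm
    omega

theorem iterate_semiconj (hP : ∀ x, P x → P (f x)) (h1 : ∀ x, P x → g (θ x) = θ (f x))
    (hd : P d) (i : ℕ) : g^[i] (θ d) = θ (f^[i] d) := by
  have hPi : ∀ i, P (f^[i] d) := fun i => by
    induction i with
    | zero => exact hd
    | succ i ih => rw [Function.iterate_succ_apply']; exact hP _ ih
  induction i with
  | zero => rfl
  | succ i ih => rw [Function.iterate_succ_apply', ih, h1 _ (hPi i), Function.iterate_succ_apply']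

theorem minimalPeriod_semiconj (hθ : Function.Injective θ) (hP : ∀ x, P x → P (f x))
    (h1 : ∀ x, P x → g (θ x) = θ (f x)) (hd : P d) :
    Function.minimalPeriod g (θ d) = Function.minimalPeriod f d := by
  have key := iterate_semiconj hP h1 hd
  apply Function.minimalPeriod_eq_minimalPeriod_iff.2
  intro n
  rw [Function.IsPeriodicPt, Function.IsFixedPt, key, Function.IsPeriodicPt, Function.IsFixedPt,
    hθ.eq_iff]

end Iterate

namespace TrivalentMap

variable {D : Type*} (G : TrivalentMap D)

theorem sameCycle_next {x y : D} : G.next.SameCycle (G.next x) y ↔ G.next.SameCycle x y :=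
  Equiv.Perm.sameCycle_apply_left

theorem sameCycle_around (d : D) (i : ℕ) : G.next.SameCycle (G.around d i) d := by
  induction i with
  | zero => exact Equiv.Perm.SameCycle.refl _ _
  | succ i ih => rw [around_succ, sameCycle_next]; exact ih

variable [DecidableEq D] {G} {d₀ : D}

/-- The darts around an edge `d₀` that can be removed, with a triangle on its left. -/
structure Triangle (G : TrivalentMap D) (d₀ a b c e₃ e₄ : D) : Prop where
  rot_rev : G.rot (G.rev d₀) = a
  rot_a : G.rot a = e₄
  rot_e₄ : G.rot e₄ = G.rev d₀
  rot_d₀ : G.rot d₀ = e₃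
  rot_e₃ : G.rot e₃ = G.rev b
  rot_rev_b : G.rot (G.rev b) = d₀
  rot_rev_a : G.rot (G.rev a) = b
  rot_b : G.rot b = c
  rot_c : G.rot c = G.rev a

theorem triangle_of_faceDegree (htri : G.faceDegree d₀ = 3) :
    Triangle G d₀ (G.rot (G.rev d₀)) (G.rot (G.rev (G.rot (G.rev d₀))))
      (G.rot (G.rot (G.rev (G.rot (G.rev d₀))))) (G.rot d₀) (G.rot (G.rot (G.rev d₀))) := by
  have h3 : G.rot (G.rev (G.rot (G.rev (G.rot (G.rev d₀))))) = d₀ := by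
    have := G.around_faceDegree d₀
    rw [htri] at this
    exact this
  refine ⟨rfl, rfl, G.rot_rot_rot _, rfl, ?_, h3, rfl, rfl, G.rot_rot_rot _⟩
  conv_lhs => rw [← h3]
  exact G.rot_rot_rot _

namespace Triangle

variable {a b c e₃ e₄ : D} (T : Triangle G d₀ a b c e₃ e₄)
include T

theorem mem_ends {x : D} : x ∈ G.ends d₀ ↔
    x = d₀ ∨ x = e₃ ∨ x = G.rev b ∨ x = G.rev d₀ ∨ x = a ∨ x = e₄ := by
  simp [ends, T.rot_d₀, T.rot_e₃, T.rot_rev, T.rot_a]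

end Triangle

end TrivalentMap

namespace TrivalentMap

variable {D : Type*} {G : TrivalentMap D} {d₀ : D}

/-- The face on the left of a dart. -/
def faceClass (G : TrivalentMap D) (x : D) : Quotient (Equiv.Perm.SameCycle.setoid G.next) :=
  Quotient.mk _ x

theorem faceClass_eq_iff {x y : D} : G.faceClass x = G.faceClass y ↔ G.next.SameCycle x y :=
  Quotient.eq

theorem faceClass_next (x : D) : G.faceClass (G.next x) = G.faceClass x :=
  faceClass_eq_iff.2 ((sameCycle_next G).2 (Equiv.Perm.SameCycle.refl _ _))

theorem faceClass_rot (x : D) : G.faceClass (G.rot x) = G.faceClass (G.rev x) := by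
  rw [← faceClass_next (G.rev x), next_apply, G.rev_rev]

theorem faceClass_around (d : D) (i : ℕ) : G.faceClass (G.around d i) = G.faceClass d :=
  faceClass_eq_iff.2 (G.sameCycle_around d i)

theorem FacesEmbedded.faceClass_rev_ne (hG : G.FacesEmbedded) (x : D) :
    G.faceClass (G.rev x) ≠ G.faceClass x := fun h => (hG x).1 (faceClass_eq_iff.1 h.symm)

variable [DecidableEq D]

theorem extendLabels_kept (k : G.Kept d₀ → ℤ) (x : G.Kept d₀) : G.extendLabels d₀ k x = k x :=
  dif_pos x.2

theorem extendLabels_d₀ (k : G.Kept d₀ → ℤ) : G.extendLabels d₀ k d₀ = 0 := by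
  simp [extendLabels, ends]

theorem extendLabels_rev_d₀ (k : G.Kept d₀ → ℤ) : G.extendLabels d₀ k (G.rev d₀) = 0 := by
  simp [extendLabels, ends]

namespace Triangle

variable {a b c e₃ e₄ : D} (T : Triangle G d₀ a b c e₃ e₄)
include T

theorem class_a : G.faceClass a = G.faceClass d₀ := by
  rw [← T.rot_rev, faceClass_rot, G.rev_rev]

theorem class_b : G.faceClass b = G.faceClass d₀ := by
  rw [← T.rot_rev_a, faceClass_rot, G.rev_rev, T.class_a]

theorem class_rev_d₀ : G.faceClass (G.rev d₀) = G.faceClass e₃ := by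
  rw [← T.rot_d₀, faceClass_rot]

theorem class_rev_e₄ : G.faceClass (G.rev e₄) = G.faceClass e₃ := by
  rw [← faceClass_rot, T.rot_e₄, T.class_rev_d₀]

theorem class_rev_a : G.faceClass (G.rev a) = G.faceClass e₄ := by
  rw [← faceClass_rot, T.rot_a]

theorem class_rev_c : G.faceClass (G.rev c) = G.faceClass e₄ := by
  rw [← faceClass_rot, T.rot_c, T.class_rev_a]

theorem class_rev_b : G.faceClass (G.rev b) = G.faceClass c := by
  rw [← faceClass_rot, T.rot_b]

theorem class_rev_e₃ : G.faceClass (G.rev e₃) = G.faceClass c := by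
  rw [← faceClass_rot, T.rot_e₃, T.class_rev_b]

variable (hG : G.FacesEmbedded)
include hG

/-- The four faces around the triangle and its edge `d₀` are distinct. -/
theorem class_ne : G.faceClass d₀ ≠ G.faceClass e₃ ∧ G.faceClass d₀ ≠ G.faceClass e₄ ∧
    G.faceClass d₀ ≠ G.faceClass c ∧ G.faceClass e₃ ≠ G.faceClass e₄ ∧
    G.faceClass e₃ ≠ G.faceClass c ∧ G.faceClass e₄ ≠ G.faceClass c := by
  refine ⟨fun h => hG.faceClass_rev_ne d₀ ?_, fun h => hG.faceClass_rev_ne a ?_,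
    fun h => hG.faceClass_rev_ne b ?_, fun h => hG.faceClass_rev_ne e₄ ?_,
    fun h => hG.faceClass_rev_ne e₃ ?_, fun h => hG.faceClass_rev_ne c ?_⟩
  · rw [T.class_rev_d₀, h]
  · rw [T.class_rev_a, T.class_a, h]
  · rw [T.class_rev_b, T.class_b, h]
  · rw [T.class_rev_e₄, h]
  · rw [T.class_rev_e₃, h]
  · rw [T.class_rev_c, h]

variable (h : G.Removable d₀)
include h

theorem kept : G.rev a ∉ G.ends d₀ ∧ G.rev e₄ ∉ G.ends d₀ ∧ G.rev e₃ ∉ G.ends d₀ ∧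
    b ∉ G.ends d₀ ∧ c ∉ G.ends d₀ := by
  obtain ⟨n1, n2, n3, n4, n5, n6⟩ := T.class_ne hG
  have ca := T.class_a
  have cb := T.class_b
  have c0 := T.class_rev_d₀
  have cb' := T.class_rev_b
  have hb : b ∉ G.ends d₀ := by
    have := h.far (G.rev b) (T.mem_ends.2 (by simp)) (fun e => n3 (by rw [← cb', e]))
      (fun e => n5 (by rw [← cb', ← c0, e]))
    rwa [G.rev_rev] at this
  refine ⟨h.far _ (T.mem_ends.2 (by simp)) ?_ ?_, h.far _ (T.mem_ends.2 (by simp)) ?_ ?_,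
    h.far _ (T.mem_ends.2 (by simp)) ?_ ?_, hb, ?_⟩
  · rintro rfl
    exact h.ne_rot_rot (by rw [T.rot_a, T.rot_e₄])
  · rintro e
    exact G.rot_ne (G.rev d₀) (by rw [T.rot_rev, e])
  · rintro rfl; exact n2 rfl
  · rintro rfl; exact n4 (by rw [c0])
  · rintro rfl; exact n1 rfl
  · rintro rfl; exact h.ne_rot T.rot_d₀.symm
  · rw [← T.rot_b, G.rot_mem_ends]; exact hb

theorem distinct : d₀ ≠ a ∧ d₀ ≠ b ∧ a ≠ b ∧ G.rev d₀ ≠ e₃ ∧ G.rev a ≠ e₄ ∧ G.rev e₄ ≠ e₃ ∧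
    G.rev e₃ ≠ c ∧ G.rev b ≠ c ∧ G.rev c ∉ G.ends d₀ := by
  obtain ⟨n1, n2, n3, n4, n5, n6⟩ := T.class_ne hG
  obtain ⟨k1, k2, k3, k4, k5⟩ := T.kept hG h
  have m := fun x => T.mem_ends (x := x)
  have h4 : G.rev c ≠ e₄ := fun e => n5 (by
    rw [← T.class_rev_e₄, ← e, G.rev_rev])
  refine ⟨?_, ?_, ?_, ?_, ?_, ?_, ?_, ?_, ?_⟩
  · rintro rfl; exact h.ne_rot_rot (by rw [T.rot_a, T.rot_e₄])
  · rintro rfl; exact k4 ((m _).2 (by simp))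
  · rintro rfl; exact k4 ((m _).2 (by simp))
  · intro e; exact h.ne_rot (by rw [e, T.rot_d₀])
  · intro e; exact k1 ((m _).2 (by simp [e]))
  · intro e; exact k2 ((m _).2 (by simp [e]))
  · intro e
    have : G.rev c = e₃ := by rw [← e, G.rev_rev]
    exact n4 (by rw [← this, T.class_rev_c])
  · intro e; exact k5 ((m _).2 (by simp [← e]))
  · rw [m]
    rintro (e | e | e | e | e | e)
    · exact n2 (by rw [← e, T.class_rev_c])
    · exact n4 (by rw [← e, T.class_rev_c])
    · exact n6 (by rw [← T.class_rev_b, ← e, T.class_rev_c])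
    · exact n4 (by rw [← T.class_rev_d₀, ← e, T.class_rev_c])
    · exact n2 (by rw [← T.class_a, ← e, T.class_rev_c])
    · exact h4 e

omit hG h in
theorem rev_mem_ends (x : G.Kept d₀) (hx : G.rev x ∈ G.ends d₀) :
    (x : D) = G.rev a ∨ (x : D) = G.rev e₄ ∨ (x : D) = G.rev e₃ ∨ (x : D) = b := by
  have hk := x.2
  have e : ∀ y, G.rev x = y → (x : D) = G.rev y := fun y hy => by rw [← hy, G.rev_rev]
  rw [T.mem_ends] at hx hk
  rcases hx with hx | hx | hx | hx | hx | hx <;> have := e _ hx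
  · simp [this] at hk
  · simp [this]
  · simp [this, G.rev_rev]
  · simp [this, G.rev_rev] at hk
  · simp [this]
  · simp [this]

omit hG in
theorem removeEdge_rev_of_notMem (x : G.Kept d₀) (hx : G.rev x ∉ G.ends d₀) :
    ((G.removeEdge h).rev x : D) = G.rev x := if_neg hx

theorem removeEdge_rev_of_mem {x : G.Kept d₀} :
    ((x : D) = G.rev a → ((G.removeEdge h).rev x : D) = G.rev e₄) ∧
    ((x : D) = G.rev e₄ → ((G.removeEdge h).rev x : D) = G.rev a) ∧
    ((x : D) = G.rev e₃ → ((G.removeEdge h).rev x : D) = b) ∧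
    ((x : D) = b → ((G.removeEdge h).rev x : D) = G.rev e₃) := by
  obtain ⟨n1, n2, n3, n4, n5, n6⟩ := T.class_ne hG
  have m := fun x => T.mem_ends (x := x)
  have key : ((G.removeEdge h).rev x : D) = if G.rev x ∈ G.ends d₀ then
    G.rev (G.partner d₀ (G.rev x)) else G.rev x := rfl
  rw [key]
  refine ⟨fun e => ?_, fun e => ?_, fun e => ?_, fun e => ?_⟩
  · rw [e, G.rev_rev, if_pos ((m _).2 (by simp)), partner, if_neg, T.rot_a]
    rw [T.rot_a]
    rintro (rfl | rfl)
    · exact n2 rfl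
    · exact n4 (by rw [T.class_rev_d₀])
  · rw [e, G.rev_rev, if_pos ((m _).2 (by simp)), partner, if_pos (Or.inr T.rot_e₄), T.rot_e₄,
      T.rot_rev]
  · rw [e, G.rev_rev, if_pos ((m _).2 (by simp)), partner, if_neg, T.rot_e₃, G.rev_rev]
    rw [T.rot_e₃]
    rintro (e | e)
    · exact n3 (by rw [← e, T.class_rev_b])
    · exact n5 (by rw [← T.class_rev_b, e, T.class_rev_d₀])
  · rw [e, if_pos ((m _).2 (by simp)), partner, if_pos (Or.inl T.rot_rev_b), T.rot_rev_b, T.rot_d₀]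

omit hG in
theorem removeEdge_next (x : G.Kept d₀) :
    ((G.removeEdge h).next x : D) = G.rot ((G.removeEdge h).rev x) := rfl

end Triangle

/-- The face of `θ d` in `G` arises from the face of `d` in `G'` by inserting the dart `y₀` after
the dart number `t`. -/
structure FaceInsertion {X : Type*} (G' : TrivalentMap X) (G : TrivalentMap D) (θ : X → D)
    (y₀ : D) (d : X) (t : ℕ) : Prop where
  injective : Function.Injective θ
  ne : ∀ x, θ x ≠ y₀
  lt : t < G'.faceDegree d
  degree : G.faceDegree (θ d) = G'.faceDegree d + 1
  around : ∀ i ≤ G'.faceDegree d + 1,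
    G.around (θ d) i = insSeq t y₀ (fun j => θ (G'.around d j)) i

omit [DecidableEq D] in
theorem FaceInsertion.of_class {X : Type*} [Finite X] {G' : TrivalentMap X} {θ : X → D} {y₀ : D}
    (hθ : Function.Injective θ) (hy : ∀ x, θ x ≠ y₀) {s d : X} (hd : ∃ t, G'.around d t = s)
    (h1 : ∀ x, G.faceClass (θ x) = G.faceClass y₀ → x ≠ s → G.next (θ x) = θ (G'.next x))
    (h2 : G.next (θ s) = y₀) (h3 : G.next y₀ = θ (G'.next s)) :
    ∃ t, G'.around d t = s ∧ FaceInsertion G' G θ y₀ d t := by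
  obtain ⟨t, ht⟩ := hd
  have hP : ∀ x, G.faceClass (θ x) = G.faceClass y₀ →
      G.faceClass (θ (G'.next x)) = G.faceClass y₀ := fun x hx => by
    by_cases hs : x = s
    · rw [hs, ← h3, faceClass_next]
    · rw [← h1 x hx hs, faceClass_next, hx]
  have hPi : ∀ i, G.faceClass (θ (G'.next^[i] s)) = G.faceClass y₀ := fun i => by
    induction i with
    | zero => rw [← h2, faceClass_next]; rfl
    | succ i ih => rw [Function.iterate_succ_apply']; exact hP _ ih
  have hn := G'.faceDegree_pos d
  set n := G'.faceDegree d
  have ht' : G'.next^[t % n] d = s := by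
    rw [← ht]; exact Function.iterate_mod_minimalPeriod_eq
  have hlt : t % n < n := Nat.mod_lt _ hn
  have hd : G.faceClass (θ d) = G.faceClass y₀ := by
    have := hPi (n - t % n)
    rw [← ht', ← Function.iterate_add_apply, Nat.sub_add_cancel hlt.le] at this
    rwa [show G'.next^[n] d = d from Function.iterate_minimalPeriod] at this
  exact ⟨t % n, ht', hθ, hy, hlt, minimalPeriod_insert hθ hy hP h1 h2 h3 hd ht' hlt,
    iterate_insert hP h1 h2 h3 hd ht' hlt⟩

namespace Triangle

variable {a b c e₃ e₄ : D} (T : Triangle G d₀ a b c e₃ e₄) (hG : G.FacesEmbedded)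
  (h : G.Removable d₀)

/-- The inclusion of the darts that is used for the face from which the edge is removed. -/
def mergedDart (_ : Triangle G d₀ a b c e₃ e₄) (x : G.Kept d₀) : D :=
  if (x : D) = b then e₃ else x

include T hG h

theorem mergedDart_injective : Function.Injective T.mergedDart := by
  have m := fun x => T.mem_ends (x := x)
  intro x y hxy
  have hx := x.2
  have hy := y.2
  apply Subtype.ext
  unfold mergedDart at hxy
  split_ifs at hxy with h1 h2 h2
  · rw [h1, h2]
  · exact absurd ((m _).2 (by simp [hxy])) hy
  · exact absurd ((m _).2 (by simp [hxy])) hx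
  · exact hxy

omit hG h in
theorem mergedDart_of_eq {x : G.Kept d₀} (hx : (x : D) = b) : T.mergedDart x = e₃ := if_pos hx

omit hG h in
theorem mergedDart_of_ne {x : G.Kept d₀} (hx : (x : D) ≠ b) : T.mergedDart x = x := if_neg hx

/-- The faces of the graph after the removal. -/
theorem face_cases [Finite D] (d : G.Kept d₀) :
    (∃ t, ((G.removeEdge h).around d t : D) = G.rev a ∧
      FaceInsertion (G.removeEdge h) G Subtype.val e₄ d t) ∨
    (∃ t, ((G.removeEdge h).around d t : D) = G.rev e₃ ∧
      FaceInsertion (G.removeEdge h) G Subtype.val (G.rev b) d t) ∨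
    (∃ t, ((G.removeEdge h).around d t : D) = G.rev e₄ ∧
      FaceInsertion (G.removeEdge h) G T.mergedDart (G.rev d₀) d t) ∨
    ((∀ i, ((G.removeEdge h).around d i : D) ≠ G.rev a ∧
        ((G.removeEdge h).around d i : D) ≠ G.rev e₃ ∧
        ((G.removeEdge h).around d i : D) ≠ G.rev e₄ ∧ ((G.removeEdge h).around d i : D) ≠ b) ∧
      G.faceDegree (d : D) = (G.removeEdge h).faceDegree d ∧
      ∀ i, G.around (d : D) i = (G.removeEdge h).around d i) := by
  obtain ⟨n1, n2, n3, n4, n5, n6⟩ := T.class_ne hG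
  obtain ⟨k1, k2, k3, k4, k5⟩ := T.kept hG h
  have m := fun x => T.mem_ends (x := x)
  have ca := T.class_a
  have cb := T.class_b
  have c0 := T.class_rev_d₀
  have cb' := T.class_rev_b
  have ca' := T.class_rev_a
  have c3' := T.class_rev_e₃
  have c4' := T.class_rev_e₄
  have hrev := @removeEdge_rev_of_mem _ _ _ _ _ _ _ _ _ T hG h
  have hnext : ∀ x : G.Kept d₀, (x : D) ≠ G.rev a → (x : D) ≠ G.rev e₄ → (x : D) ≠ G.rev e₃ →
      (x : D) ≠ b → G.next x = ((G.removeEdge h).next x : D) := fun x h1 h2 h3 h4 => by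
    have hx : G.rev x ∉ G.ends d₀ := fun hx => by
      rcases T.rev_mem_ends x hx with e | e | e | e <;> contradiction
    rw [T.removeEdge_next, T.removeEdge_rev_of_notMem h x hx]
    rfl
  have hval := Subtype.val_injective (p := fun x : D => x ∉ G.ends d₀)
  by_cases hA : ∃ t, ((G.removeEdge h).around d t : D) = G.rev a
  · left
    obtain ⟨t, ht, hI⟩ := FaceInsertion.of_class (G' := G.removeEdge h) (G := G)
      (θ := Subtype.val) (y₀ := e₄) (s := ⟨G.rev a, k1⟩) (d := d) hval
      (fun x e => x.2 ((m _).2 (by simp [e]))) (hA.imp fun t ht => Subtype.ext ht)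
      (fun x hx hs => hnext x (fun e => hs (Subtype.ext e))
        (fun e => n4 (by rw [← hx, e, c4'])) (fun e => n6 (by rw [← hx, e, c3']))
        (fun e => n2 (by rw [← hx, e, cb])))
      (by rw [next_apply, G.rev_rev, T.rot_a])
      (by rw [T.removeEdge_next, (hrev (x := ⟨G.rev a, k1⟩)).1 rfl]; rfl)
    exact ⟨t, congrArg Subtype.val ht, hI⟩
  right
  by_cases hB : ∃ t, ((G.removeEdge h).around d t : D) = G.rev e₃
  · left
    obtain ⟨t, ht, hI⟩ := FaceInsertion.of_class (G' := G.removeEdge h) (G := G)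
      (θ := Subtype.val) (y₀ := G.rev b) (s := ⟨G.rev e₃, k3⟩) (d := d) hval
      (fun x e => x.2 ((m _).2 (by simp [e]))) (hB.imp fun t ht => Subtype.ext ht)
      (fun x hx hs => hnext x (fun e => n6 (by rw [← cb', ← hx, e, ca']))
        (fun e => n5 (by rw [← cb', ← hx, e, c4'])) (fun e => hs (Subtype.ext e))
        (fun e => n3 (by rw [← cb', ← hx, e, cb])))
      (by rw [next_apply, G.rev_rev, T.rot_e₃])
      (by rw [T.removeEdge_next, (hrev (x := ⟨G.rev e₃, k3⟩)).2.2.1 rfl, next_apply, G.rev_rev])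
    exact ⟨t, congrArg Subtype.val ht, hI⟩
  right
  by_cases hC : ∃ t, ((G.removeEdge h).around d t : D) = G.rev e₄
  · left
    have hne : G.rev e₄ ≠ b := fun e => n1 (by rw [← cb, ← e, c4'])
    obtain ⟨t, ht, hI⟩ := FaceInsertion.of_class (G' := G.removeEdge h) (G := G)
      (θ := T.mergedDart) (y₀ := G.rev d₀) (s := ⟨G.rev e₄, k2⟩) (d := d)
      (T.mergedDart_injective hG h)
      (fun x e => by
        by_cases hx : (x : D) = b
        · rw [T.mergedDart_of_eq hx] at e
          exact (T.distinct hG h).2.2.2.1 e.symm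
        · rw [T.mergedDart_of_ne hx] at e
          exact x.2 ((m _).2 (by simp [e])))
      (hC.imp fun t ht => Subtype.ext ht)
      (fun x hx hs => by
        have hs' : (x : D) ≠ G.rev e₄ := fun e => hs (Subtype.ext e)
        by_cases hxb : (x : D) = b
        · have e1 := (hrev (x := x)).2.2.2 hxb
          have e2 : ((G.removeEdge h).next x : D) ≠ b := by
            rw [T.removeEdge_next, e1, ← T.rot_rev_a]
            intro e
            have : e₃ = a := G.rev.injective (G.rot.injective e)
            exact n1 (by rw [this, ca])
          rw [T.mergedDart_of_eq hxb, T.mergedDart_of_ne e2, T.removeEdge_next, e1]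
          rfl
        · rw [T.mergedDart_of_ne hxb] at hx ⊢
          have h1 : (x : D) ≠ G.rev a := fun e => n4 (by rw [← c0, ← hx, e, ca'])
          have h2 : (x : D) ≠ G.rev e₃ := fun e => n5 (by rw [← c0, ← hx, e, c3'])
          have e1 := hnext x h1 hs' h2 hxb
          rw [T.mergedDart_of_ne, e1]
          rw [← e1]
          intro e
          exact n1 (by rw [← cb, ← e, faceClass_next, hx, c0]))
      (by rw [T.mergedDart_of_ne hne, next_apply, G.rev_rev, T.rot_e₄])
      (by
        rw [T.mergedDart_of_eq, next_apply, G.rev_rev, T.rot_d₀]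
        rw [T.removeEdge_next, (hrev (x := ⟨G.rev e₄, k2⟩)).2.1 rfl, T.rot_rev_a])
    exact ⟨t, congrArg Subtype.val ht, hI⟩
  right
  have hb : ∀ i, ((G.removeEdge h).around d i : D) ≠ b := by
    intro i hi
    have hi' : ((G.removeEdge h).next ⟨G.rev e₄, k2⟩ : D) = b := by
      rw [T.removeEdge_next, (hrev (x := ⟨G.rev e₄, k2⟩)).2.1 rfl, T.rot_rev_a]
    have hn := (G.removeEdge h).faceDegree_pos d
    have hj : ∃ j, (G.removeEdge h).around d (j + 1) = (G.removeEdge h).around d i := by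
      refine ⟨i + (G.removeEdge h).faceDegree d - 1, ?_⟩
      rw [Nat.sub_add_cancel (by omega), around, Function.iterate_add_apply]
      congr 1
      exact (G.removeEdge h).around_faceDegree d
    obtain ⟨j, hj⟩ := hj
    rw [around_succ] at hj
    refine hC ⟨j, congrArg Subtype.val
      ((G.removeEdge h).next.injective (a₂ := ⟨G.rev e₄, k2⟩) (Subtype.ext ?_))⟩
    rw [hj, hi, hi']
  have hall : ∀ i, ((G.removeEdge h).around d i : D) ≠ G.rev a ∧
        ((G.removeEdge h).around d i : D) ≠ G.rev e₃ ∧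
        ((G.removeEdge h).around d i : D) ≠ G.rev e₄ ∧
        ((G.removeEdge h).around d i : D) ≠ b := fun i =>
    ⟨fun e => hA ⟨i, e⟩, fun e => hB ⟨i, e⟩, fun e => hC ⟨i, e⟩, hb i⟩
  have hP : ∀ x : G.Kept d₀, (∃ i, (G.removeEdge h).around d i = x) →
      ∃ i, (G.removeEdge h).around d i = (G.removeEdge h).next x := by
    rintro x ⟨i, rfl⟩; exact ⟨i + 1, around_succ _ _ _⟩
  have h1 : ∀ x : G.Kept d₀, (∃ i, (G.removeEdge h).around d i = x) →
      G.next x = ((G.removeEdge h).next x : D) := by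
    rintro x ⟨i, rfl⟩
    exact hnext _ (hall i).1 (hall i).2.2.1 (hall i).2.1 (hall i).2.2.2
  exact ⟨hall, minimalPeriod_semiconj hval hP h1 ⟨0, rfl⟩, iterate_semiconj hP h1 ⟨0, rfl⟩⟩

end Triangle

end TrivalentMap

theorem Triad.rotate {x y z : ℤ} : Triad x y z ↔ Triad y z x := by
  rw [Triad.swap12, Triad.swap23]

theorem Triad.nonneg {x y z : ℤ} (h : Triad x y z) : 0 ≤ x ∧ 0 ≤ y ∧ 0 ≤ z := by
  obtain ⟨-, h1, h2, h3⟩ := h; omega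

theorem triad_zero {x : ℤ} (h : 0 ≤ x) : Triad 0 x x := by
  simp only [Triad, Int.even_iff]; omega

theorem eq_of_triad_zero {x y : ℤ} (h : Triad 0 x y) : x = y := by
  obtain ⟨-, h1, h2, h3⟩ := h; omega

@[to_additive]
theorem prod_range_insert {M : Type*} [CommMonoid M] {t n : ℕ} (ht : t < n) (F : ℕ → M) :
    ∏ i ∈ range (n + 1), F i =
      (∏ i ∈ range n, F (if i ≤ t then i else i + 1)) * F (t + 1) := by
  obtain ⟨m, rfl⟩ := Nat.exists_eq_add_of_lt ht
  rw [show t + m + 1 + 1 = t + 1 + 1 + m by ring, show t + m + 1 = t + 1 + m by ring,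
    prod_range_add F (t + 1 + 1) m, prod_range_add _ (t + 1) m, prod_range_succ F (t + 1)]
  have h1 : ∏ i ∈ range (t + 1), F (if i ≤ t then i else i + 1) = ∏ i ∈ range (t + 1), F i :=
    prod_congr rfl fun i hi => by rw [if_pos (by simp at hi; omega)]
  have h2 : ∏ i ∈ range m, F (if t + 1 + i ≤ t then t + 1 + i else t + 1 + i + 1) =
      ∏ i ∈ range m, F (t + 1 + 1 + i) :=
    prod_congr rfl fun i _ => by rw [if_neg (by omega)]; congr 1; ring
  rw [h1, h2, mul_right_comm]

namespace TrivalentMap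

variable {D : Type*} {G : TrivalentMap D} {d₀ : D}

theorem triad_rot {L : D → ℤ} {x : D} (hx : Triad (L x) (L (G.rot x)) (L (G.rot (G.rot x)))) :
    Triad (L (G.rot x)) (L (G.rot (G.rot x))) (L (G.rot (G.rot (G.rot x)))) := by
  rw [G.rot_rot_rot]; exact Triad.rotate.1 hx

theorem Admissible.nonneg {L : D → ℤ} (h : G.Admissible L) (x : D) : 0 ≤ L x :=
  (h.2 x).nonneg.1

theorem State.coeff_of_not {ψ : G.State} {L : D → ℤ} (h : ¬ G.Admissible L) : ψ.coeff L = 0 :=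
  dif_neg h

variable [DecidableEq D]

theorem faceLabels_rev {L : D → ℤ} (hL : ∀ x, L (G.rev x) = L x) (d : D) (κ : ℕ → ℤ) (x : D) :
    G.faceLabels d L κ (G.rev x) = G.faceLabels d L κ x := by
  unfold faceLabels
  rw [hL, G.rev_rev]
  congr 1
  exact sum_congr rfl fun i _ => add_comm _ _

theorem faceLabels_insertion {X : Type*} {G' : TrivalentMap X} {θ : X → D} {y₀ : D} {d : X} {t : ℕ}
    (hI : FaceInsertion G' G θ y₀ d t) (k : D → ℤ) (κ : ℕ → ℤ) (z : ℤ) (x : D) :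
    G.faceLabels (θ d) k (insSeq t z κ) x = k x +
      (∑ i ∈ range (G'.faceDegree d),
        ((if θ (G'.around d i) = x then κ i - k (θ (G'.around d i)) else 0) +
          if θ (G'.around d i) = G.rev x then κ i - k (θ (G'.around d i)) else 0)) +
      ((if y₀ = x then z - k y₀ else 0) + if y₀ = G.rev x then z - k y₀ else 0) := by
  rw [faceLabels, hI.degree, sum_range_insert hI.lt, add_assoc]
  congr 2
  · refine sum_congr rfl fun i hi => ?_
    rw [mem_range] at hi
    rcases le_or_gt i t with h1 | h1
    · simp only [if_pos h1, hI.around i (by omega), insSeq_of_le h1]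
    · simp only [if_neg (not_le.2 h1), hI.around (i + 1) (by omega), insSeq_of_lt h1]
  · rw [hI.around _ (by have := hI.lt; omega), insSeq_self, insSeq_self]

/-- A labelling which is changed to `z`, `x`, `y` on the edges of `d₀`, `a`, `b`. -/
def setTriangle (G : TrivalentMap D) (d₀ a b : D) (L : D → ℤ) (z x y : ℤ) (u : D) : ℤ :=
  if u = d₀ ∨ u = G.rev d₀ then z else if u = a ∨ u = G.rev a then x
  else if u = b ∨ u = G.rev b then y else L u

theorem eq_rev_iff {u v : D} : G.rev u = v ↔ u = G.rev v :=
  ⟨fun e => by rw [← e, G.rev_rev], fun e => by rw [e, G.rev_rev]⟩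

theorem setTriangle_rev {a b : D} {L : D → ℤ} (hL : ∀ x, L (G.rev x) = L x) (z x y : ℤ) (u : D) :
    G.setTriangle d₀ a b L z x y (G.rev u) = G.setTriangle d₀ a b L z x y u := by
  have key : ∀ v, (G.rev u = v ∨ G.rev u = G.rev v) ↔ (u = v ∨ u = G.rev v) := fun v => by
    rw [eq_rev_iff, G.rev.injective.eq_iff, or_comm]
  simp only [setTriangle, key, hL]

theorem setTriangle_setTriangle {a b : D} (L : D → ℤ) (z x y z' x' y' : ℤ) :
    G.setTriangle d₀ a b (G.setTriangle d₀ a b L z' x' y') z x y =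
      G.setTriangle d₀ a b L z x y := by
  funext u
  unfold setTriangle
  split_ifs <;> rfl

theorem setTriangle_self {a b : D} {L : D → ℤ} (hL : ∀ x, L (G.rev x) = L x) :
    G.setTriangle d₀ a b L (L d₀) (L a) (L b) = L := by
  funext u
  unfold setTriangle
  split_ifs with h1 h2 h3
  · rcases h1 with rfl | rfl <;> simp [hL]
  · rcases h2 with rfl | rfl <;> simp [hL]
  · rcases h3 with rfl | rfl <;> simp [hL]
  · rfl

variable (h : G.Removable d₀)

theorem extendLabels_of_rev {k : G.Kept d₀ → ℤ} {x : G.Kept d₀} (hx : G.rev x ∈ G.ends d₀) :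
    G.extendLabels d₀ k (G.rev x) = k x := by
  have h1 : ¬ (G.rev x = d₀ ∨ G.rev x = G.rev d₀) := by
    have := x.2
    rintro (e | e)
    · rw [eq_rev_iff] at e; exact this (by rw [e]; simp [ends])
    · rw [G.rev.injective.eq_iff] at e; exact this (by rw [e]; simp [ends])
  have h2 : G.rev (G.rev x) ∉ G.ends d₀ := by rw [G.rev_rev]; exact x.2
  rw [extendLabels, dif_neg (not_not.2 hx), if_neg h1, dif_pos h2]
  congr 1
  exact Subtype.ext (G.rev_rev _)

theorem extendLabels_rev {k : G.Kept d₀ → ℤ} (hk : ∀ x, k ((G.removeEdge h).rev x) = k x) (x : D) :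
    G.extendLabels d₀ k (G.rev x) = G.extendLabels d₀ k x := by
  have key : ∀ x : G.Kept d₀, G.extendLabels d₀ k (G.rev x) = G.extendLabels d₀ k x := fun x => by
    by_cases hx : G.rev x ∈ G.ends d₀
    · rw [extendLabels_of_rev hx, extendLabels_kept]
    · have e : (G.removeEdge h).rev x = ⟨G.rev x, hx⟩ := Subtype.ext (if_neg hx)
      rw [extendLabels_kept, ← hk, e]
      exact extendLabels_kept k ⟨G.rev x, hx⟩
  by_cases hx : x ∈ G.ends d₀
  · by_cases h0 : x = d₀
    · rw [h0, extendLabels_d₀, extendLabels_rev_d₀]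
    by_cases h1 : x = G.rev d₀
    · rw [h1, G.rev_rev, extendLabels_d₀, extendLabels_rev_d₀]
    have := key ⟨G.rev x, h.far x hx h0 h1⟩
    simp only [G.rev_rev] at this
    exact this.symm
  · exact key ⟨x, hx⟩

include h in
/-- Two labellings agree if they agree on the darts that are kept and on `d₀`. -/
theorem labels_ext {L L' : D → ℤ} (hL : ∀ x, L (G.rev x) = L x) (hL' : ∀ x, L' (G.rev x) = L' x)
    (h0 : L d₀ = L' d₀) (hk : ∀ x : G.Kept d₀, L x = L' x) : L = L' := by
  funext x
  by_cases hx : x ∈ G.ends d₀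
  · by_cases e0 : x = d₀
    · rw [e0, h0]
    by_cases e1 : x = G.rev d₀
    · rw [e1, hL, hL', h0]
    rw [← hL, ← hL']
    exact hk ⟨_, h.far x hx e0 e1⟩
  · exact hk ⟨x, hx⟩

theorem admissible_iff {L : D → ℤ} : G.Admissible L ↔ (∀ x, L (G.rev x) = L x) ∧
    Triad (L d₀) (L (G.rot d₀)) (L (G.rot (G.rot d₀))) ∧
    Triad (L (G.rev d₀)) (L (G.rot (G.rev d₀))) (L (G.rot (G.rot (G.rev d₀)))) ∧
    ∀ x ∉ G.ends d₀, Triad (L x) (L (G.rot x)) (L (G.rot (G.rot x))) := by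
  constructor
  · exact fun hL => ⟨hL.1, hL.2 _, hL.2 _, fun x _ => hL.2 x⟩
  · rintro ⟨h1, h2, h3, h4⟩
    refine ⟨h1, fun x => ?_⟩
    by_cases hx : x ∈ G.ends d₀
    · simp only [ends, mem_insert, mem_singleton] at hx
      rcases hx with rfl | rfl | rfl | rfl | rfl | rfl
      · exact h2
      · exact triad_rot h2
      · exact triad_rot (triad_rot h2)
      · exact h3
      · exact triad_rot h3
      · exact triad_rot (triad_rot h3)
    · exact h4 x hx

namespace Triangle

variable {a b c e₃ e₄ : D} (T : Triangle G d₀ a b c e₃ e₄) (hG : G.FacesEmbedded)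
  {h : G.Removable d₀}
include T hG

omit hG in
theorem triad_iff {L : D → ℤ} : G.Admissible L ↔ (∀ x, L (G.rev x) = L x) ∧
    Triad (L d₀) (L e₃) (L (G.rev b)) ∧ Triad (L (G.rev d₀)) (L a) (L e₄) ∧
    ∀ x ∉ G.ends d₀, Triad (L x) (L (G.rot x)) (L (G.rot (G.rot x))) := by
  rw [admissible_iff (d₀ := d₀), T.rot_d₀, T.rot_e₃, T.rot_rev, T.rot_a]

include h in
theorem setTriangle_apply (L : D → ℤ) (z x y : ℤ) :
    G.setTriangle d₀ a b L z x y d₀ = z ∧ G.setTriangle d₀ a b L z x y (G.rev d₀) = z ∧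
    G.setTriangle d₀ a b L z x y a = x ∧ G.setTriangle d₀ a b L z x y (G.rev a) = x ∧
    G.setTriangle d₀ a b L z x y b = y ∧ G.setTriangle d₀ a b L z x y (G.rev b) = y ∧
    G.setTriangle d₀ a b L z x y e₃ = L e₃ ∧ G.setTriangle d₀ a b L z x y e₄ = L e₄ ∧
    G.setTriangle d₀ a b L z x y c = L c := by
  obtain ⟨n1, n2, n3, n4, n5, n6⟩ := T.class_ne hG
  obtain ⟨k1, k2, k3, k4, k5⟩ := T.kept hG h
  obtain ⟨d1, d2, d3, d4, d5, d6, d7, d8, d9⟩ := T.distinct hG h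
  have m := fun x => T.mem_ends (x := x)
  have ca := T.class_a
  have cb := T.class_b
  have c0 := T.class_rev_d₀
  have cb' := T.class_rev_b
  have ca' := T.class_rev_a
  have hne : ∀ {u v : D}, G.faceClass u ≠ G.faceClass v → u ≠ v := fun h e => h (by rw [e])
  have x1 : a ≠ G.rev d₀ := hne (by rw [ca, c0]; exact n1)
  have x2 : b ≠ G.rev d₀ := hne (by rw [cb, c0]; exact n1)
  have x3 : b ≠ G.rev a := hne (by rw [cb, ca']; exact n2)
  have x4 : e₃ ≠ d₀ := hne n1.symm
  have x5 : e₃ ≠ a := hne (by rw [ca]; exact n1.symm)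
  have x6 : e₃ ≠ G.rev a := hne (by rw [ca']; exact n4)
  have x7 : e₃ ≠ b := hne (by rw [cb]; exact n1.symm)
  have x8 : e₃ ≠ G.rev b := hne (by rw [cb']; exact n5)
  have y1 : e₄ ≠ d₀ := hne n2.symm
  have y2 : e₄ ≠ G.rev d₀ := hne (by rw [c0]; exact n4.symm)
  have y3 : e₄ ≠ a := hne (by rw [ca]; exact n2.symm)
  have y4 : e₄ ≠ b := hne (by rw [cb]; exact n2.symm)
  have y5 : e₄ ≠ G.rev b := hne (by rw [cb']; exact n6)
  have z1 : c ≠ d₀ := hne n3.symm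
  have z2 : c ≠ G.rev d₀ := hne (by rw [c0]; exact n5.symm)
  have z3 : c ≠ a := hne (by rw [ca]; exact n3.symm)
  have z4 : c ≠ G.rev a := hne (by rw [ca']; exact n6.symm)
  have z5 : c ≠ b := hne (by rw [cb]; exact n3.symm)
  have w1 : G.rev a ≠ d₀ := fun e => x1 (eq_rev_iff.1 e)
  have w2 : G.rev b ≠ d₀ := fun e => x2 (eq_rev_iff.1 e)
  have w3 : G.rev b ≠ a := fun e => x3 (eq_rev_iff.1 e)
  have hi := fun u v => G.rev.injective.eq_iff (a := u) (b := v)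
  refine ⟨?_, ?_, ?_, ?_, ?_, ?_, ?_, ?_, ?_⟩ <;> unfold setTriangle
  · simp
  · simp
  · simp [d1.symm, x1]
  · simp [w1, d1.symm]
  · simp [d2.symm, x2, d3.symm, x3]
  · simp [w2, d2.symm, w3, d3.symm]
  · simp [x4, d4.symm, x5, x6, x7, x8]
  · simp [y1, y2, y3, d5.symm, y4, y5]
  · simp [z1, z2, z3, z4, z5, d8.symm]

omit hG in
theorem setTriangle_of_kept (L : D → ℤ) (z x y : ℤ) {u : D} (hu : u ∉ G.ends d₀)
    (h1 : u ≠ G.rev a) (h2 : u ≠ b) : G.setTriangle d₀ a b L z x y u = L u := by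
  have m := hu
  rw [T.mem_ends] at m
  push Not at m
  simp [setTriangle, m, h1, h2]

include h in
theorem admissible_setTriangle {L : D → ℤ} (hL : G.Admissible L) {z x y : ℤ}
    (h0 : Triad z (L e₃) y) (h1 : Triad z x (L e₄)) (h2 : Triad x y (L c)) :
    G.Admissible (G.setTriangle d₀ a b L z x y) := by
  obtain ⟨s1, s2, s3, s4, s5, s6, s7, s8, s9⟩ := T.setTriangle_apply hG (h := h) L z x y
  rw [T.triad_iff, s1, s7, s6, s2, s3, s8]
  refine ⟨setTriangle_rev hL.1 z x y, h0, h1, fun u hu => ?_⟩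
  have hA : Triad (G.setTriangle d₀ a b L z x y (G.rev a))
      (G.setTriangle d₀ a b L z x y (G.rot (G.rev a)))
      (G.setTriangle d₀ a b L z x y (G.rot (G.rot (G.rev a)))) := by
    rw [T.rot_rev_a, T.rot_b, s4, s5, s9]; exact h2
  have hB := triad_rot hA
  have hC := triad_rot hB
  rw [T.rot_rev_a] at hB hC
  rw [T.rot_b] at hC
  by_cases e1 : u = G.rev a
  · rw [e1]; exact hA
  by_cases e2 : u = b
  · rw [e2]; exact hB
  by_cases e3 : u = c
  · rw [e3]; exact hC
  have hr := (G.rot_mem_ends d₀ u).2 hu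
  have hrr := (G.rot_mem_ends d₀ _).2 hr
  have f1 : G.rot u ≠ G.rev a := fun e => e3 (G.rot.injective (by rw [e, T.rot_c]))
  have f2 : G.rot u ≠ b := fun e => e1 (G.rot.injective (by rw [e, T.rot_rev_a]))
  have f3 : G.rot (G.rot u) ≠ G.rev a := fun e => e2 (by
    rw [← G.rot_rot_rot u, e, T.rot_rev_a])
  have f4 : G.rot (G.rot u) ≠ b := fun e => e3 (by rw [← G.rot_rot_rot u, e, T.rot_b])
  rw [T.setTriangle_of_kept L z x y hu e1 e2, T.setTriangle_of_kept L z x y hr f1 f2,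
    T.setTriangle_of_kept L z x y hrr f3 f4]
  exact hL.2 u

omit hG in
theorem extendLabels_apply {k : G.Kept d₀ → ℤ} {x : G.Kept d₀} :
    ((x : D) = G.rev a → G.extendLabels d₀ k a = k x) ∧
    ((x : D) = G.rev e₄ → G.extendLabels d₀ k e₄ = k x) ∧
    ((x : D) = G.rev e₃ → G.extendLabels d₀ k e₃ = k x) ∧
    ((x : D) = b → G.extendLabels d₀ k (G.rev b) = k x) := by
  have m := fun x => T.mem_ends (x := x)
  refine ⟨fun e => ?_, fun e => ?_, fun e => ?_, fun e => ?_⟩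
  · rw [← eq_rev_iff] at e
    rw [← e, extendLabels_of_rev]
    rw [e, m]; simp
  · rw [← eq_rev_iff] at e
    rw [← e, extendLabels_of_rev]
    rw [e, m]; simp
  · rw [← eq_rev_iff] at e
    rw [← e, extendLabels_of_rev]
    rw [e, m]; simp
  · rw [← e, extendLabels_of_rev]
    rw [e, m]; simp

theorem admissible_extendLabels_iff (h : G.Removable d₀) {k : G.Kept d₀ → ℤ} :
    G.Admissible (G.extendLabels d₀ k) ↔ (G.removeEdge h).Admissible k := by
  obtain ⟨k1, k2, k3, k4, k5⟩ := T.kept hG h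
  have hrev := @removeEdge_rev_of_mem _ _ _ _ _ _ _ _ _ T hG h
  have v1 := (T.extendLabels_apply (k := k) (x := ⟨_, k1⟩)).1 rfl
  have v2 := (T.extendLabels_apply (k := k) (x := ⟨_, k2⟩)).2.1 rfl
  have v3 := (T.extendLabels_apply (k := k) (x := ⟨_, k3⟩)).2.2.1 rfl
  have v4 := (T.extendLabels_apply (k := k) (x := ⟨_, k4⟩)).2.2.2 rfl
  have hkept : ∀ x : G.Kept d₀, (Triad (G.extendLabels d₀ k x) (G.extendLabels d₀ k (G.rot x))
      (G.extendLabels d₀ k (G.rot (G.rot x))) ↔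
      Triad (k x) (k ((G.removeEdge h).rot x)) (k ((G.removeEdge h).rot
        ((G.removeEdge h).rot x)))) := fun x => by
    rw [← extendLabels_kept k x, ← extendLabels_kept k ((G.removeEdge h).rot x),
      ← extendLabels_kept k ((G.removeEdge h).rot ((G.removeEdge h).rot x))]
    rfl
  have r1 : (G.removeEdge h).rev ⟨G.rev a, k1⟩ = ⟨G.rev e₄, k2⟩ := Subtype.ext (hrev.1 rfl)
  have r3 : (G.removeEdge h).rev ⟨G.rev e₃, k3⟩ = ⟨b, k4⟩ := Subtype.ext (hrev.2.2.1 rfl)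
  rw [T.triad_iff, extendLabels_d₀, extendLabels_rev_d₀, v1, v2, v3, v4]
  constructor
  · rintro ⟨h1, h2, h3, h4⟩
    refine ⟨fun x => ?_, fun x => (hkept x).1 (h4 x x.2)⟩
    by_cases hx : G.rev x ∈ G.ends d₀
    · have e1 := eq_of_triad_zero h2
      have e2 := eq_of_triad_zero h3
      rcases T.rev_mem_ends x hx with e | e | e | e
      · obtain rfl : x = ⟨_, k1⟩ := Subtype.ext e
        rw [r1, e2]
      · obtain rfl : x = ⟨_, k2⟩ := Subtype.ext e
        rw [← r1, (G.removeEdge h).rev_rev, r1, e2]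
      · obtain rfl : x = ⟨_, k3⟩ := Subtype.ext e
        rw [r3, e1]
      · obtain rfl : x = ⟨_, k4⟩ := Subtype.ext e
        rw [← r3, (G.removeEdge h).rev_rev, r3, e1]
    · have := h1 x
      have e : (G.removeEdge h).rev x = ⟨G.rev x, hx⟩ :=
        Subtype.ext (T.removeEdge_rev_of_notMem h x hx)
      rw [extendLabels_kept] at this
      rw [e, ← this, ← extendLabels_kept k ⟨G.rev x, hx⟩]
  · intro hk
    have e1 : k ⟨G.rev e₄, k2⟩ = k ⟨G.rev a, k1⟩ := by rw [← r1, hk.1]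
    have e2 : k ⟨b, k4⟩ = k ⟨G.rev e₃, k3⟩ := by rw [← r3, hk.1]
    refine ⟨extendLabels_rev h hk.1, ?_, ?_, fun x hx => (hkept ⟨x, hx⟩).2 (hk.2 _)⟩
    · rw [e2]; exact triad_zero (hk.nonneg _)
    · rw [e1]; exact triad_zero (hk.nonneg _)

end Triangle

end TrivalentMap

theorem arcSum_congr {w : Ordering} {q : ℝ} {l l' K K' : ℕ → ℤ} {ε ε' : ℕ → ℤˣ} {a b n : ℕ}
    {Φ Φ' : (ℕ → ℤ) → ℂ} (hb : b ≤ n) (hl : ∀ i ∈ Ioc a b, l i = l' i)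
    (hK : ∀ i ≤ n, K i = K' i) (hε : ∀ i ≤ n, ε i = ε' i)
    (hΦ : ∀ κ κ' : ℕ → ℤ, (∀ i < n, κ i = κ' i) → Φ κ = Φ' κ') :
    arcSum w q l K ε a b Φ = arcSum w q l' K' ε' a b Φ' := by
  unfold arcSum
  apply Finset.sum_of_injOn fun σ i => if i ∈ Ioo a b then σ i else ε' i
  · intro σ hσ τ hτ h
    rw [mem_coe, mem_seqSigns] at hσ hτ
    funext i
    by_cases hi : i ∈ Ioo a b
    · simpa [hi] using congrFun h i
    · rw [hσ i hi, hτ i hi]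
  · intro σ _
    rw [mem_coe, mem_seqSigns]
    exact fun i hi => if_neg hi
  · intro σ hσ hno
    rw [mem_seqSigns] at hσ
    refine absurd ⟨fun i => if i ∈ Ioo a b then σ i else ε i, ?_, ?_⟩ hno
    · rw [mem_coe, mem_seqSigns]
      exact fun i hi => if_neg hi
    · funext i
      by_cases hi : i ∈ Ioo a b
      · simp only [hi, if_true]
      · simp only [hi, if_false, hσ i hi]
  · intro σ hσ
    rw [mem_seqSigns] at hσ
    have key : ∀ i ≤ n, σ i = if i ∈ Ioo a b then σ i else ε' i := fun i hi => by
      split_ifs with h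
      · rfl
      · rw [hσ i h, hε i hi]
    congr 1
    · congr 1
      refine prod_congr rfl fun i hi => ?_
      have hi' := mem_Ioc.1 hi
      rw [hl i hi, hK i (by omega), hK (i - 1) (by omega)]
      congr 1
      · exact key i (by omega)
      · exact key (i - 1) (by omega)
    · exact hΦ _ _ fun i hi => by
        show K i - (σ i : ℤ) = K' i - ((if i ∈ Ioo a b then σ i else ε' i : ℤˣ) : ℤ)
        rw [hK i hi.le, ← key i hi.le]

theorem insSeq_map₂ {α β γ : Type*} (φ : α → β → γ) (t : ℕ) (x : α) (y : β) (u : ℕ → α)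
    (v : ℕ → β) (i : ℕ) :
    φ (insSeq t x u i) (insSeq t y v i) = insSeq t (φ x y) (fun i => φ (u i) (v i)) i := by
  unfold insSeq; split_ifs <;> rfl

theorem insSeq_map {α β : Type*} (φ : α → β) (t : ℕ) (x : α) (u : ℕ → α) (i : ℕ) :
    φ (insSeq t x u i) = insSeq t (φ x) (fun i => φ (u i)) i := by
  unfold insSeq; split_ifs <;> rfl

namespace TrivalentMap

variable {D : Type*} {G : TrivalentMap D} {d₀ : D}

section

variable [DecidableEq D]

theorem FaceInsertion.faceClass {X : Type*} {G' : TrivalentMap X} {θ : X → D} {y₀ : D}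
    {d : X} {t : ℕ} (hI : FaceInsertion G' G θ y₀ d t) {i : ℕ} (hi : i < G'.faceDegree d) :
    G.faceClass (θ (G'.around d i)) = G.faceClass y₀ := by
  have h1 := hI.around (t + 1) (by have := hI.lt; omega)
  rw [insSeq_self] at h1
  rw [← h1, faceClass_around]
  rcases le_or_gt i t with h | h
  · have h2 := hI.around i (by omega)
    rw [insSeq_of_le h] at h2
    rw [← h2, faceClass_around]
  · have h2 := hI.around (i + 1) (by omega)
    rw [insSeq_of_lt h] at h2
    rw [← h2, faceClass_around]

/-- The difference equation for a face that arises by the insertion of a dart. -/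
theorem FaceInsertion.arcSum_eq {X : Type*} {G' : TrivalentMap X} [Fintype D] {θ : X → D} {y₀ : D}
    {d : X} {t : ℕ} (hI : FaceInsertion G' G θ y₀ d t) {w : Ordering} {q : ℝ} {o : D → ℤˣ}
    {ψ : G.State} (hψ : G.IsPhysical w q o ψ) {k' : D → ℤ} (hk' : G.Admissible k') {k : X → ℤ}
    (hk : ∀ i, k' (θ (G'.around d i)) = k (G'.around d i)) (ε : X → ℤˣ) (s₀ : ℤˣ) {r : ℕ}
    (hr0 : 0 < r) (hr : r < G'.faceDegree d) {z : ℤ} (hz : k' y₀ = z) {r' : ℕ}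
    (hr' : r' = if r ≤ t then r else r + 1) :
    arcSum w q (fun i => k' (G.rot (insSeq t y₀ (fun i => θ (G'.around d i)) i)))
        (insSeq t z fun i => k (G'.around d i)) (insSeq t s₀ fun i => ε (G'.around d i)) 0 r'
        (fun κ => ψ.coeff (G.faceLabels (θ d) k' κ)) =
      ((coeffAlpha w q (ε (G'.around d 0)) (ε (G'.around d r)) (k (G'.around d 0))
        (k (G'.around d r)) : ℝ) : ℂ) *
      ((∏ i ∈ range (G'.faceDegree d), ((o (θ (G'.around d i)) : ℤ) : ℂ)) * ((o y₀ : ℤ) : ℂ)) *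
      arcSum w q (fun i => k' (G.rot (insSeq t y₀ (fun i => θ (G'.around d i)) i)))
        (insSeq t (z - s₀) fun i => k (G'.around d i) - ε (G'.around d i))
        (insSeq t (-s₀) fun i => -ε (G'.around d i)) r' (G'.faceDegree d + 1)
        (fun κ => ψ.coeff (G.faceLabels (θ d) k' κ)) := by
  set ε' : D → ℤˣ := fun x => if x = y₀ then s₀ else Function.extend θ ε (fun _ => 1) x with hε'
  have hε'θ : ∀ x, ε' (θ x) = ε x := fun x => by
    simp only [hε', hI.ne x, if_false, hI.injective.extend_apply]
  have hε'y : ε' y₀ = s₀ := by simp [hε']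
  have hlt : r' < G.faceDegree (θ d) := by rw [hI.degree, hr']; split_ifs <;> omega
  have key := (G.constraint_eq_zero_iff w q o ψ (θ d) hlt ε' k').1
    (hψ (θ d) r' (by rw [hr']; split_ifs <;> omega) hlt ε' k' hk')
  have hΦ : ∀ κ κ' : ℕ → ℤ, (∀ i < G'.faceDegree d + 1, κ i = κ' i) →
      ψ.coeff (G.faceLabels (θ d) k' κ) = ψ.coeff (G.faceLabels (θ d) k' κ') := fun κ κ' h => by
    rw [G.faceLabels_congr (by rwa [hI.degree])]
  have hP : ∏ i ∈ range (G.faceDegree (θ d)), ((o (G.around (θ d) i) : ℤ) : ℂ) =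
      (∏ i ∈ range (G'.faceDegree d), ((o (θ (G'.around d i)) : ℤ) : ℂ)) * ((o y₀ : ℤ) : ℂ) := by
    rw [hI.degree, prod_range_insert hI.lt, hI.around (t + 1) (by have := hI.lt; omega),
      insSeq_self]
    congr 1
    refine prod_congr rfl fun i hi => ?_
    rw [mem_range] at hi
    rcases le_or_gt i t with h1 | h1
    · simp only [if_pos h1, hI.around i (by omega), insSeq_of_le h1]
    · simp only [if_neg (not_le.2 h1), hI.around (i + 1) (by omega), insSeq_of_lt h1]
  have hr'' : G.around (θ d) r' = θ (G'.around d r) := by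
    rw [hr']
    split_ifs with h
    · rw [hI.around r (by omega), insSeq_of_le h]
    · rw [hI.around (r + 1) (by omega), insSeq_of_lt (not_le.1 h)]
  have hk1 : ∀ i ≤ G'.faceDegree d + 1,
      k' (G.around (θ d) i) = insSeq t z (fun i => k (G'.around d i)) i := fun i hi => by
    rw [hI.around i hi, insSeq_map k', hz]
    simp only [hk]
  have he1 : ∀ i ≤ G'.faceDegree d + 1,
      ε' (G.around (θ d) i) = insSeq t s₀ (fun i => ε (G'.around d i)) i := fun i hi => by
    rw [hI.around i hi, insSeq_map ε', hε'y]
    simp only [hε'θ]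
  rw [hP, hr'', show G.around (θ d) 0 = θ (G'.around d 0) from rfl, hk, hk, hε'θ, hε'θ,
    hI.degree] at key
  convert key using 1
  · refine arcSum_congr (n := G'.faceDegree d + 1) (by rw [hI.degree] at hlt; omega)
      (fun i hi => ?_) (fun i hi => (hk1 i hi).symm) (fun i hi => (he1 i hi).symm) hΦ
    rw [hI.around i (by rw [hI.degree] at hlt; simp at hi; omega)]
  · congr 1
    refine arcSum_congr (n := G'.faceDegree d + 1) le_rfl
      (fun i hi => ?_) (fun i hi => ?_) (fun i hi => ?_) hΦ
    · rw [hI.around i (by simp at hi; omega)]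
    · rw [hk1 i hi, he1 i hi]
      exact (insSeq_map₂ (fun (x : ℤ) (y : ℤˣ) => x - (y : ℤ)) t z s₀ _ _ i).symm
    · rw [he1 i hi]
      exact (insSeq_map (fun y : ℤˣ => -y) t s₀ _ i).symm

variable {h : G.Removable d₀}

/-- Comparison of labellings for a face in which the two merged edges follow each other. -/
theorem extendLabels_faceLabels_val {y₀ : D} {d : G.Kept d₀} {t : ℕ}
    (hI : FaceInsertion (G.removeEdge h) G Subtype.val y₀ d t) {k : G.Kept d₀ → ℤ}
    (hk : ∀ x, k ((G.removeEdge h).rev x) = k x) {x₀ : G.Kept d₀} (hx₀ : G.rev x₀ = y₀)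
    (hy : y₀ ∈ G.ends d₀) (hs : (G.removeEdge h).rev x₀ = (G.removeEdge h).around d t)
    (hno : ∀ x : G.Kept d₀, G.rev x ∈ G.ends d₀ → x ≠ x₀ →
      ∀ i < (G.removeEdge h).faceDegree d, (G.removeEdge h).around d i ≠ (G.removeEdge h).rev x)
    (κ : ℕ → ℤ) :
    G.extendLabels d₀ ((G.removeEdge h).faceLabels d k κ) =
      G.faceLabels d (G.extendLabels d₀ k) (insSeq t (κ t) κ) := by
  have hk' := extendLabels_rev h hk
  have hends : d₀ ∈ G.ends d₀ ∧ G.rev d₀ ∈ G.ends d₀ := by simp [ends]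
  have hy0 : y₀ ≠ d₀ := fun e => x₀.2 (by rw [eq_rev_iff.1 (hx₀.trans e)]; exact hends.2)
  have hy1 : y₀ ≠ G.rev d₀ := fun e => x₀.2 (by rw [G.rev.injective (hx₀.trans e)]; exact hends.1)
  refine labels_ext h (extendLabels_rev h (faceLabels_rev hk d κ)) (faceLabels_rev hk' _ _) ?_ ?_
  · rw [faceLabels_insertion hI, extendLabels_d₀, extendLabels_d₀, if_neg hy0, if_neg hy1,
      sum_eq_zero]
    · rfl
    · intro i _
      rw [if_neg, if_neg, add_zero]
      · exact fun e => ((G.removeEdge h).around d i).2 (by rw [e]; exact hends.2)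
      · exact fun e => ((G.removeEdge h).around d i).2 (by rw [e]; exact hends.1)
  · intro x
    rw [faceLabels_insertion hI, extendLabels_kept, extendLabels_kept, faceLabels,
      if_neg (fun e : y₀ = x => x.2 (by rw [← e]; exact hy)), zero_add, add_assoc]
    congr 1
    simp only [extendLabels_kept, sum_add_distrib, Subtype.ext_iff]
    rw [add_assoc]
    congr 1
    by_cases hx : G.rev x ∈ G.ends d₀
    · rw [sum_eq_zero (f := fun i => if ((G.removeEdge h).around d i : D) = G.rev x then _ else _)
        fun i _ => if_neg fun e => ((G.removeEdge h).around d i).2 (by rw [e]; exact hx), zero_add]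
      by_cases hxx : x = x₀
      · subst hxx
        rw [if_pos hx₀.symm, sum_eq_single_of_mem t (mem_range.2 hI.lt), if_pos, ← hx₀,
          extendLabels_of_rev hx, ← hs, hk]
        · rw [hs]
        · intro i hi hit
          refine if_neg fun e => hit ((G.removeEdge h).around_injOn d (mem_range.1 hi) hI.lt ?_)
          rw [← hs]; exact Subtype.ext e
      · rw [if_neg, sum_eq_zero]
        · intro i hi
          exact if_neg fun e => hno x hx hxx i (mem_range.1 hi) (Subtype.ext e)
        · intro e
          exact hxx (Subtype.ext (G.rev.injective (by rw [← e, hx₀])))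
    · rw [if_neg fun e : y₀ = G.rev x => hx (by rw [← e]; exact hy), add_zero,
        show ((G.removeEdge h).rev x : D) = G.rev x from if_neg hx]

/-- Comparison of labellings for a face which does not contain a merged edge. -/
theorem extendLabels_faceLabels_same {d : G.Kept d₀}
    (hdeg : G.faceDegree (d : D) = (G.removeEdge h).faceDegree d)
    (haround : ∀ i, G.around (d : D) i = (G.removeEdge h).around d i) {k : G.Kept d₀ → ℤ}
    (hk : ∀ x, k ((G.removeEdge h).rev x) = k x)
    (hno : ∀ x : G.Kept d₀, G.rev x ∈ G.ends d₀ →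
      ∀ i, (G.removeEdge h).around d i ≠ (G.removeEdge h).rev x)
    (κ : ℕ → ℤ) :
    G.extendLabels d₀ ((G.removeEdge h).faceLabels d k κ) =
      G.faceLabels d (G.extendLabels d₀ k) κ := by
  have hk' := extendLabels_rev h hk
  have hends : d₀ ∈ G.ends d₀ ∧ G.rev d₀ ∈ G.ends d₀ := by simp [ends]
  refine labels_ext h (extendLabels_rev h (faceLabels_rev hk d κ)) (faceLabels_rev hk' _ _) ?_ ?_
  · rw [faceLabels, extendLabels_d₀, extendLabels_d₀, sum_eq_zero]
    · rfl
    · intro i _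
      rw [haround, if_neg, if_neg, add_zero]
      · exact fun e => ((G.removeEdge h).around d i).2 (by rw [e]; exact hends.2)
      · exact fun e => ((G.removeEdge h).around d i).2 (by rw [e]; exact hends.1)
  · intro x
    rw [faceLabels, extendLabels_kept, extendLabels_kept, faceLabels, hdeg]
    congr 1
    refine sum_congr rfl fun i _ => ?_
    simp only [haround, extendLabels_kept, Subtype.ext_iff]
    congr 1
    by_cases hx : G.rev x ∈ G.ends d₀
    · rw [if_neg, if_neg]
      · exact fun e => ((G.removeEdge h).around d i).2 (by rw [e]; exact hx)
      · exact fun e => hno x hx i (Subtype.ext e)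
    · rw [show ((G.removeEdge h).rev x : D) = G.rev x from if_neg hx]

namespace Triangle

variable {a b c e₃ e₄ : D} (T : Triangle G d₀ a b c e₃ e₄) (hG : G.FacesEmbedded)
include T hG

/-- Comparison of labellings for the face that is obtained by merging two faces. -/
theorem faceLabels_mergedDart {d : G.Kept d₀} {t : ℕ}
    (hI : FaceInsertion (G.removeEdge h) G T.mergedDart (G.rev d₀) d t) {k : G.Kept d₀ → ℤ}
    (hk : ∀ x, k ((G.removeEdge h).rev x) = k x) (z₀ x₀ y₀ z : ℤ) (κ : ℕ → ℤ) :
    G.faceLabels (T.mergedDart d) (G.setTriangle d₀ a b (G.extendLabels d₀ k) z₀ x₀ y₀)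
        (insSeq t z κ) =
      G.setTriangle d₀ a b (G.extendLabels d₀ ((G.removeEdge h).faceLabels d k κ)) z x₀ y₀ := by
  obtain ⟨n1, n2, n3, n4, n5, n6⟩ := T.class_ne hG
  obtain ⟨k1, k2, k3, k4, k5⟩ := T.kept hG h
  obtain ⟨s1, s2, s3, s4, s5, s6, s7, s8, s9⟩ :=
    T.setTriangle_apply hG (h := h) (G.extendLabels d₀ k) z₀ x₀ y₀
  obtain ⟨u1, u2, u3, u4, u5, u6, u7, u8, u9⟩ := T.setTriangle_apply hG (h := h)
    (G.extendLabels d₀ ((G.removeEdge h).faceLabels d k κ)) z x₀ y₀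
  have m := fun x => T.mem_ends (x := x)
  have hrev := @removeEdge_rev_of_mem _ _ _ _ _ _ _ _ _ T hG h
  have hk' := extendLabels_rev h hk
  have hends : d₀ ∈ G.ends d₀ ∧ G.rev d₀ ∈ G.ends d₀ := by simp [ends]
  have v3 := (T.extendLabels_apply (k := k) (x := ⟨_, k3⟩)).2.2.1 rfl
  have r3 : (G.removeEdge h).rev ⟨G.rev e₃, k3⟩ = ⟨b, k4⟩ := Subtype.ext (hrev.2.2.1 rfl)
  have hcl : ∀ i < (G.removeEdge h).faceDegree d,
      G.faceClass (T.mergedDart ((G.removeEdge h).around d i)) = G.faceClass e₃ := fun i hi => by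
    rw [hI.faceClass hi, T.class_rev_d₀]
  have hcl' : ∀ i < (G.removeEdge h).faceDegree d, ∀ x : D, G.faceClass x ≠ G.faceClass e₃ →
      T.mergedDart ((G.removeEdge h).around d i) ≠ x := fun i hi x hx e => hx (by
    rw [← e, hcl i hi])
  have hab : ∀ i < (G.removeEdge h).faceDegree d, ((G.removeEdge h).around d i : D) ≠ G.rev a :=
    fun i hi e => hcl' i hi (G.rev a) (by rw [T.class_rev_a]; exact n4.symm) (by
      rw [T.mergedDart_of_ne, e]
      rw [e]; intro e'; exact n2 (by rw [← T.class_b, ← e', T.class_rev_a]))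
  have hends' : ∀ i, ∀ x ∈ G.ends d₀, x ≠ e₃ →
      T.mergedDart ((G.removeEdge h).around d i) ≠ x := fun i x hx hx3 e => by
    by_cases hb : ((G.removeEdge h).around d i : D) = b
    · rw [T.mergedDart_of_eq hb] at e; exact hx3 e.symm
    · rw [T.mergedDart_of_ne hb] at e
      exact ((G.removeEdge h).around d i).2 (by rw [e]; exact hx)
  refine labels_ext h (faceLabels_rev (setTriangle_rev hk' _ _ _) _ _)
    (setTriangle_rev (extendLabels_rev h (faceLabels_rev hk d κ)) _ _ _) ?_ ?_
  · rw [faceLabels_insertion hI, s1, s2, u1, if_neg (G.rev_ne d₀), if_pos rfl, sum_eq_zero]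
    · ring
    · intro i hi
      rw [if_neg (hcl' i (mem_range.1 hi) _ n1), if_neg (hI.ne _), add_zero]
  · intro x
    rw [faceLabels_insertion hI, if_neg (fun e : G.rev d₀ = x => x.2 (by rw [← e]; exact hends.2)),
      if_neg (fun e : G.rev d₀ = G.rev x => x.2 (by
        rw [← G.rev.injective e]; exact hends.1)), add_zero, add_zero]
    by_cases hxa : (x : D) = G.rev a
    · rw [hxa, s4, u4, sum_eq_zero, add_zero]
      intro i hi
      rw [mem_range] at hi
      rw [if_neg (hcl' i hi _ (by rw [T.class_rev_a]; exact n4.symm)), G.rev_rev,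
        if_neg (hcl' i hi _ (by rw [T.class_a]; exact n1)), add_zero]
    by_cases hxb : (x : D) = b
    · rw [hxb, s5, u5, sum_eq_zero, add_zero]
      intro i hi
      rw [mem_range] at hi
      rw [if_neg (hcl' i hi _ (by rw [T.class_b]; exact n1)),
        if_neg (hcl' i hi _ (by rw [T.class_rev_b]; exact n5.symm)), add_zero]
    rw [T.setTriangle_of_kept _ _ _ _ x.2 hxa hxb, T.setTriangle_of_kept _ _ _ _ x.2 hxa hxb,
      extendLabels_kept, extendLabels_kept, faceLabels]
    congr 1
    refine sum_congr rfl fun i hi => ?_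
    rw [mem_range] at hi
    have hlab : G.setTriangle d₀ a b (G.extendLabels d₀ k) z₀ x₀ y₀
        (T.mergedDart ((G.removeEdge h).around d i)) = k ((G.removeEdge h).around d i) := by
      by_cases hb : ((G.removeEdge h).around d i : D) = b
      · rw [T.mergedDart_of_eq hb, s7, v3, ← hk, r3]
        congr 1
        exact Subtype.ext hb.symm
      · rw [T.mergedDart_of_ne hb, T.setTriangle_of_kept _ _ _ _
          ((G.removeEdge h).around d i).2 (hab i hi) hb, extendLabels_kept]
    have c1 : T.mergedDart ((G.removeEdge h).around d i) = x ↔ (G.removeEdge h).around d i = x := by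
      rw [Subtype.ext_iff]
      by_cases hb : ((G.removeEdge h).around d i : D) = b
      · rw [T.mergedDart_of_eq hb, hb]
        exact ⟨fun e => absurd ((m e₃).2 (by simp)) (by rw [e]; exact x.2),
          fun e => absurd e.symm hxb⟩
      · rw [T.mergedDart_of_ne hb]
    have c2 : T.mergedDart ((G.removeEdge h).around d i) = G.rev x ↔
        (G.removeEdge h).around d i = (G.removeEdge h).rev x := by
      rw [Subtype.ext_iff]
      by_cases hx : G.rev x ∈ G.ends d₀
      · rcases T.rev_mem_ends x hx with e | e | e | e
        · exact absurd e hxa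
        · rw [hrev.2.1 e, e, G.rev_rev]
          exact ⟨fun e' => absurd e' (hcl' i hi _ n4.symm), fun e' => absurd e' (hab i hi)⟩
        · rw [hrev.2.2.1 e, e, G.rev_rev]
          constructor
          · intro e'
            by_contra hb
            rw [T.mergedDart_of_ne hb] at e'
            exact ((G.removeEdge h).around d i).2 ((m _).2 (by simp [e']))
          · exact fun e' => T.mergedDart_of_eq e'
        · exact absurd e hxb
      · rw [T.removeEdge_rev_of_notMem h x hx]
        by_cases hb : ((G.removeEdge h).around d i : D) = b
        · rw [T.mergedDart_of_eq hb, hb]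
          refine ⟨fun e => absurd ((m e₃).2 (by simp)) (by rw [e]; exact hx), fun e => ?_⟩
          exact absurd ((m (G.rev b)).2 (by simp)) (by rw [eq_rev_iff.2 e]; exact x.2)
        · rw [T.mergedDart_of_ne hb]
    simp only [c1, c2, hlab]

end Triangle

end

end TrivalentMap

theorem insSeq_sub (t : ℕ) (x : ℤ) (s : ℤˣ) (u : ℕ → ℤ) (v : ℕ → ℤˣ) :
    (fun i => insSeq t x u i - (insSeq t s v i : ℤˣ)) = insSeq t (x - s) fun i => u i - v i :=
  funext fun i => insSeq_map₂ (fun (x : ℤ) (y : ℤˣ) => x - (y : ℤ)) t x s u v i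

theorem coeffA_eq_zero_of_neg {w : Ordering} {q : ℝ} {o ε ε' : ℤˣ} {k k' l : ℤ}
    (h : k < 0 ∨ k' < 0) : coeffA w q o ε ε' k k' l = 0 := by
  refine coeffA_eq_zero fun hT => ?_
  have := hT.2.1.nonneg
  omega

theorem coeffA_eq_zero_of_ne {w : Ordering} {q : ℝ} {o ε ε' : ℤˣ} {x : ℤ} (h : ε ≠ ε') :
    coeffA w q o ε ε' x x 0 = 0 := by
  refine coeffA_eq_zero fun hT => h ?_
  have := eq_of_triad_zero (Triad.rotate.2 (Triad.rotate.2 (Triad.rotate.2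
    (Triad.rotate.1 (Triad.rotate.1 hT.2.2.1)))))
  exact Units.ext (by omega)

/-- The factor which relates the coefficients before and after the removal of an edge. -/
noncomputable def removalFactor (q : ℝ) (s₁ s₂ : ℤˣ) (x y : ℤ) : ℂ :=
  ((s₁ : ℤ) : ℂ) ^ x * ((s₂ : ℤ) : ℂ) ^ y * ((Real.sqrt (qNum q (x + 1)) : ℝ) : ℂ) *
    ((Real.sqrt (qNum q (y + 1)) : ℝ) : ℂ)

theorem unit_zpow_sub (s σ : ℤˣ) (x : ℤ) :
    ((s : ℤ) : ℂ) ^ (x - (σ : ℤ)) = ((s : ℤ) : ℂ) * ((s : ℤ) : ℂ) ^ x := by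
  have h0 : ((s : ℤ) : ℂ) ≠ 0 := by
    intro h
    have := unit_cast_mul_self s
    simp [h] at this
  rw [zpow_sub₀ h0]
  rcases Int.units_eq_one_or s with rfl | rfl <;> rcases Int.units_eq_one_or σ with rfl | rfl <;>
    simp [div_neg]

theorem removalFactor_comm (q : ℝ) (s₁ s₂ : ℤˣ) (x y : ℤ) :
    removalFactor q s₁ s₂ x y = removalFactor q s₂ s₁ y x := by
  unfold removalFactor; ring

theorem removalFactor_sub {q : ℝ} (hq : 0 < q) (hq1 : q ≠ 1) (s₁ s₂ σ : ℤˣ) {x : ℤ} (hx : 0 ≤ x)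
    (y : ℤ) :
    ((Real.sqrt (qNum q (x - σ + 1)) / Real.sqrt (qNum q (x + 1)) : ℝ) : ℂ) *
      (((s₁ : ℤ) : ℂ) * removalFactor q s₁ s₂ x y) = removalFactor q s₁ s₂ (x - σ) y := by
  have h : ((Real.sqrt (qNum q (x + 1)) : ℝ) : ℂ) ≠ 0 :=
    Complex.ofReal_ne_zero.2 (Real.sqrt_pos.2 (qNum_pos hq hq1 (by omega))).ne'
  unfold removalFactor
  rw [unit_zpow_sub]
  push_cast
  field_simp

theorem sign_eq_zpow (o₁ o₂ : ℤˣ) (x y : ℤ) :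
    (-1 : ℂ) ^ (((1 + (o₁ : ℤ)) * x + (1 + (o₂ : ℤ)) * y) / 2) =
      (((-o₁ : ℤˣ) : ℤ) : ℂ) ^ x * (((-o₂ : ℤˣ) : ℤ) : ℂ) ^ y := by
  rcases Int.units_eq_one_or o₁ with rfl | rfl <;> rcases Int.units_eq_one_or o₂ with rfl | rfl
  · rw [show ((1 + ((1 : ℤˣ) : ℤ)) * x + (1 + ((1 : ℤˣ) : ℤ)) * y) / 2 = x + y by
      simp only [Units.val_one]; omega, zpow_add₀ (by norm_num)]
    simp
  · rw [show ((1 + ((1 : ℤˣ) : ℤ)) * x + (1 + ((-1 : ℤˣ) : ℤ)) * y) / 2 = x by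
      simp only [Units.val_one, Units.val_neg]; omega]
    simp
  · rw [show ((1 + ((-1 : ℤˣ) : ℤ)) * x + (1 + ((1 : ℤˣ) : ℤ)) * y) / 2 = y by
      simp only [Units.val_one, Units.val_neg]; omega]
    simp
  · simp

namespace TrivalentMap

variable {D : Type*} [DecidableEq D] {G : TrivalentMap D} {d₀ : D}

/-- The state after the removal of the edge of `d₀` from the triangle with edges `d₀`, `a`, `b`. -/
noncomputable def reducedState (G : TrivalentMap D) (q : ℝ) (o : D → ℤˣ) (a b : D) (ψ : G.State)
    (h : G.Removable d₀) : (G.removeEdge h).State := fun k =>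
  let j := G.extendLabels d₀ k.1
  let j₁ := j a
  let j₂ := j b
  let o₁ : ℤ := (o a : ℤ)
  let o₂ : ℤ := (o b : ℤ)
  (-1 : ℂ) ^ (((1 + o₁) * j₁ + (1 + o₂) * j₂) / 2) *
    ((Real.sqrt (qNum q (j₁ + 1) * qNum q (j₂ + 1)) : ℝ) : ℂ) * ψ.coeff j

variable {a b c e₃ e₄ : D} {h : G.Removable d₀}

theorem Triangle.reducedState_coeff (T : Triangle G d₀ a b c e₃ e₄) (hG : G.FacesEmbedded)
    {q : ℝ} (hq : 0 < q) (hq1 : q ≠ 1) (o : D → ℤˣ) (ψ : G.State) (k : G.Kept d₀ → ℤ) :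
    (G.reducedState q o a b ψ h).coeff k =
      removalFactor q (-o a) (-o b) (G.extendLabels d₀ k a) (G.extendLabels d₀ k b) *
        ψ.coeff (G.extendLabels d₀ k) := by
  by_cases hk : (G.removeEdge h).Admissible k
  · have hk' := (T.admissible_extendLabels_iff hG h).2 hk
    rw [State.coeff, dif_pos hk, reducedState]
    simp only
    rw [sign_eq_zpow, Real.sqrt_mul (qNum_nonneg hq hq1 (by have := hk'.nonneg a; omega)),
      removalFactor, Complex.ofReal_mul]
    ring
  · rw [State.coeff_of_not hk, State.coeff_of_not
      (fun hk' => hk ((T.admissible_extendLabels_iff hG h).1 hk')), mul_zero]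

variable [Fintype D] {q : ℝ} {o : D → ℤˣ} {ψ : G.State} {k : G.Kept d₀ → ℤ}

/-- The difference equation for a face in which two edges are merged at a vertex. -/
theorem constraint_of_insertion_val (hq : 0 < q) (hq1 : q ≠ 1)
    (hψ : G.IsPhysical .left q o ψ) {o' : G.Kept d₀ → ℤˣ} {ψ' : (G.removeEdge h).State}
    {y₀ : D} {d : G.Kept d₀} {t : ℕ}
    (hI : FaceInsertion (G.removeEdge h) G Subtype.val y₀ d t)
    (hk' : G.Admissible (G.extendLabels d₀ k))
    (hlab : ∀ κ, G.extendLabels d₀ ((G.removeEdge h).faceLabels d k κ) =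
      G.faceLabels d (G.extendLabels d₀ k) (insSeq t (κ t) κ))
    {g : ℤ → ℂ} {s : ℤˣ}
    (hg : ∀ x, 0 ≤ x → ∀ σ : ℤˣ,
      ((Real.sqrt (qNum q (x - σ + 1)) / Real.sqrt (qNum q (x + 1)) : ℝ) : ℂ) *
        (((s : ℤ) : ℂ) * g x) = g (x - σ))
    (hc : ∀ κ, ψ'.coeff ((G.removeEdge h).faceLabels d k κ) =
      g (κ t) * ψ.coeff (G.extendLabels d₀ ((G.removeEdge h).faceLabels d k κ)))
    (hy : G.extendLabels d₀ k y₀ = k ((G.removeEdge h).around d t))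
    (hl0 : G.extendLabels d₀ k (G.rot y₀) = 0)
    (hP : (∏ i ∈ range ((G.removeEdge h).faceDegree d),
        ((o ((G.removeEdge h).around d i) : ℤ) : ℂ)) * ((o y₀ : ℤ) : ℂ) =
      (∏ i ∈ range ((G.removeEdge h).faceDegree d),
        ((o' ((G.removeEdge h).around d i) : ℤ) : ℂ)) * ((s : ℤ) : ℂ))
    {r : ℕ} (hr0 : 0 < r) (hr : r < (G.removeEdge h).faceDegree d) (ε : G.Kept d₀ → ℤˣ) :
    (G.removeEdge h).constraint .left q o' ψ' d r ε k = 0 := by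
  have hkk : ∀ i, G.extendLabels d₀ k ((G.removeEdge h).around d i) =
      k ((G.removeEdge h).around d i) := fun i => extendLabels_kept _ _
  have key := hI.arcSum_eq hψ hk' hkk ε (ε ((G.removeEdge h).around d t)) hr0 hr hy rfl
  rw [constraint_eq_zero_iff _ _ _ _ _ _ hr]
  rw [hP] at key
  have hss := unit_cast_mul_self s
  set n := (G.removeEdge h).faceDegree d with hn
  set e := (G.removeEdge h).around d with he
  set l : ℕ → ℤ := fun i => k ((G.removeEdge h).rot (e i)) with hl
  set l' : ℕ → ℤ := fun i =>
    G.extendLabels d₀ k (G.rot (insSeq t y₀ (fun i => (e i : D)) i)) with hl'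
  have hll : ∀ i, G.extendLabels d₀ k (G.rot (e i)) = l i := fun i =>
    extendLabels_kept k ((G.removeEdge h).rot (e i))
  have hl1 : ∀ i ≤ t, l' i = l i := fun i hi => by simp only [hl', insSeq_of_le hi, hll]
  have hl2 : ∀ i, t < i → l' (i + 1) = l i := fun i hi => by
    simp only [hl', insSeq_of_lt hi, hll]
  have hl3 : l' (t + 1) = 0 := by simp only [hl', insSeq_self, hl0]
  set Φ : (ℕ → ℤ) → ℂ := fun κ => ψ'.coeff ((G.removeEdge h).faceLabels d k κ) with hΦ
  set Φ' : (ℕ → ℤ) → ℂ := fun κ => ψ.coeff (G.faceLabels d (G.extendLabels d₀ k) κ) with hΦ'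
  have hΦΦ : ∀ κ : ℕ → ℤ, Φ κ = g (κ t) * Φ' (insSeq t (κ t) κ) := fun κ => by
    simp only [hΦ, hΦ', hc, hlab]
  have H0 : ∀ x : ℤ, ∀ σ σ' : ℤˣ, σ' ≠ σ → coeffA .left q 1 σ' σ x x (l' (t + 1)) = 0 :=
    fun x σ σ' hσ => by rw [hl3]; exact coeffA_eq_zero_of_ne hσ
  have H : ∀ (B : ℕ → ℤ) (σ : ℕ → ℤˣ),
      ((coeffA .left q 1 (σ t) (σ t) (B t) (B t) (l' (t + 1)) *
        coeffA .left q 1 (σ (t + 1)) (σ t) (B (t + 1)) (B t) (l' (t + 2)) : ℝ) : ℂ) *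
        Φ' (fun i => insSeq t (B t) B i - (insSeq t (σ t) σ i : ℤˣ)) *
          (((s : ℤ) : ℂ) * g (B t)) =
      ((coeffA .left q 1 (σ (t + 1)) (σ t) (B (t + 1)) (B t) (l (t + 1)) : ℝ) : ℂ) *
        Φ fun i => B i - σ i := fun B σ => by
    rw [insSeq_sub, hl3, hl2 (t + 1) (by omega), hΦΦ]
    rcases lt_or_ge (B t) 0 with hB | hB
    · rw [coeffA_eq_zero_of_neg (k := B (t + 1)) (Or.inr hB)]
      simp
    · rw [coeffA_zero_last hq hq1 _ hB]
      have := hg (B t) hB (σ t)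
      push_cast at this ⊢
      rw [← this]
      ring
  split_ifs at key with hrt
  · have e1 := arcSum_insert_after (w := .left) (q := q) (a := 0) hrt
      (fun i hi => hl1 i (by simp at hi; omega)) (l := l) (l' := l') (K := fun i => k (e i))
      (ε := fun i => ε (e i)) (x := k (e t)) (s₀ := ε (e t)) (Φ := Φ) (Φ' := Φ')
      (C := g (k (e t) - ε (e t))) (fun σ hσ => by
        have ht : σ t = ε (e t) := mem_seqSigns.1 hσ t (by simp; omega)
        rw [insSeq_sub, hΦΦ]
        simp only [ht]
        ring)
    have e2 := arcSum_insert (w := .left) (q := q) hrt hI.lt id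
      (fun i _ hi => hl1 i hi) (fun i _ hi => hl2 i (by omega))
      (K := fun i => k (e i) - ε (e i))
      (ε := fun i => -ε (e i)) (x := k (e t) - ε (e t)) (s₀ := -ε (e t)) (Φ := Φ) (Φ' := Φ')
      (C := ((s : ℤ) : ℂ) * g (k (e t) - ε (e t))) (fun σ _ σ' hσ' => H0 _ _ _ hσ')
      (fun σ _ => H (fun i => k (e i) - ε (e i)) σ)
    rw [← e1, ← e2, key]
    ring
  · have hrt' := not_le.1 hrt
    have e1 := arcSum_insert (w := .left) (q := q) (Nat.zero_le t) hrt' id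
      (fun i _ hi => hl1 i hi) (fun i _ hi => hl2 i (by omega))
      (K := fun i => k (e i))
      (ε := fun i => ε (e i)) (x := k (e t)) (s₀ := ε (e t)) (Φ := Φ) (Φ' := Φ')
      (C := ((s : ℤ) : ℂ) * g (k (e t))) (fun σ _ σ' hσ' => H0 _ _ _ hσ')
      (fun σ _ => H (fun i => k (e i)) σ)
    have e2 := arcSum_insert_before (w := .left) (q := q) (b := n) hrt'
      (fun i hi => hl2 i (by simp at hi; omega)) (l := l) (l' := l')
      (K := fun i => k (e i) - ε (e i))
      (ε := fun i => -ε (e i)) (x := k (e t) - ε (e t)) (s₀ := -ε (e t)) (Φ := Φ) (Φ' := Φ')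
      (C := g (k (e t))) (fun σ hσ => by
        have ht : σ t = -ε (e t) := mem_seqSigns.1 hσ t (by simp; omega)
        rw [insSeq_sub, hΦΦ]
        simp only [ht, Units.val_neg, sub_neg_eq_add, sub_add_cancel]
        ring)
    rw [← e1, ← e2, key]
    linear_combination ((coeffAlpha .left q (ε (e 0)) (ε (e r)) (k (e 0)) (k (e r)) : ℝ) : ℂ) *
      (∏ i ∈ range n, ((o' (e i) : ℤ) : ℂ)) * arcSum .left q l'
        (insSeq t (k (e t) - ε (e t)) fun i => k (e i) - ε (e i))
        (insSeq t (-ε (e t)) fun i => -ε (e i)) (r + 1) (n + 1) Φ' * g (k (e t)) * hss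

end TrivalentMap

section SmallArcs

variable {w : Ordering} {q : ℝ} {l K : ℕ → ℤ} {ε : ℕ → ℤˣ} {Φ : (ℕ → ℤ) → ℂ}

theorem seqSigns_empty (ε : ℕ → ℤˣ) : seqSigns ε ∅ = {ε} := by
  ext σ
  rw [mem_seqSigns, mem_singleton]
  exact ⟨fun h => funext fun i => h i (notMem_empty i), fun h i _ => by rw [h]⟩

theorem sum_seqSigns_singleton (ε : ℕ → ℤˣ) (j : ℕ) (F : (ℕ → ℤˣ) → ℂ) :
    ∑ σ ∈ seqSigns ε {j}, F σ = F (Function.update ε j 1) + F (Function.update ε j (-1)) := by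
  have hne : Function.update ε j 1 ≠ Function.update ε j (-1) := fun h => by
    have := congrFun h j
    simp at this
  classical
  have : seqSigns ε {j} = {Function.update ε j 1, Function.update ε j (-1)} := by
    ext σ
    rw [mem_seqSigns, mem_insert, mem_singleton]
    constructor
    · intro hσ
      rcases Int.units_eq_one_or (σ j) with h | h
      · left
        funext i
        by_cases hi : i = j
        · rw [hi, h, Function.update_self]
        · rw [Function.update_of_ne hi, hσ i (by simpa using hi)]
      · right
        funext i
        by_cases hi : i = j
        · rw [hi, h, Function.update_self]
        · rw [Function.update_of_ne hi, hσ i (by simpa using hi)]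
    · rintro (rfl | rfl) i hi <;> exact Function.update_of_ne (by simpa using hi) _ _
  rw [this, sum_pair hne]

theorem arcSum_succ (m : ℕ) :
    arcSum w q l K ε m (m + 1) Φ =
      ((coeffA w q 1 (ε (m + 1)) (ε m) (K (m + 1)) (K m) (l (m + 1)) : ℝ) : ℂ) *
        Φ fun i => K i - ε i := by
  have h : Ioo m (m + 1) = ∅ := by ext; simp
  rw [arcSum, h, seqSigns_empty, sum_singleton, prod_Ioc_succ_top (by omega)]
  simp

theorem arcSum_one_three :
    arcSum w q l K ε 1 3 Φ =
      ((coeffA w q 1 1 (ε 1) (K 2) (K 1) (l 2) *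
          coeffA w q 1 (ε 3) 1 (K 3) (K 2) (l 3) : ℝ) : ℂ) *
        Φ (fun i => K i - (Function.update ε 2 1 i : ℤˣ)) +
      ((coeffA w q 1 (-1) (ε 1) (K 2) (K 1) (l 2) *
          coeffA w q 1 (ε 3) (-1) (K 3) (K 2) (l 3) : ℝ) : ℂ) *
        Φ (fun i => K i - (Function.update ε 2 (-1) i : ℤˣ)) := by
  have h : Ioo 1 3 = {2} := by ext; simp; omega
  rw [arcSum, h, sum_seqSigns_singleton]
  simp [Function.update_apply, prod_Ioc_succ_top (show 1 ≤ 2 by omega)]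

end SmallArcs

namespace TrivalentMap

variable {D : Type*} [DecidableEq D] {G : TrivalentMap D} {d₀ : D}

/-- The labels `x`, `y`, `z` of the edges of a triangle. -/
def triple (x y z : ℤ) (i : ℕ) : ℤ := if i = 0 then x else if i = 1 then y else z

/-- A difference equation for a triangle. -/
theorem IsPhysical.triangle [Fintype D] {w : Ordering} {q : ℝ} {o : D → ℤˣ} {ψ : G.State}
    (hψ : G.IsPhysical w q o ψ) {p₀ p₁ p₂ : D} (hdeg : G.faceDegree p₀ = 3)
    (h1 : G.next p₀ = p₁) (h2 : G.next p₁ = p₂) (h3 : G.next p₂ = p₀) (h01 : p₀ ≠ p₁)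
    (h02 : p₀ ≠ p₂) (h12 : p₁ ≠ p₂) {L : D → ℤ}
    (hL : G.Admissible L) (s₀ s₁ s₂ : ℤˣ) :
    ((coeffA w q 1 s₁ s₀ (L p₁) (L p₀) (L (G.rot p₁)) : ℝ) : ℂ) *
      ψ.coeff (G.faceLabels p₀ L (triple (L p₀ - s₀) (L p₁ - s₁) (L p₂ - s₂))) =
    ((coeffAlpha w q s₀ s₁ (L p₀) (L p₁) : ℝ) : ℂ) *
      (((o p₀ : ℤ) : ℂ) * ((o p₁ : ℤ) : ℂ) * ((o p₂ : ℤ) : ℂ)) *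
      (((coeffA w q 1 1 (-s₁) (L p₂ - s₂) (L p₁ - s₁) (L (G.rot p₂)) *
          coeffA w q 1 (-s₀) 1 (L p₀ - s₀) (L p₂ - s₂) (L (G.rot p₀)) : ℝ) : ℂ) *
        ψ.coeff (G.faceLabels p₀ L (triple (L p₀) (L p₁) (L p₂ - s₂ - 1))) +
      ((coeffA w q 1 (-1) (-s₁) (L p₂ - s₂) (L p₁ - s₁) (L (G.rot p₂)) *
          coeffA w q 1 (-s₀) (-1) (L p₀ - s₀) (L p₂ - s₂) (L (G.rot p₀)) : ℝ) : ℂ) *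
        ψ.coeff (G.faceLabels p₀ L (triple (L p₀) (L p₁) (L p₂ - s₂ + 1)))) := by
  have a0 : G.around p₀ 0 = p₀ := rfl
  have a1 : G.around p₀ 1 = p₁ := h1
  have a2 : G.around p₀ 2 = p₂ := by rw [around_succ, a1, h2]
  have a3 : G.around p₀ 3 = p₀ := by rw [around_succ, a2, h3]
  set ε : D → ℤˣ := fun x => if x = p₀ then s₀ else if x = p₁ then s₁ else s₂ with hε
  have e0 : ε p₀ = s₀ := by simp [hε]
  have e1 : ε p₁ = s₁ := by simp [hε, h01.symm]
  have e2 : ε p₂ = s₂ := by simp [hε, h02.symm, h12.symm]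
  have key := (G.constraint_eq_zero_iff w q o ψ p₀ (r := 1) (by omega) ε L).1
    (hψ p₀ 1 (by omega) (by omega) ε L hL)
  rw [arcSum_succ 0, hdeg, arcSum_one_three] at key
  simp only [zero_add, prod_range_succ, prod_range_zero, one_mul, a0, a1, a2, a3, e0, e1, e2]
    at key
  have hlab : ∀ (κ : ℕ → ℤ) (x y z : ℤ), κ 0 = x → κ 1 = y → κ 2 = z →
      G.faceLabels p₀ L κ = G.faceLabels p₀ L (triple x y z) := fun κ x y z h0 h1 h2 => by
    apply faceLabels_congr
    rw [hdeg]
    intro i hi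
    interval_cases i <;> simp [triple, h0, h1, h2]
  have f1 : (fun i => L (G.around p₀ i) - ((ε (G.around p₀ i) : ℤˣ) : ℤ)) 2 = L p₂ - s₂ := by
    simp only [a2, e2]
  rw [hlab (fun i => L (G.around p₀ i) - ((ε (G.around p₀ i) : ℤˣ) : ℤ))
      (L p₀ - s₀) (L p₁ - s₁) (L p₂ - s₂) (by simp only [a0, e0]) (by simp only [a1, e1]) f1,
    hlab (fun i => L (G.around p₀ i) - ((ε (G.around p₀ i) : ℤˣ) : ℤ) -
      ((Function.update (fun i => -ε (G.around p₀ i)) 2 1 i : ℤˣ) : ℤ))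
      (L p₀) (L p₁) (L p₂ - s₂ - 1) (by simp [a0, e0]) (by simp [a1, e1]) (by simp [a2, e2]),
    hlab (fun i => L (G.around p₀ i) - ((ε (G.around p₀ i) : ℤˣ) : ℤ) -
      ((Function.update (fun i => -ε (G.around p₀ i)) 2 (-1) i : ℤˣ) : ℤ))
      (L p₀) (L p₁) (L p₂ - s₂ + 1) (by simp [a0, e0]) (by simp [a1, e1]) (by simp [a2, e2])]
    at key
  exact key

namespace Triangle

variable {a b c e₃ e₄ : D} (T : Triangle G d₀ a b c e₃ e₄) (hG : G.FacesEmbedded)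
  {h : G.Removable d₀}
include T

theorem next_d₀ : G.next d₀ = a := T.rot_rev
theorem next_a : G.next a = b := T.rot_rev_a
theorem next_b : G.next b = d₀ := T.rot_rev_b

include hG

theorem setTriangle_eq_add (h : G.Removable d₀) {L : D → ℤ} (hL : ∀ x, L (G.rev x) = L x)
    (z x y : ℤ) (u : D) :
    G.setTriangle d₀ a b L z x y u = L u +
      (((if d₀ = u then z - L d₀ else 0) + if d₀ = G.rev u then z - L d₀ else 0) +
      ((if a = u then x - L a else 0) + if a = G.rev u then x - L a else 0) +
      ((if b = u then y - L b else 0) + if b = G.rev u then y - L b else 0)) := by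
  obtain ⟨n1, n2, n3, n4, n5, n6⟩ := T.class_ne hG
  obtain ⟨d1, d2, d3, -⟩ := T.distinct hG h
  have hne : ∀ {u v : D}, G.faceClass u ≠ G.faceClass v → u ≠ v := fun h e => h (by rw [e])
  have x1 : a ≠ G.rev d₀ := hne (by rw [T.class_a, T.class_rev_d₀]; exact n1)
  have x2 : b ≠ G.rev d₀ := hne (by rw [T.class_b, T.class_rev_d₀]; exact n1)
  have x3 : b ≠ G.rev a := hne (by rw [T.class_b, T.class_rev_a]; exact n2)
  have key : ∀ (v : D) (m : ℤ), ((if v = u then m else 0) + if v = G.rev u then m else 0) =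
      if u = v ∨ u = G.rev v then m else 0 := fun v m => by
    by_cases h1 : v = u
    · subst h1
      simp [(G.rev_ne v).symm]
    · by_cases h2 : v = G.rev u
      · have : u = G.rev v := by rw [h2, G.rev_rev]
        rw [if_neg h1, if_pos h2, if_pos (Or.inr this), zero_add]
      · have h3 : u ≠ G.rev v := fun e => h2 (by rw [e, G.rev_rev])
        rw [if_neg h1, if_neg h2, if_neg (by tauto), zero_add]
  have disj : ∀ v v' : D, v ≠ v' → v' ≠ G.rev v → (u = v ∨ u = G.rev v) →
      ¬ (u = v' ∨ u = G.rev v') := by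
    rintro v v' h1 h2 (rfl | rfl) (h | h)
    · exact h1 h
    · exact h2 (eq_rev_iff.1 h.symm)
    · exact h2 h.symm
    · exact h1 (G.rev.injective h)
  rw [key, key, key, setTriangle]
  have j1 := disj d₀ a d1 x1
  have j2 := disj d₀ b d2 x2
  have j3 := disj a b d3 x3
  by_cases c1 : u = d₀ ∨ u = G.rev d₀
  · rw [if_pos c1, if_pos c1, if_neg (j1 c1), if_neg (j2 c1)]
    have : L u = L d₀ := by rcases c1 with e | e <;> rw [e]; exact hL _
    rw [this]; ring
  · rw [if_neg c1, if_neg c1]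
    by_cases c2 : u = a ∨ u = G.rev a
    · rw [if_pos c2, if_pos c2, if_neg (j3 c2)]
      have : L u = L a := by rcases c2 with e | e <;> rw [e]; exact hL _
      rw [this]; ring
    · rw [if_neg c2, if_neg c2]
      by_cases c3 : u = b ∨ u = G.rev b
      · rw [if_pos c3, if_pos c3]
        have : L u = L b := by rcases c3 with e | e <;> rw [e]; exact hL _
        rw [this]; ring
      · rw [if_neg c3, if_neg c3]; ring

theorem faceLabels_triangle (h : G.Removable d₀) (htri : G.faceDegree d₀ = 3) {L : D → ℤ}
    (hL : ∀ x, L (G.rev x) = L x) (x y z : ℤ) :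
    G.faceLabels a L (triple x y z) = G.setTriangle d₀ a b L z x y ∧
    G.faceLabels d₀ L (triple x y z) = G.setTriangle d₀ a b L x y z ∧
    G.faceLabels b L (triple x y z) = G.setTriangle d₀ a b L y z x ∧
    G.faceDegree a = 3 ∧ G.faceDegree b = 3 := by
  have hp : d₀ ∈ Function.periodicPts G.next := by
    rw [← Function.minimalPeriod_pos_iff_mem_periodicPts]
    change 0 < G.faceDegree d₀
    omega
  have h1 : G.faceDegree a = 3 := by
    rw [← htri, ← T.next_d₀]; exact Function.minimalPeriod_apply hp
  have hp1 : a ∈ Function.periodicPts G.next := by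
    rw [← Function.minimalPeriod_pos_iff_mem_periodicPts]
    change 0 < G.faceDegree a
    omega
  have h2 : G.faceDegree b = 3 := by
    rw [← h1, ← T.next_a]; exact Function.minimalPeriod_apply hp1
  refine ⟨funext fun u => ?_, funext fun u => ?_, funext fun u => ?_, h1, h2⟩ <;>
    rw [T.setTriangle_eq_add hG h hL, faceLabels] <;>
    simp only [h1, h2, htri, sum_range_succ, sum_range_zero, around_succ, around_zero, T.next_d₀,
      T.next_a, T.next_b, triple] <;>
    norm_num <;> ring

end Triangle

end TrivalentMap

section Coefficients

variable {q : ℝ}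

theorem coeffA_from_zero (hq : 0 < q) (hq1 : q ≠ 1) (s : ℤˣ) {x : ℤ} (hx : 0 ≤ x)
    (h : 0 ≤ x - s) :
    coeffA .left q 1 (-1) s 0 x x = -(((s : ℤ) : ℝ) * (Real.sqrt (qNum q 2) /
      Real.sqrt (qNum q (x + 1)))) := by
  have h2 := qNum_pos hq hq1 (show 0 < 2 by norm_num)
  have hs := Real.mul_self_sqrt h2.le
  have hs0 := (Real.sqrt_pos.2 h2).ne'
  have hs1 := (Real.sqrt_pos.2 (qNum_pos hq hq1 (show 0 < x + 1 by omega))).ne'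
  have key := unit_mul_neg_one_zpow s x
  have hss : ((s : ℤ) : ℝ) * ((s : ℤ) : ℝ) = 1 := by
    rcases Int.units_eq_one_or s with rfl | rfl <;> simp
  have e : coeffA .left q 1 (-1) s 0 x x =
      -(qNum q 2 * (-1 : ℝ) ^ ((x + x) / 2) * sixJ q 0 1 1 (x - s) x x) := by
    simp [coeffA]
  rw [e, sixJ_zero_first hq hq1 (triad_sub_unit hx h)]
  have key2 : (-1 : ℝ) ^ ((x + x) / 2) * (-1 : ℝ) ^ ((x + (x - s) + 1) / 2) = ((s : ℤ) : ℝ) := by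
    linear_combination ((s : ℤ) : ℝ) * key - (-1 : ℝ) ^ ((x + x) / 2) *
      (-1 : ℝ) ^ ((x + (x - s) + 1) / 2) * hss
  rw [show qNum q 2 * (-1 : ℝ) ^ ((x + x) / 2) * ((-1 : ℝ) ^ ((x + (x - s) + 1) / 2) *
    (Real.sqrt (qNum q 2) * Real.sqrt (qNum q (x + 1)))⁻¹) =
    ((-1 : ℝ) ^ ((x + x) / 2) * (-1 : ℝ) ^ ((x + (x - s) + 1) / 2)) * (qNum q 2 *
    (Real.sqrt (qNum q 2) * Real.sqrt (qNum q (x + 1)))⁻¹) by ring, key2]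
  nth_rw 1 [← hs]
  field_simp

theorem coeffA_to_zero (hq : 0 < q) (hq1 : q ≠ 1) (s : ℤˣ) {x : ℤ} (hx : 0 ≤ x)
    (h : 0 ≤ x - s) :
    coeffA .left q 1 s (-1) x 0 x = qNum q (x - s + 1) / (Real.sqrt (qNum q 2) *
      Real.sqrt (qNum q (x + 1))) := by
  have key := unit_mul_neg_one_zpow s x
  have e : coeffA .left q 1 s (-1) x 0 x =
      ((s : ℤ) : ℝ) * qNum q (x - s + 1) * (-1 : ℝ) ^ ((x + x) / 2) *
        sixJ q x (x - s) 1 1 0 x := by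
    simp [coeffA]
  rw [e, sixJ_zero_middle hq hq1 (triad_sub_unit hx h), div_eq_mul_inv]
  linear_combination (qNum q (x - s + 1) * (Real.sqrt (qNum q 2) *
      Real.sqrt (qNum q (x + 1)))⁻¹) * key

theorem coeffA_zero_pos {w : Ordering} (o s : ℤˣ) (x l : ℤ) : coeffA w q o 1 s 0 x l = 0 := by
  refine coeffA_eq_zero fun h => ?_
  have := h.1.nonneg
  simp at this

end Coefficients

namespace TrivalentMap

variable {D : Type*} [DecidableEq D] {G : TrivalentMap D} {d₀ : D}

theorem removalFactor_sub_sub {q : ℝ} (s₁ s₂ σ τ : ℤˣ) (x y : ℤ) :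
    removalFactor q s₁ s₂ (x - σ) (y - τ) = ((s₁ : ℤ) : ℂ) * ((s₂ : ℤ) : ℂ) *
      (((s₁ : ℤ) : ℂ) ^ x * ((s₂ : ℤ) : ℂ) ^ y) *
      ((Real.sqrt (qNum q (x - σ + 1)) : ℝ) : ℂ) * ((Real.sqrt (qNum q (y - τ + 1)) : ℝ) : ℂ) := by
  unfold removalFactor
  rw [unit_zpow_sub, unit_zpow_sub]
  ring

namespace Triangle

variable {a b c e₃ e₄ : D} (T : Triangle G d₀ a b c e₃ e₄) (hG : G.FacesEmbedded)
include T hG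

theorem setTriangle_admissible_of_coeffA (h : G.Removable d₀) {w : Ordering} {q : ℝ} {o : ℤˣ}
    {M : D → ℤ} (hM : G.Admissible M) {x y : ℤ} {σ τ : ℤˣ} (m4 : M e₄ = x - σ) (m3 : M e₃ = y - τ)
    (hA : coeffA w q o τ σ y x (M c) ≠ 0) : G.Admissible (G.setTriangle d₀ a b M 1 x y) := by
  have hT := not_imp_comm.1 coeffA_eq_zero hA
  refine T.admissible_setTriangle hG (h := h) hM ?_ ?_ (Triad.swap12.1 hT.2.1)
  · rw [m3]; exact Triad.rotate.2 (Triad.swap12.1 hT.1)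
  · rw [m4]; exact Triad.rotate.2 (Triad.swap12.1 hT.2.2.2)

/-- The relation between the coefficients for the labels `0` and `1` of the edge of `d₀`. -/
theorem coeff_relation [Fintype D] (h : G.Removable d₀) (htri : G.faceDegree d₀ = 3) {q : ℝ}
    (hq : 0 < q) (hq1 : q ≠ 1) {o : D → ℤˣ} {ψ : G.State} (hψ : G.IsPhysical .left q o ψ)
    {M : D → ℤ} (hM : ∀ x, M (G.rev x) = M x) {x y : ℤ} {σ τ : ℤˣ} (m0 : M d₀ = 0)
    (ma : M a = x - σ) (mb : M b = y - τ) (m4 : M e₄ = x - σ) (m3 : M e₃ = y - τ) :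
    ((coeffA .left q 1 (-1) σ 0 x x * coeffA .left q 1 τ (-1) y 0 y : ℝ) : ℂ) *
        ψ.coeff (G.setTriangle d₀ a b M 1 x y) *
        (-((o d₀ : ℤ) : ℂ) * removalFactor q (-o a) (-o b) x y) =
      ((coeffA .left q 1 τ σ y x (M c) : ℝ) : ℂ) *
        (removalFactor q (-o a) (-o b) (x - σ) (y - τ) * ψ.coeff M) := by
  by_cases hL : G.Admissible (G.setTriangle d₀ a b M 1 x y)
  · obtain ⟨s1, s2, s3, s4, s5, s6, s7, s8, s9⟩ := T.setTriangle_apply hG (h := h) M 1 x y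
    obtain ⟨f1, -, -, f2, -⟩ := T.faceLabels_triangle hG h htri hL.1 (x - σ) (y - τ) 0
    obtain ⟨f3, -⟩ := T.faceLabels_triangle hG h htri hL.1 x y 1
    obtain ⟨d1, d2, d3, -⟩ := T.distinct hG h
    have key := hψ.triangle f2 T.next_a T.next_b T.next_d₀ d3 d1.symm d2.symm hL σ τ 1
    rw [T.rot_b, T.rot_d₀, T.rot_a, s1, s3, s5, s7, s8, s9, m3, m4] at key
    simp only [Units.val_one, sub_self, zero_add, coeffA_zero_pos, zero_mul, Complex.ofReal_zero]
      at key
    rw [f1, f3, setTriangle_setTriangle, setTriangle_setTriangle, ← m0, ← ma, ← mb,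
      setTriangle_self hM, m0, ma, mb] at key
    have hy := hL.nonneg b
    have hx := hL.nonneg a
    have hy' := hL.nonneg e₃
    have hx' := hL.nonneg e₄
    rw [s3] at hx
    rw [s5] at hy
    rw [s7, m3] at hy'
    rw [s8, m4] at hx'
    have ey : y - (τ : ℤ) - ((-τ : ℤˣ) : ℤ) = y := by simp
    have ex : x - (σ : ℤ) - ((-σ : ℤˣ) : ℤ) = x := by simp
    rw [coeffA_from_zero hq hq1 _ hy' (by rw [ey]; exact hy),
      coeffA_to_zero hq hq1 _ hx' (by rw [ex]; exact hx), ex] at key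
    rw [coeffA_from_zero hq hq1 _ hx hx', coeffA_to_zero hq hq1 _ hy hy', removalFactor_sub_sub,
      mul_left_comm (Complex.ofReal _), key, removalFactor]
    have pos := fun (z : ℤ) (hz : 0 ≤ z) => qNum_pos hq hq1 (show 0 < z + 1 by omega)
    have sq := fun (z : ℤ) (hz : 0 ≤ z) => Real.mul_self_sqrt (pos z hz).le
    have ne := fun (z : ℤ) (hz : 0 ≤ z) =>
      Complex.ofReal_ne_zero.2 (Real.sqrt_pos.2 (pos z hz)).ne'
    have h2 : ((Real.sqrt (qNum q 2) : ℝ) : ℂ) ≠ 0 := ne 1 (by norm_num)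
    have nx := ne _ hx
    have ny := ne _ hy
    have nx' := ne _ hx'
    have ny' := ne _ hy'
    have ea : coeffAlpha .left q σ τ x y = ((σ : ℤ) : ℝ) * ((τ : ℤ) : ℝ) *
      (qNum q (y - τ + 1) / qNum q (x + 1)) := rfl
    have qx := congrArg Complex.ofReal (sq _ hx)
    have qy := congrArg Complex.ofReal (sq _ hy')
    rw [ea]
    have hσ := unit_cast_mul_self σ
    have hτ := unit_cast_mul_self τ
    have hoa := unit_cast_mul_self (o a)
    have hob := unit_cast_mul_self (o b)
    clear key
    simp only [Units.val_neg, Int.cast_neg]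
    push_cast at qx qy ⊢
    rw [← qx, ← qy]
    generalize ((Real.sqrt (qNum q 2) : ℝ) : ℂ) = R at *
    generalize ((Real.sqrt (qNum q (x + 1)) : ℝ) : ℂ) = X at *
    generalize ((Real.sqrt (qNum q (y + 1)) : ℝ) : ℂ) = Y at *
    generalize ((Real.sqrt (qNum q (x - σ + 1)) : ℝ) : ℂ) = X' at *
    generalize ((Real.sqrt (qNum q (y - τ + 1)) : ℝ) : ℂ) = Y' at *
    generalize (-((o a : ℤ) : ℂ)) ^ x = A
    generalize (-((o b : ℤ) : ℂ)) ^ y = B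
    generalize ((σ : ℤ) : ℂ) = s at *
    generalize ((τ : ℤ) : ℂ) = t at *
    generalize ((o a : ℤ) : ℂ) = oa at *
    generalize ((o b : ℤ) : ℂ) = ob at *
    rw [← _root_.sq] at hσ hτ hoa hob
    field_simp
    rw [hτ, hoa, hob]
    ring
  · rw [State.coeff_of_not hL, mul_zero, zero_mul]
    by_cases hM' : G.Admissible M
    · by_cases hA : coeffA .left q 1 τ σ y x (M c) = 0
      · rw [hA]; simp
      · exact absurd (T.setTriangle_admissible_of_coeffA hG h hM' m4 m3 hA) hL
    · rw [State.coeff_of_not hM']; simp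

end Triangle

end TrivalentMap

namespace TrivalentMap

variable {D : Type*} [DecidableEq D] {G : TrivalentMap D} {d₀ : D}

theorem around_mod (d : D) (i : ℕ) : G.around d (i % G.faceDegree d) = G.around d i :=
  Function.iterate_mod_minimalPeriod_eq

theorem faceLabels_around {d : D} {k : D → ℤ} {κ : ℕ → ℤ} {i : ℕ} (hi : i < G.faceDegree d)
    (hno : ∀ j < G.faceDegree d, G.around d j ≠ G.rev (G.around d i)) :
    G.faceLabels d k κ (G.around d i) = κ i := by
  rw [faceLabels, sum_eq_single_of_mem i (mem_range.2 hi), if_pos rfl, if_neg (hno i hi)]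
  · ring
  · intro j hj hji
    rw [mem_range] at hj
    rw [if_neg (fun e => hji (G.around_injOn d hj hi e)), if_neg (hno j hj), add_zero]

theorem faceLabels_of_notMem {d x : D} {k : D → ℤ} {κ : ℕ → ℤ}
    (hx : ∀ j < G.faceDegree d, G.around d j ≠ x)
    (hx' : ∀ j < G.faceDegree d, G.around d j ≠ G.rev x) : G.faceLabels d k κ x = k x := by
  rw [faceLabels, sum_eq_zero, add_zero]
  intro j hj
  rw [mem_range] at hj
  rw [if_neg (hx j hj), if_neg (hx' j hj), add_zero]

namespace Triangle

variable {a b c e₃ e₄ : D} (T : Triangle G d₀ a b c e₃ e₄) (hG : G.FacesEmbedded)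
  {h : G.Removable d₀}
include T hG

section Merged

variable {d : G.Kept d₀} {t : ℕ}
  (hI : FaceInsertion (G.removeEdge h) G T.mergedDart (G.rev d₀) d t)
include hI

theorem merged_class (i : ℕ) :
    G.faceClass (T.mergedDart ((G.removeEdge h).around d i)) = G.faceClass e₃ := by
  rw [← around_mod, hI.faceClass (Nat.mod_lt _ (by have := hI.lt; omega)), T.class_rev_d₀]

theorem merged_ne (i : ℕ) {x : G.Kept d₀} (hx : (x : D) ≠ b)
    (hc : G.faceClass (x : D) ≠ G.faceClass e₃) : (G.removeEdge h).around d i ≠ x := by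
  rintro rfl
  have := T.merged_class hG hI i
  rw [T.mergedDart_of_ne hx] at this
  exact hc this

/-- The position of the dart after the inserted one. -/
theorem merged_succ (het : ((G.removeEdge h).around d t : D) = G.rev e₄) :
    ((G.removeEdge h).around d (t + 1) : D) = b ∧
    (∀ i, 0 < i → i ≤ (G.removeEdge h).faceDegree d → i ≠ t + 1 →
      ((G.removeEdge h).around d i : D) ≠ b) ∧
    ∃ v < (G.removeEdge h).faceDegree d, ((G.removeEdge h).around d v : D) = b ∧
      (v = t + 1 ∨ (v = 0 ∧ t + 1 = (G.removeEdge h).faceDegree d)) := by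
  have h1 : ((G.removeEdge h).around d (t + 1) : D) = b := by
    rw [around_succ, T.removeEdge_next, (T.removeEdge_rev_of_mem hG h).2.1 het, T.rot_rev_a]
  have hlt := hI.lt
  have hn := (G.removeEdge h).around_faceDegree d
  have hinj := (G.removeEdge h).around_injOn d
  refine ⟨h1, fun i hi hin hit hb => ?_, ?_⟩
  · have e : (G.removeEdge h).around d i = (G.removeEdge h).around d (t + 1) :=
      Subtype.ext (hb.trans h1.symm)
    rcases hin.eq_or_lt with rfl | hin
    · rw [hn] at e
      have := hinj (x₁ := 0) (by simp; omega) (by simp; omega) e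
      omega
    · rcases Nat.lt_or_ge (t + 1) ((G.removeEdge h).faceDegree d) with h2 | h2
      · exact hit (hinj hin h2 e)
      · rw [show t + 1 = (G.removeEdge h).faceDegree d by omega, hn] at e
        have := hinj (x₂ := 0) hin (by simp; omega) e
        omega
  · rcases Nat.lt_or_ge (t + 1) ((G.removeEdge h).faceDegree d) with h2 | h2
    · exact ⟨t + 1, h2, h1, Or.inl rfl⟩
    · have e : t + 1 = (G.removeEdge h).faceDegree d := by omega
      refine ⟨0, by omega, ?_, Or.inr ⟨rfl, e⟩⟩
      rw [e, hn] at h1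
      exact h1

theorem merged_labels (het : ((G.removeEdge h).around d t : D) = G.rev e₄) {v : ℕ}
    (hv : v < (G.removeEdge h).faceDegree d) (hev : ((G.removeEdge h).around d v : D) = b)
    {k : G.Kept d₀ → ℤ} (hk : ∀ x, k ((G.removeEdge h).rev x) = k x) (κ : ℕ → ℤ) :
    G.extendLabels d₀ ((G.removeEdge h).faceLabels d k κ) a = κ t ∧
    G.extendLabels d₀ ((G.removeEdge h).faceLabels d k κ) e₄ = κ t ∧
    G.extendLabels d₀ ((G.removeEdge h).faceLabels d k κ) b = κ v ∧
    G.extendLabels d₀ ((G.removeEdge h).faceLabels d k κ) e₃ = κ v ∧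
    G.extendLabels d₀ ((G.removeEdge h).faceLabels d k κ) c = G.extendLabels d₀ k c := by
  obtain ⟨n1, n2, n3, n4, n5, n6⟩ := T.class_ne hG
  obtain ⟨k1, k2, k3, k4, k5⟩ := T.kept hG h
  have hrev := @removeEdge_rev_of_mem _ _ _ _ _ _ _ _ _ T hG h
  have v1 := (T.extendLabels_apply (k := (G.removeEdge h).faceLabels d k κ) (x := ⟨_, k1⟩)).1 rfl
  have v3 := (T.extendLabels_apply (k := (G.removeEdge h).faceLabels d k κ)
    (x := ⟨_, k3⟩)).2.2.1 rfl
  have hfr := faceLabels_rev hk d κ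
  have ra : (G.removeEdge h).rev ((G.removeEdge h).around d t) = ⟨_, k1⟩ :=
    Subtype.ext (hrev.2.1 het)
  have r3 : (G.removeEdge h).rev ((G.removeEdge h).around d v) = ⟨_, k3⟩ :=
    Subtype.ext (hrev.2.2.2 hev)
  have hab : G.rev a ≠ b := fun e => n2 (by rw [← T.class_b, ← e, T.class_rev_a])
  have h3b : G.rev e₃ ≠ b := fun e => n3 (by rw [← T.class_b, ← e, T.class_rev_e₃])
  have ft : (G.removeEdge h).faceLabels d k κ ((G.removeEdge h).around d t) = κ t := by
    apply faceLabels_around hI.lt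
    intro j _
    rw [ra]
    exact T.merged_ne hG hI j hab (by rw [T.class_rev_a]; exact n4.symm)
  have fv : (G.removeEdge h).faceLabels d k κ ((G.removeEdge h).around d v) = κ v := by
    apply faceLabels_around hv
    intro j _
    rw [r3]
    exact T.merged_ne hG hI j h3b (by rw [T.class_rev_e₃]; exact n5.symm)
  have hb : (G.removeEdge h).around d v = ⟨b, k4⟩ := Subtype.ext hev
  have h4 : (G.removeEdge h).around d t = ⟨_, k2⟩ := Subtype.ext het
  refine ⟨?_, ?_, ?_, ?_, ?_⟩
  · rw [v1, ← ra, hfr, ft]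
  · rw [(T.extendLabels_apply (k := (G.removeEdge h).faceLabels d k κ)
      (x := ⟨_, k2⟩)).2.1 rfl, ← h4, ft]
  · have := extendLabels_kept ((G.removeEdge h).faceLabels d k κ) ⟨b, k4⟩
    rw [← hb, fv, hev] at this
    exact this
  · rw [v3, ← r3, hfr, fv]
  · rw [show c = ((⟨c, k5⟩ : G.Kept d₀) : D) from rfl, extendLabels_kept, extendLabels_kept]
    apply faceLabels_of_notMem
    · intro j _
      exact T.merged_ne hG hI j (fun e => n3 (by rw [← T.class_b, ← e])) n5.symm
    · intro j _
      have e : ((G.removeEdge h).rev ⟨c, k5⟩ : D) = G.rev c :=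
        T.removeEdge_rev_of_notMem h _ (T.distinct hG h).2.2.2.2.2.2.2.2
      refine T.merged_ne hG hI j ?_ ?_ <;> rw [e]
      · exact fun e => n2 (by rw [← T.class_b, ← e, T.class_rev_c])
      · rw [T.class_rev_c]; exact n4.symm

theorem merged_label {k : G.Kept d₀ → ℤ} (hk : ∀ x, k ((G.removeEdge h).rev x) = k x) (z x y : ℤ) (i : ℕ) :
    G.setTriangle d₀ a b (G.extendLabels d₀ k) z x y
        (T.mergedDart ((G.removeEdge h).around d i)) = k ((G.removeEdge h).around d i) ∧
    (((G.removeEdge h).around d i : D) ≠ b →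
      G.setTriangle d₀ a b (G.extendLabels d₀ k) z x y
        (G.rot (T.mergedDart ((G.removeEdge h).around d i))) =
        k ((G.removeEdge h).rot ((G.removeEdge h).around d i))) := by
  obtain ⟨n1, n2, n3, n4, n5, n6⟩ := T.class_ne hG
  obtain ⟨k1, k2, k3, k4, k5⟩ := T.kept hG h
  have hrev := @removeEdge_rev_of_mem _ _ _ _ _ _ _ _ _ T hG h
  have hab : G.rev a ≠ b := fun e => n2 (by rw [← T.class_b, ← e, T.class_rev_a])
  have ne_a : ((G.removeEdge h).around d i : D) ≠ G.rev a := fun e =>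
    T.merged_ne hG hI i (x := ⟨_, k1⟩) hab (by rw [T.class_rev_a]; exact n4.symm) (Subtype.ext e)
  constructor
  · by_cases hb : ((G.removeEdge h).around d i : D) = b
    · have r3 : (G.removeEdge h).rev ((G.removeEdge h).around d i) = ⟨_, k3⟩ :=
        Subtype.ext (hrev.2.2.2 hb)
      rw [T.mergedDart_of_eq hb, (T.setTriangle_apply hG (h := h) _ z x y).2.2.2.2.2.2.1,
        (T.extendLabels_apply (x := ⟨_, k3⟩)).2.2.1 rfl, ← r3, hk]
    · rw [T.mergedDart_of_ne hb, T.setTriangle_of_kept _ _ _ _ ((G.removeEdge h).around d i).2 ne_a hb,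
        extendLabels_kept]
  · intro hb
    have hcl := T.merged_class hG hI i
    rw [T.mergedDart_of_ne hb] at hcl ⊢
    rw [T.setTriangle_of_kept _ _ _ _ ((G.rot_mem_ends d₀ _).2 ((G.removeEdge h).around d i).2)]
    · exact extendLabels_kept k ((G.removeEdge h).rot ((G.removeEdge h).around d i))
    · intro e
      rw [← T.rot_c] at e
      exact n5 (by rw [← hcl, G.rot.injective e])
    · intro e
      rw [← T.rot_rev_a] at e
      exact n4 (by rw [← hcl, G.rot.injective e, T.class_rev_a])

end Merged

end Triangle

end TrivalentMap

namespace TrivalentMap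

variable {D : Type*} [DecidableEq D] {G : TrivalentMap D} {d₀ : D}

namespace Triangle

variable {a b c e₃ e₄ : D} (T : Triangle G d₀ a b c e₃ e₄) (hG : G.FacesEmbedded)
  {h : G.Removable d₀}
include T hG

section Merged

variable {d : G.Kept d₀} {t v : ℕ}
  (hI : FaceInsertion (G.removeEdge h) G T.mergedDart (G.rev d₀) d t)
  (het : ((G.removeEdge h).around d t : D) = G.rev e₄)
  (hv : v < (G.removeEdge h).faceDegree d) (hev : ((G.removeEdge h).around d v : D) = b)
  (hvt : v = t + 1 ∨ (v = 0 ∧ t + 1 = (G.removeEdge h).faceDegree d))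
  {k : G.Kept d₀ → ℤ} (hk : ∀ x, k ((G.removeEdge h).rev x) = k x)
  {q : ℝ} {ψ : G.State} {s₁ s₂ : ℤˣ}
  {l l' : ℕ → ℤ} {B : ℕ → ℤ} {E : ℕ → ℤˣ} {m m' : ℕ} {x₀ y₀ : ℤ} {Φ Φ' : (ℕ → ℤ) → ℂ}
  (hΦ : ∀ κ, Φ κ = removalFactor q s₁ s₂ (κ t) (κ v) *
    ψ.coeff (G.extendLabels d₀ ((G.removeEdge h).faceLabels d k κ)))
  (hΦ' : ∀ z κ, Φ' (insSeq t z κ) = ψ.coeff (G.setTriangle d₀ a b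
    (G.extendLabels d₀ ((G.removeEdge h).faceLabels d k κ)) z x₀ y₀))
include hI het hv hev hk hΦ

section

include hΦ'

theorem merged_coeff {κ : ℕ → ℤ} (hx : κ t = x₀) (hy : κ v = y₀) :
    Φ' (insSeq t 0 κ) * removalFactor q s₁ s₂ x₀ y₀ = Φ κ := by
  obtain ⟨m1, m2, m3, m4, m5⟩ := T.merged_labels hG hI het hv hev hk κ
  have hs := G.setTriangle_self (d₀ := d₀) (a := a) (b := b)
    (extendLabels_rev h (faceLabels_rev hk d κ))
  rw [extendLabels_d₀, m1, m3, hx, hy] at hs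
  rw [hΦ', hs, hΦ, hx, hy]
  ring

/-- An arc of the face that does not contain the inserted dart. -/
theorem arcSum_beside {s : ℤˣ} (hx : B t - E t = x₀) (hy : B v - E v = y₀) :
    (t < m → v ∉ Ioo m m' → (∀ i ∈ Ioc m m', l' (i + 1) = l i) →
      arcSum .left q l' (insSeq t (s : ℤ) B) (insSeq t s E) (m + 1) (m' + 1) Φ' *
        removalFactor q s₁ s₂ x₀ y₀ = arcSum .left q l B E m m' Φ) ∧
    (m' ≤ t → v ∉ Ioo m m' → (∀ i ∈ Ioc m m', l' i = l i) →
      arcSum .left q l' (insSeq t (s : ℤ) B) (insSeq t s E) m m' Φ' *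
        removalFactor q s₁ s₂ x₀ y₀ = arcSum .left q l B E m m' Φ) := by
  have key : t ∉ Ioo m m' → v ∉ Ioo m m' → ∀ σ ∈ seqSigns E (Ioo m m'),
      Φ' (fun i => insSeq t (s : ℤ) B i - (insSeq t s σ i : ℤˣ)) * removalFactor q s₁ s₂ x₀ y₀ =
        Φ fun i => B i - σ i := fun h1 h2 σ hσ => by
    rw [insSeq_sub, sub_self]
    rw [mem_seqSigns] at hσ
    exact T.merged_coeff hG hI het hv hev hk hΦ hΦ' (by simp only [hσ t h1, hx])
      (by simp only [hσ v h2, hy])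
  exact ⟨fun h1 h2 hl => arcSum_insert_before h1 hl (key (by simp; omega) h2),
    fun h1 h2 hl => arcSum_insert_after h1 hl (key (by simp; omega) h2)⟩

include hvt

/-- An arc of the face that contains the inserted dart. -/
theorem arcSum_through [Fintype D] (htri : G.faceDegree d₀ = 3) (hq : 0 < q) (hq1 : q ≠ 1)
    {o : D → ℤˣ} (hψ : G.IsPhysical .left q o ψ) (h1 : s₁ = -o a) (h2 : s₂ = -o b) {s : ℤˣ}
    (hmt : m ≤ t) (htm : t < m') (hm' : m' ≤ (G.removeEdge h).faceDegree d)
    (hBn : B ((G.removeEdge h).faceDegree d) = B 0)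
    (hEn : E ((G.removeEdge h).faceDegree d) = E 0)
    (hx : B t = x₀) (hy : B v = y₀) (hl : ∀ i ∈ Ioc m m', i ≤ t → l' i = l i)
    (hl2 : ∀ i ∈ Ioc m m', t + 1 < i → l' (i + 1) = l i)
    (l1 : l' (t + 1) = x₀) (l2 : l' (t + 2) = y₀) (l3 : l (t + 1) = G.extendLabels d₀ k c) :
    arcSum .left q l' (insSeq t 0 B) (insSeq t s E) m (m' + 1) Φ' *
        (-((o d₀ : ℤ) : ℂ) * removalFactor q s₁ s₂ x₀ y₀) = arcSum .left q l B E m m' Φ := by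
  subst h1 h2
  refine arcSum_insert hmt htm (fun _ => -1) hl hl2 (fun σ _ s' hs' => ?_) (fun σ hσ => ?_)
  · have : s' = 1 := (Int.units_eq_one_or s').resolve_right hs'
    rw [this, coeffA_zero_pos]
  · rw [mem_seqSigns] at hσ
    have hB1 : B (t + 1) = y₀ := by
      rcases hvt with rfl | ⟨rfl, e⟩
      · exact hy
      · rw [e, hBn, hy]
    have hσ1 : σ (t + 1) = σ v := by
      rcases hvt with rfl | ⟨rfl, e⟩
      · rfl
      · rw [hσ 0 (by simp), hσ (t + 1) (by simp; omega), e, hEn]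
    obtain ⟨m1, m2, m3, m4, m5⟩ := T.merged_labels hG hI het hv hev hk fun i => B i - σ i
    have key := T.coeff_relation hG h htri hq hq1 hψ
      (extendLabels_rev h (faceLabels_rev hk d fun i => B i - σ i)) (x := x₀) (y := y₀)
      (σ := σ t) (τ := σ v) (extendLabels_d₀ _) (by rw [m1, hx]) (by rw [m3, hy])
      (by rw [m2, hx]) (by rw [m4, hy])
    rw [insSeq_sub, hΦ', hΦ, l1, l2, l3, hB1, hσ1, hx, hy, ← m5, ← key]
    simp

end

include hvt

/-- The arcs vanish if there is no admissible labelling. -/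
theorem arcSum_eq_zero (hBn : B ((G.removeEdge h).faceDegree d) = B 0)
    (l3 : l (t + 1) = G.extendLabels d₀ k c) :
    (m' ≤ t → ¬ Triad (B t - E t) (B v - E v) (G.extendLabels d₀ k c) →
      arcSum .left q l B E m m' Φ = 0) ∧
    (m ≤ t → t < m' → ¬ Triad (B t) (B v) (G.extendLabels d₀ k c) →
      arcSum .left q l B E m m' Φ = 0) := by
  have hB1 : B (t + 1) = B v := by
    rcases hvt with rfl | ⟨rfl, e⟩
    · rfl
    · rw [e, hBn]
  constructor
  · intro hm' hT
    refine sum_eq_zero fun σ hσ => ?_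
    rw [mem_seqSigns] at hσ
    rw [hΦ, State.coeff_of_not, mul_zero, mul_zero]
    intro hM
    obtain ⟨m1, m2, m3, m4, m5⟩ := T.merged_labels hG hI het hv hev hk fun i => B i - σ i
    have hM' := hM.2 (G.rev a)
    rw [T.rot_rev_a, T.rot_b, hM.1, m1, m3, m5, hσ t (by simp; omega),
      hσ v (by simp; omega)] at hM'
    exact hT hM'
  · intro hmt htm hT
    refine sum_eq_zero fun σ _ => ?_
    rw [prod_eq_zero (i := t + 1) (by simp; omega), Complex.ofReal_zero, zero_mul]
    rw [Nat.add_sub_cancel, l3, hB1]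
    exact coeffA_eq_zero fun hA => hT (Triad.swap12.1 hA.2.1)

end Merged

/-- The difference equation for the face which is obtained by merging two faces. -/
theorem constraint_merged [Fintype D] {d : G.Kept d₀} {t : ℕ}
    (hI : FaceInsertion (G.removeEdge h) G T.mergedDart (G.rev d₀) d t)
    (het : ((G.removeEdge h).around d t : D) = G.rev e₄) (htri : G.faceDegree d₀ = 3)
    {q : ℝ} (hq : 0 < q) (hq1 : q ≠ 1) {o : D → ℤˣ} (ho : G.IsOrientation o) {ψ : G.State}
    (hψ : G.IsPhysical .left q o ψ) {o' : G.Kept d₀ → ℤˣ}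
    (hP : ∏ i ∈ range ((G.removeEdge h).faceDegree d),
        ((o (T.mergedDart ((G.removeEdge h).around d i)) : ℤ) : ℂ) =
      ∏ i ∈ range ((G.removeEdge h).faceDegree d),
        ((o' ((G.removeEdge h).around d i) : ℤ) : ℂ))
    {k : G.Kept d₀ → ℤ} (hka : (G.removeEdge h).Admissible k)
    {r : ℕ} (hr0 : 0 < r) (hr : r < (G.removeEdge h).faceDegree d) (ε : G.Kept d₀ → ℤˣ) :
    (G.removeEdge h).constraint .left q o' (G.reducedState q o a b ψ h) d r ε k = 0 := by
  obtain ⟨hb1, hb2, v, hv, hev, hvt⟩ := T.merged_succ hG hI het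
  have hk := hka.1
  have hk' := (T.admissible_extendLabels_iff hG h).2 hka
  obtain ⟨w1, w2, w3, w4, -⟩ := T.merged_labels hG hI het hv hev hk
    fun i => k ((G.removeEdge h).around d i)
  have hself : (G.removeEdge h).faceLabels d k (fun i => k ((G.removeEdge h).around d i)) = k := by
    funext x; simp [faceLabels]
  rw [hself] at w1 w2 w3 w4
  have hn0 := (G.removeEdge h).around_faceDegree d
  have hlt := hI.lt
  rw [constraint_eq_zero_iff _ _ _ _ _ _ hr]
  have hoo := unit_cast_mul_self (o d₀)
  set n := (G.removeEdge h).faceDegree d with hn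
  set e := (G.removeEdge h).around d with he
  have he0 : e n = e 0 := hn0
  set Φ : (ℕ → ℤ) → ℂ := fun κ =>
    (G.reducedState q o a b ψ h).coeff ((G.removeEdge h).faceLabels d k κ) with hΦdef
  have hΦ : ∀ κ, Φ κ = removalFactor q (-o a) (-o b) (κ t) (κ v) *
      ψ.coeff (G.extendLabels d₀ ((G.removeEdge h).faceLabels d k κ)) := fun κ => by
    obtain ⟨m1, -, m3, -⟩ := T.merged_labels hG hI het hv hev hk κ
    simp only [hΦdef]
    rw [T.reducedState_coeff hG hq hq1, m1, m3]
  set l : ℕ → ℤ := fun i => k ((G.removeEdge h).rot (e i)) with hl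
  have l3 : l (t + 1) = G.extendLabels d₀ k c := by
    simp only [hl]
    rw [← extendLabels_kept k]
    show G.extendLabels d₀ k (G.rot (e (t + 1) : D)) = _
    rw [hb1, T.rot_b]
  have hvn : v ∉ Ioo 0 r ∨ t < r := by
    rcases hvt with rfl | ⟨rfl, -⟩
    · by_cases htr : t < r
      · exact Or.inr htr
      · left; simp; omega
    · left; simp
  have corner : ∀ (z x y : ℤ) (l' : ℕ → ℤ), (∀ i, l' i = G.setTriangle d₀ a b
      (G.extendLabels d₀ k) z x y (G.rot (insSeq t (G.rev d₀) (fun i => T.mergedDart (e i)) i))) →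
      (∀ i ∈ Ioc 0 n, i ≤ t → l' i = l i) ∧ (∀ i ∈ Ioc 0 n, t + 1 < i → l' (i + 1) = l i) ∧
      l' (t + 1) = x ∧ l' (t + 2) = y := fun z x y l' hl' => by
    obtain ⟨u1, u2, u3, u4, u5, u6, u7, u8, u9⟩ :=
      T.setTriangle_apply hG (h := h) (G.extendLabels d₀ k) z x y
    refine ⟨fun i hi hit => ?_, fun i hi hit => ?_, ?_, ?_⟩
    · rw [mem_Ioc] at hi
      rw [hl', insSeq_of_le hit]
      exact (T.merged_label hG hI hk z x y i).2 (hb2 i hi.1 hi.2 (by omega))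
    · rw [mem_Ioc] at hi
      rw [hl', insSeq_of_lt (by omega)]
      exact (T.merged_label hG hI hk z x y i).2 (hb2 i hi.1 hi.2 (by omega))
    · rw [hl', insSeq_self, T.rot_rev, u3]
    · rw [hl', insSeq_of_lt (by omega), T.mergedDart_of_eq hb1, T.rot_e₃, u6]
  have ho0 : ((o (G.rev d₀) : ℤ) : ℂ) = -((o d₀ : ℤ) : ℂ) := by rw [ho]; simp
  by_cases htr : t < r
  · have hbase : G.setTriangle d₀ a b (G.extendLabels d₀ k) 0 (k (e t)) (k (e v)) =
        G.extendLabels d₀ k := by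
      have := G.setTriangle_self (d₀ := d₀) (a := a) (b := b) (extendLabels_rev h hk)
      rwa [extendLabels_d₀, w1, w3] at this
    have key := hI.arcSum_eq hψ (k' := G.setTriangle d₀ a b (G.extendLabels d₀ k) 0 (k (e t))
      (k (e v))) (by rw [hbase]; exact hk') (k := k)
      (fun i => (T.merged_label hG hI hk _ _ _ i).1) ε 1 hr0 hr
      (T.setTriangle_apply hG (h := h) _ _ _ _).2.1 (r' := r + 1) (if_neg (by omega)).symm
    obtain ⟨c1, c2, c3, c4⟩ := corner 0 (k (e t)) (k (e v)) (fun i =>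
      G.setTriangle d₀ a b (G.extendLabels d₀ k) 0 (k (e t)) (k (e v))
        (G.rot (insSeq t (G.rev d₀) (fun i => T.mergedDart (e i)) i))) fun i => rfl
    set Φ' : (ℕ → ℤ) → ℂ := fun κ => ψ.coeff (G.faceLabels (T.mergedDart d)
      (G.setTriangle d₀ a b (G.extendLabels d₀ k) 0 (k (e t)) (k (e v))) κ) with hΦ'def
    have hΦ' : ∀ z κ, Φ' (insSeq t z κ) = ψ.coeff (G.setTriangle d₀ a b (G.extendLabels d₀
        ((G.removeEdge h).faceLabels d k κ)) z (k (e t)) (k (e v))) := fun z κ =>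
      congrArg ψ.coeff (T.faceLabels_mergedDart hG hI hk 0 (k (e t)) (k (e v)) z κ)
    have e1 := T.arcSum_through hG hI het hv hev hvt hk (m := 0) (m' := r)
      (B := fun i => k (e i)) (E := fun i => ε (e i)) (s := 1)
      hΦ hΦ' htri hq hq1 hψ rfl rfl (by omega) htr hr.le (congrArg k he0)
      (congrArg ε he0) rfl rfl (fun i hi => c1 i (by simp at hi ⊢; omega))
      (fun i hi => c2 i (by simp at hi ⊢; omega)) c3 c4 l3
    have e2 := (T.arcSum_beside hG hI het hv hev hk (m := r) (m' := n) (l := l) (l' := fun i =>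
        G.setTriangle d₀ a b (G.extendLabels d₀ k) 0 (k (e t)) (k (e v))
        (G.rot (insSeq t (G.rev d₀) (fun i => T.mergedDart (e i)) i)))
      (B := fun i => k (e i) - ε (e i)) (E := fun i => -ε (e i)) (s := -1)
      hΦ hΦ' (by simp) (by simp)).1 htr (by simp; omega)
      (fun i hi => c2 i (by simp at hi ⊢; omega) (by simp at hi; omega))
    rw [hP, ho0, zero_sub, ← Units.val_neg] at key
    rw [← e1, ← e2, key]
    linear_combination ((coeffAlpha .left q (ε (e 0)) (ε (e r)) (k (e 0)) (k (e r)) : ℝ) : ℂ) *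
      (∏ i ∈ range n, ((o' (e i) : ℤ) : ℂ)) * arcSum .left q (fun i =>
        G.setTriangle d₀ a b (G.extendLabels d₀ k) 0 (k (e t)) (k (e v))
        (G.rot (insSeq t (G.rev d₀) (fun i => T.mergedDart (e i)) i)))
        (insSeq t ((-1 : ℤˣ) : ℤ) fun i => k (e i) - ε (e i)) (insSeq t (-1) fun i => -ε (e i))
        (r + 1) (n + 1) Φ' * removalFactor q (-o a) (-o b) (k (e t)) (k (e v)) * hoo
  · have hvt' : v ∉ Ioo 0 r := hvn.resolve_right htr
    set x₀ := k (e t) - ε (e t) with hx₀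
    set y₀ := k (e v) - ε (e v) with hy₀
    set B : ℕ → ℤ := fun i => k (e i) - ε (e i) with hB
    have hBn : B n = B 0 := by simp only [hB]; rw [he0]
    by_cases hT : Triad x₀ y₀ (G.extendLabels d₀ k c)
    · have hbase : G.Admissible (G.setTriangle d₀ a b (G.extendLabels d₀ k) 1 x₀ y₀) := by
        refine T.admissible_setTriangle hG (h := h) hk' ?_ ?_ hT
        · rw [w4]
          exact Triad.rotate.2 (triad_sub_unit (hka.nonneg _) hT.nonneg.2.1)
        · rw [w2]
          exact Triad.rotate.2 (Triad.swap12.1 (triad_sub_unit (hka.nonneg _) hT.nonneg.1))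
      have key := hI.arcSum_eq hψ hbase (k := k)
        (fun i => (T.merged_label hG hI hk _ _ _ i).1) ε 1 hr0 hr
        (T.setTriangle_apply hG (h := h) _ _ _ _).2.1 (r' := r) (if_pos (by omega)).symm
      obtain ⟨c1, c2, c3, c4⟩ := corner 1 x₀ y₀ (fun i =>
      G.setTriangle d₀ a b (G.extendLabels d₀ k) 1 x₀ y₀
        (G.rot (insSeq t (G.rev d₀) (fun i => T.mergedDart (e i)) i))) fun i => rfl
      set Φ' : (ℕ → ℤ) → ℂ := fun κ => ψ.coeff (G.faceLabels (T.mergedDart d)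
        (G.setTriangle d₀ a b (G.extendLabels d₀ k) 1 x₀ y₀) κ) with hΦ'def
      have hΦ' : ∀ z κ, Φ' (insSeq t z κ) = ψ.coeff (G.setTriangle d₀ a b (G.extendLabels d₀
          ((G.removeEdge h).faceLabels d k κ)) z x₀ y₀) := fun z κ =>
        congrArg ψ.coeff (T.faceLabels_mergedDart hG hI hk 1 x₀ y₀ z κ)
      have e1 := (T.arcSum_beside hG hI het hv hev hk (m := 0) (m' := r) (l := l) (l' := fun i =>
        G.setTriangle d₀ a b (G.extendLabels d₀ k) 1 x₀ y₀
        (G.rot (insSeq t (G.rev d₀) (fun i => T.mergedDart (e i)) i)))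
        (B := fun i => k (e i)) (E := fun i => ε (e i)) (s := 1)
        hΦ hΦ' rfl rfl).2 (by omega) hvt'
        (fun i hi => c1 i (by simp at hi ⊢; omega) (by simp at hi; omega))
      have e2 := T.arcSum_through hG hI het hv hev hvt hk (m := r) (m' := n)
        (B := B) (E := fun i => -ε (e i)) (s := -1)
        hΦ hΦ' htri hq hq1 hψ rfl rfl (by omega) hlt le_rfl hBn
        (congrArg (fun x => -ε x) he0) rfl rfl (fun i hi => c1 i (by simp at hi ⊢; omega))
        (fun i hi => c2 i (by simp at hi ⊢; omega)) c3 c4 l3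
      rw [hP, ho0, Units.val_one, sub_self] at key
      rw [← e1, ← e2]
      rw [Units.val_one, key]
      ring
    · rw [(T.arcSum_eq_zero hG hI het hv hev hvt hk hΦ (B := fun i => k (e i))
        (congrArg k he0) l3).1 (by omega) hT,
        (T.arcSum_eq_zero hG hI het hv hev hvt hk hΦ hBn l3).2 (by omega) hlt hT, mul_zero]

end Triangle

end TrivalentMap

namespace TrivalentMap

variable {D : Type*} [DecidableEq D] {G : TrivalentMap D} {d₀ : D}

namespace Triangle

variable {a b c e₃ e₄ : D} (T : Triangle G d₀ a b c e₃ e₄) (hG : G.FacesEmbedded)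
  {h : G.Removable d₀}
include T

theorem removeOrientation_apply (o : D → ℤˣ) (x : G.Kept d₀) :
    ((x : D) = G.rev a → G.removeOrientation d₀ o x = o e₄) ∧
    ((x : D) ≠ G.rev a → (x : D) = b → G.removeOrientation d₀ o x = o e₃) ∧
    ((x : D) ≠ G.rev a → (x : D) ≠ b → G.removeOrientation d₀ o x = o x) := by
  have h1 : G.rev x = a ↔ (x : D) = G.rev a := eq_rev_iff
  have h2 : G.rev x = G.rev b ↔ (x : D) = b := G.rev.injective.eq_iff
  simp only [removeOrientation, T.rot_rev, T.rot_a, T.rot_d₀, T.rot_e₃, h1, h2]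
  refine ⟨fun h => if_pos h, fun h h' => ?_, fun h h' => ?_⟩
  · rw [if_neg h, if_pos h']
  · rw [if_neg h, if_neg h']

variable [Fintype D] {q : ℝ} (hq : 0 < q) (hq1 : q ≠ 1) {o : D → ℤˣ} (ho : G.IsOrientation o)
  {ψ : G.State} (hψ : G.IsPhysical .left q o ψ) {d : G.Kept d₀} {t : ℕ}
  {k : G.Kept d₀ → ℤ} (hka : (G.removeEdge h).Admissible k)
  {r : ℕ} (hr0 : 0 < r) (hr : r < (G.removeEdge h).faceDegree d) (ε : G.Kept d₀ → ℤˣ)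
include hG hq hq1 hψ hka hr0 hr

theorem constraint_same
    (hno : ∀ i, ((G.removeEdge h).around d i : D) ≠ G.rev a ∧
      ((G.removeEdge h).around d i : D) ≠ G.rev e₃ ∧
      ((G.removeEdge h).around d i : D) ≠ G.rev e₄ ∧ ((G.removeEdge h).around d i : D) ≠ b)
    (hdeg : G.faceDegree (d : D) = (G.removeEdge h).faceDegree d)
    (haround : ∀ i, G.around (d : D) i = (G.removeEdge h).around d i) :
    (G.removeEdge h).constraint .left q (G.removeOrientation d₀ o) (G.reducedState q o a b ψ h)
      d r ε k = 0 := by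
  obtain ⟨k1, k2, k3, k4, k5⟩ := T.kept hG h
  have hk := hka.1
  have hk' := (T.admissible_extendLabels_iff hG h).2 hka
  have hrev := @removeEdge_rev_of_mem _ _ _ _ _ _ _ _ _ T hG h
  have hlab := extendLabels_faceLabels_same hdeg haround hk fun x hx i e => by
    have e' := congrArg Subtype.val e
    rcases T.rev_mem_ends x hx with hx | hx | hx | hx
    · exact (hno i).2.2.1 (e'.trans (hrev.1 hx))
    · exact (hno i).1 (e'.trans (hrev.2.1 hx))
    · exact (hno i).2.2.2 (e'.trans (hrev.2.2.1 hx))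
    · exact (hno i).2.1 (e'.trans (hrev.2.2.2 hx))
  have hla : ∀ κ, G.extendLabels d₀ ((G.removeEdge h).faceLabels d k κ) a = k ⟨_, k1⟩ := by
    intro κ
    rw [(T.extendLabels_apply (x := ⟨_, k1⟩)).1 rfl]
    refine faceLabels_of_notMem (fun j _ e => (hno j).1 (congrArg Subtype.val e))
      (fun j _ e => (hno j).2.2.1 ((congrArg Subtype.val e).trans (hrev.1 rfl)))
  have hlb : ∀ κ, G.extendLabels d₀ ((G.removeEdge h).faceLabels d k κ) b = k ⟨_, k4⟩ := by
    intro κ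
    refine (extendLabels_kept _ (⟨b, k4⟩ : G.Kept d₀)).trans ?_
    refine faceLabels_of_notMem (fun j _ e => (hno j).2.2.2 (congrArg Subtype.val e))
      (fun j _ e => (hno j).2.1 ((congrArg Subtype.val e).trans (hrev.2.2.2 rfl)))
  have hΦ : ∀ κ, ψ.coeff (G.faceLabels d (G.extendLabels d₀ k) κ) *
      removalFactor q (-o a) (-o b) (k ⟨_, k1⟩) (k ⟨_, k4⟩) =
      (G.reducedState q o a b ψ h).coeff ((G.removeEdge h).faceLabels d k κ) := fun κ => by
    rw [T.reducedState_coeff hG hq hq1, hla, hlb, hlab, mul_comm]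
  have key := (G.constraint_eq_zero_iff .left q o ψ (d : D) (r := r) (by rw [hdeg]; exact hr)
    (fun x => if hx : x ∉ G.ends d₀ then ε ⟨x, hx⟩ else 1) _).1
    (hψ d r hr0 (by rw [hdeg]; exact hr) _ _ hk')
  have hε : ∀ x : G.Kept d₀, (if hx : (x : D) ∉ G.ends d₀ then ε ⟨x, hx⟩ else 1) = ε x :=
    fun x => dif_pos x.2
  have ho' : ∀ i, G.removeOrientation d₀ o ((G.removeEdge h).around d i) =
      o ((G.removeEdge h).around d i) := fun i =>
    (T.removeOrientation_apply o _).2.2 (hno i).1 (hno i).2.2.2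
  have hrot : ∀ x : G.Kept d₀, G.extendLabels d₀ k (G.rot x) = k ((G.removeEdge h).rot x) :=
    fun x => extendLabels_kept k ((G.removeEdge h).rot x)
  simp only [haround, hε, hdeg, extendLabels_kept, hrot] at key
  rw [constraint_eq_zero_iff _ _ _ _ _ _ hr]
  simp only [ho']
  rw [← arcSum_mul_congr (Φ' := fun κ => ψ.coeff (G.faceLabels d (G.extendLabels d₀ k) κ))
      (fun i _ => rfl) (fun σ _ => hΦ fun i => k ((G.removeEdge h).around d i) - σ i),
    ← arcSum_mul_congr (Φ' := fun κ => ψ.coeff (G.faceLabels d (G.extendLabels d₀ k) κ))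
      (K := fun i => k ((G.removeEdge h).around d i) - ε ((G.removeEdge h).around d i))
      (fun i _ => rfl) (fun σ _ => hΦ fun i =>
        k ((G.removeEdge h).around d i) - ε ((G.removeEdge h).around d i) - σ i), key]
  ring

include ho

theorem constraint_merged_a (het : ((G.removeEdge h).around d t : D) = G.rev a)
    (hI : FaceInsertion (G.removeEdge h) G Subtype.val e₄ d t) :
    (G.removeEdge h).constraint .left q (G.removeOrientation d₀ o) (G.reducedState q o a b ψ h)
      d r ε k = 0 := by
  obtain ⟨n1, n2, n3, n4, n5, n6⟩ := T.class_ne hG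
  obtain ⟨k1, k2, k3, k4, k5⟩ := T.kept hG h
  have m := fun x => T.mem_ends (x := x)
  have hk := hka.1
  have hk' := (T.admissible_extendLabels_iff hG h).2 hka
  have hrev := @removeEdge_rev_of_mem _ _ _ _ _ _ _ _ _ T hG h
  have et : (G.removeEdge h).around d t = ⟨_, k1⟩ := Subtype.ext het
  have hne : ∀ j < (G.removeEdge h).faceDegree d, ∀ x : G.Kept d₀,
      G.faceClass (x : D) ≠ G.faceClass e₄ → (G.removeEdge h).around d j ≠ x := fun j hj x hx e =>
    hx (by rw [← hI.faceClass hj, e])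
  have r4 : (G.removeEdge h).rev ⟨_, k2⟩ = (G.removeEdge h).around d t := by
    rw [et]; exact Subtype.ext (hrev.2.1 rfl)
  have ra : (G.removeEdge h).rev ((G.removeEdge h).around d t) = ⟨_, k2⟩ := by
    rw [← r4, (G.removeEdge h).rev_rev]
  have hla : ∀ κ, G.extendLabels d₀ ((G.removeEdge h).faceLabels d k κ) a = κ t := fun κ => by
    rw [(T.extendLabels_apply (x := ⟨_, k1⟩)).1 rfl, ← et]
    refine faceLabels_around hI.lt fun j hj => ?_
    rw [ra]
    exact hne j hj _ (by rw [T.class_rev_e₄]; exact n4)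
  have hlb : ∀ κ, G.extendLabels d₀ ((G.removeEdge h).faceLabels d k κ) b = k ⟨_, k4⟩ := by
    intro κ
    refine (extendLabels_kept _ (⟨b, k4⟩ : G.Kept d₀)).trans ?_
    refine faceLabels_of_notMem (fun j hj => hne j hj _ (by rw [T.class_b]; exact n2))
      (fun j hj => hne j hj _ ?_)
    rw [hrev.2.2.2 rfl, T.class_rev_e₃]
    exact n6.symm
  refine constraint_of_insertion_val hq hq1 hψ hI hk'
    (extendLabels_faceLabels_val hI hk (x₀ := ⟨_, k2⟩) (G.rev_rev e₄) ((m _).2 (by simp)) r4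
      fun x hx hxx i hi => hne i hi _ ?_)
    (g := fun x => removalFactor q (-o a) (-o b) x (k ⟨b, k4⟩)) (s := -o a)
    (fun x hx σ => removalFactor_sub hq hq1 _ _ _ hx _)
    (fun κ => by rw [T.reducedState_coeff hG hq hq1, hla, hlb])
    ?_ (by rw [T.rot_e₄, extendLabels_rev_d₀]) ?_ hr0 hr ε
  · rcases T.rev_mem_ends x hx with hx | hx | hx | hx
    · rw [hrev.1 hx, T.class_rev_e₄]; exact n4
    · exact absurd (Subtype.ext hx) hxx
    · rw [hrev.2.2.1 hx, T.class_b]; exact n2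
    · rw [hrev.2.2.2 hx, T.class_rev_e₃]; exact n6.symm
  · rw [(T.extendLabels_apply (x := ⟨_, k2⟩)).2.1 rfl, ← r4, hk]
  · have hmem := mem_range.2 hI.lt
    have hpr : ∏ i ∈ (range ((G.removeEdge h).faceDegree d)).erase t,
        ((o ((G.removeEdge h).around d i) : ℤ) : ℂ) =
      ∏ i ∈ (range ((G.removeEdge h).faceDegree d)).erase t,
        ((G.removeOrientation d₀ o ((G.removeEdge h).around d i) : ℤ) : ℂ) := by
      refine prod_congr rfl fun i hi => ?_
      rw [mem_erase, mem_range] at hi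
      have hi1 : ((G.removeEdge h).around d i : D) ≠ G.rev a := fun e =>
        hi.1 ((G.removeEdge h).around_injOn d hi.2 hI.lt (Subtype.ext (e.trans het.symm)))
      have hi2 : ((G.removeEdge h).around d i : D) ≠ b := fun e =>
        hne i hi.2 ⟨b, k4⟩ (by rw [T.class_b]; exact n2) (Subtype.ext e)
      rw [(T.removeOrientation_apply o _).2.2 hi1 hi2]
    rw [← mul_prod_erase _ _ hmem, ← mul_prod_erase _ (fun i =>
      ((G.removeOrientation d₀ o ((G.removeEdge h).around d i) : ℤ) : ℂ)) hmem,
      (T.removeOrientation_apply o _).1 het, het, ho, hpr]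
    ring

theorem constraint_merged_b (het : ((G.removeEdge h).around d t : D) = G.rev e₃)
    (hI : FaceInsertion (G.removeEdge h) G Subtype.val (G.rev b) d t) :
    (G.removeEdge h).constraint .left q (G.removeOrientation d₀ o) (G.reducedState q o a b ψ h)
      d r ε k = 0 := by
  obtain ⟨n1, n2, n3, n4, n5, n6⟩ := T.class_ne hG
  obtain ⟨k1, k2, k3, k4, k5⟩ := T.kept hG h
  have m := fun x => T.mem_ends (x := x)
  have hk := hka.1
  have hk' := (T.admissible_extendLabels_iff hG h).2 hka
  have hrev := @removeEdge_rev_of_mem _ _ _ _ _ _ _ _ _ T hG h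
  have et : (G.removeEdge h).around d t = ⟨_, k3⟩ := Subtype.ext het
  have hne : ∀ j < (G.removeEdge h).faceDegree d, ∀ x : G.Kept d₀,
      G.faceClass (x : D) ≠ G.faceClass c → (G.removeEdge h).around d j ≠ x := fun j hj x hx e =>
    hx (by rw [← T.class_rev_b, ← hI.faceClass hj, e])
  have rb : (G.removeEdge h).rev ⟨_, k4⟩ = (G.removeEdge h).around d t := by
    rw [et]; exact Subtype.ext (hrev.2.2.2 rfl)
  have r3 : (G.removeEdge h).rev ((G.removeEdge h).around d t) = ⟨_, k4⟩ := by
    rw [← rb, (G.removeEdge h).rev_rev]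
  have hlb : ∀ κ, G.extendLabels d₀ ((G.removeEdge h).faceLabels d k κ) b = κ t := fun κ => by
    have := extendLabels_kept ((G.removeEdge h).faceLabels d k κ) ⟨b, k4⟩
    rw [← faceLabels_rev hk, rb] at this
    rw [this]
    refine faceLabels_around hI.lt fun j hj => ?_
    rw [r3]
    exact hne j hj _ (by rw [T.class_b]; exact n3)
  have hla : ∀ κ, G.extendLabels d₀ ((G.removeEdge h).faceLabels d k κ) a = k ⟨_, k1⟩ := by
    intro κ
    rw [(T.extendLabels_apply (x := ⟨_, k1⟩)).1 rfl]
    refine faceLabels_of_notMem (fun j hj => hne j hj _ (by rw [T.class_rev_a]; exact n6))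
      (fun j hj => hne j hj _ ?_)
    rw [hrev.1 rfl, T.class_rev_e₄]
    exact n5
  refine constraint_of_insertion_val hq hq1 hψ hI hk'
    (extendLabels_faceLabels_val hI hk (x₀ := ⟨_, k4⟩) rfl ((m _).2 (by simp)) rb
      fun x hx hxx i hi => hne i hi _ ?_)
    (g := fun y => removalFactor q (-o b) (-o a) y (k ⟨_, k1⟩)) (s := -o b)
    (fun x hx σ => removalFactor_sub hq hq1 _ _ _ hx _)
    (fun κ => by rw [T.reducedState_coeff hG hq hq1, hla, hlb, removalFactor_comm])
    ?_ (by rw [T.rot_rev_b, extendLabels_d₀]) ?_ hr0 hr ε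
  · rcases T.rev_mem_ends x hx with hx | hx | hx | hx
    · rw [hrev.1 hx, T.class_rev_e₄]; exact n5
    · rw [hrev.2.1 hx, T.class_rev_a]; exact n6
    · rw [hrev.2.2.1 hx, T.class_b]; exact n3
    · exact absurd (Subtype.ext hx) hxx
  · rw [(T.extendLabels_apply (x := ⟨_, k4⟩)).2.2.2 rfl, ← rb, hk]
  · rw [ho]
    congr 1
    refine prod_congr rfl fun i hi => ?_
    rw [mem_range] at hi
    rw [(T.removeOrientation_apply o _).2.2
      (fun e => hne i hi ⟨_, k1⟩ (by rw [T.class_rev_a]; exact n6) (Subtype.ext e))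
      (fun e => hne i hi ⟨_, k4⟩ (by rw [T.class_b]; exact n3) (Subtype.ext e))]

omit hka hr0 hr in
/-- For the ordering `left`, the state induced by a physical state on the graph with the edge `d₀`
removed is physical. -/
theorem isPhysical_left (h : G.Removable d₀) (htri : G.faceDegree d₀ = 3) :
    (G.removeEdge h).IsPhysical .left q (G.removeOrientation d₀ o)
      (G.reducedState q o a b ψ h) := by
  intro d r hr0 hr ε k hka
  obtain ⟨n1, n2, n3, n4, n5, n6⟩ := T.class_ne hG
  obtain ⟨k1, k2, k3, k4, k5⟩ := T.kept hG h
  rcases T.face_cases hG h d with ⟨t, het, hI⟩ | ⟨t, het, hI⟩ | ⟨t, het, hI⟩ | ⟨hno, hdeg, har⟩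
  · exact T.constraint_merged_a hG hq hq1 ho hψ hka hr0 hr ε het hI
  · exact T.constraint_merged_b hG hq hq1 ho hψ hka hr0 hr ε het hI
  · refine T.constraint_merged hG hI het htri hq hq1 ho hψ (prod_congr rfl fun i _ => ?_)
      hka hr0 hr ε
    have hab : G.rev a ≠ b := fun e => n2 (by rw [← T.class_b, ← e, T.class_rev_a])
    have hi1 : ((G.removeEdge h).around d i : D) ≠ G.rev a := fun e =>
      T.merged_ne hG hI i (x := ⟨_, k1⟩) hab (by rw [T.class_rev_a]; exact n4.symm)
        (Subtype.ext e)
    by_cases hb : ((G.removeEdge h).around d i : D) = b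
    · rw [T.mergedDart_of_eq hb, (T.removeOrientation_apply o _).2.1 hi1 hb]
    · rw [T.mergedDart_of_ne hb, (T.removeOrientation_apply o _).2.2 hi1 hb]
  · exact T.constraint_same hG hq hq1 hψ hka hr0 hr ε hno hdeg har

end Triangle

end TrivalentMap

section SixJSquares

variable {q : ℝ}

/-- The square of a `6j` symbol whose Racah sum has a single term. -/
theorem sixJ_mul_self_of_single {a b c d e f z : ℤ}
    (h : Triad a b c ∧ Triad a e f ∧ Triad d b f ∧ Triad d e c)
    (h1 : max (max ((a + b + c) / 2) ((a + e + f) / 2))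
      (max ((d + b + f) / 2) ((d + e + c) / 2)) = z)
    (h2 : min (min ((a + b + d + e) / 2) ((a + c + d + f) / 2)) ((b + c + e + f) / 2) = z) :
    sixJ q a b c d e f * sixJ q a b c d e f =
      (triangleCoeff q a b c * triangleCoeff q a b c) *
      (triangleCoeff q a e f * triangleCoeff q a e f) *
      (triangleCoeff q d b f * triangleCoeff q d b f) *
      (triangleCoeff q d e c * triangleCoeff q d e c) *
      (qFact q (z + 1) /
          (qFact q (z - (a + b + c) / 2) * qFact q (z - (a + e + f) / 2) *
            qFact q (z - (d + b + f) / 2) * qFact q (z - (d + e + c) / 2) *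
            qFact q ((a + b + d + e) / 2 - z) * qFact q ((a + c + d + f) / 2 - z) *
            qFact q ((b + c + e + f) / 2 - z))) ^ 2 := by
  have hz : (-1 : ℝ) ^ z * (-1 : ℝ) ^ z = 1 := by
    rw [← zpow_add₀ (by norm_num), Even.neg_one_zpow ⟨z, rfl⟩]
  rw [sixJ, if_pos h, h1, h2, Finset.Icc_self, Finset.sum_singleton, mul_div_assoc]
  linear_combination (triangleCoeff q a b c * triangleCoeff q a b c) *
      (triangleCoeff q a e f * triangleCoeff q a e f) *
      (triangleCoeff q d b f * triangleCoeff q d b f) *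
      (triangleCoeff q d e c * triangleCoeff q d e c) *
      (qFact q (z + 1) /
          (qFact q (z - (a + b + c) / 2) * qFact q (z - (a + e + f) / 2) *
            qFact q (z - (d + b + f) / 2) * qFact q (z - (d + e + c) / 2) *
            qFact q ((a + b + d + e) / 2 - z) * qFact q ((a + c + d + f) / 2 - z) *
            qFact q ((b + c + e + f) / 2 - z))) ^ 2 * hz

theorem qNum_lt_add_two (hq : 0 < q) (hq1 : q ≠ 1) (n : ℤ) : qNum q n < qNum q (n + 2) := by
  simp only [qNum_eq_zpow hq]
  have ht : 0 < q ^ (1 / 2 : ℝ) := Real.rpow_pos_of_pos hq _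
  have hd := sub_inv_ne_zero ht (sqrt_base_ne_one hq hq1)
  generalize q ^ (1 / 2 : ℝ) = t at ht hd
  rw [← sub_pos, ← sub_div, zpow_add₀ ht.ne', show (2 : ℤ) = ((2 : ℕ) : ℤ) from rfl, zpow_natCast]
  have hT := zpow_pos ht n
  generalize t ^ n = T at hT
  have e : (T * t ^ 2 - (T * t ^ 2)⁻¹ - (T - T⁻¹)) / (t - t⁻¹) = T * t + (T * t)⁻¹ := by
    rw [div_eq_iff hd]
    field_simp
    ring
  rw [e]
  positivity

theorem qFact_one (hq : 0 < q) (hq1 : q ≠ 1) : qFact q 1 = 1 := by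
  have := qFact_succ (q := q) le_rfl
  simpa [qFact_zero, qNum_one hq hq1] using this

theorem sixJ_raise_mul_self (hq : 0 < q) (hq1 : q ≠ 1) {p r s : ℤ} (hp : 0 ≤ p) (hr : 0 ≤ r)
    (hs : 0 ≤ s) :
    sixJ q (p + s + 1) (p + s) 1 (r + s) (r + s + 1) (p + r) *
        sixJ q (p + s + 1) (p + s) 1 (r + s) (r + s + 1) (p + r) =
      qNum q (p + r + s + 2) * qNum q (s + 1) / (qNum q (p + s + 1) * qNum q (p + s + 2) *
        (qNum q (r + s + 1) * qNum q (r + s + 2))) := by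
  rw [sixJ_mul_self_of_single (z := p + r + s + 1)
    (by simp only [Triad, Int.even_iff]; omega) (by omega) (by omega)]
  simp only [triangleCoeff_mul_self hq hq1]
  have f := fun n => (qFact_pos hq hq1 n).ne'
  have g := fun {n : ℤ} (hn : 0 < n) => (qNum_pos hq hq1 hn).ne'
  have g1 := g (n := p + s + 1) (by omega)
  have g2 := g (n := p + s + 2) (by omega)
  have g3 := g (n := r + s + 1) (by omega)
  have g4 := g (n := r + s + 2) (by omega)
  rw [show (p + s + 1 - (p + s + 1)) / 2 = 0 by omega,
    show (p + s + 1 + 1 - (p + s)) / 2 = 1 by omega,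
    show (p + s + 1 + (p + s) - 1) / 2 = p + s by omega,
    show (p + s + 1 + (p + s) + 1) / 2 = p + s + 1 by omega,
    show (r + s + 1 + (p + r) - (p + s + 1)) / 2 = r by omega,
    show (p + s + 1 + (p + r) - (r + s + 1)) / 2 = p by omega,
    show (p + s + 1 + (r + s + 1) - (p + r)) / 2 = s + 1 by omega,
    show (p + s + 1 + (r + s + 1) + (p + r)) / 2 = p + r + s + 1 by omega,
    show (p + s + (p + r) - (r + s)) / 2 = p by omega,
    show (r + s + (p + r) - (p + s)) / 2 = r by omega,
    show (r + s + (p + s) - (p + r)) / 2 = s by omega,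
    show (r + s + (p + s) + (p + r)) / 2 = p + r + s by omega,
    show (r + s + 1 + 1 - (r + s)) / 2 = 1 by omega,
    show (r + s + 1 - (r + s + 1)) / 2 = 0 by omega,
    show (r + s + (r + s + 1) - 1) / 2 = r + s by omega,
    show (r + s + (r + s + 1) + 1) / 2 = r + s + 1 by omega,
    show p + r + s + 1 - (p + s + 1) = r by omega,
    show p + r + s + 1 - (p + r + s + 1) = 0 by omega,
    show p + r + s + 1 - (p + r + s) = 1 by omega,
    show p + r + s + 1 - (r + s + 1) = p by omega,
    show (p + s + 1 + (p + s) + (r + s) + (r + s + 1)) / 2 - (p + r + s + 1) = s by omega,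
    show (p + s + 1 + 1 + (r + s) + (p + r)) / 2 - (p + r + s + 1) = 0 by omega,
    qFact_zero, qFact_one hq hq1, qFact_succ (n := p + s + 1) (by omega),
    qFact_succ (n := p + s) (by omega), qFact_succ (n := p + r + s + 1) (by omega),
    qFact_succ (n := r + s + 1) (by omega), qFact_succ (n := r + s) (by omega),
    qFact_succ (n := s) (by omega), show p + s + 1 + 1 = p + s + 2 by ring,
    show r + s + 1 + 1 = r + s + 2 by ring, show p + r + s + 1 + 1 = p + r + s + 2 by ring]
  have f1 := f (p + s)
  have f2 := f (r + s)
  have f3 := f p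
  have f4 := f r
  have f5 := f s
  have f6 := f (p + r + s + 1)
  have g5 := g (n := p + r + s + 2) (by omega)
  field_simp

theorem sixJ_lower_mul_self (hq : 0 < q) (hq1 : q ≠ 1) {p r s : ℤ} (hp : 0 ≤ p) (hr : 0 ≤ r)
    (hs : 0 ≤ s) (hps : 0 < p + s) :
    sixJ q (p + s - 1) (p + s) 1 (r + s) (r + s + 1) (p + r) *
        sixJ q (p + s - 1) (p + s) 1 (r + s) (r + s + 1) (p + r) =
      qNum q (r + 1) * qNum q p / (qNum q (p + s) * qNum q (p + s + 1) *
        (qNum q (r + s + 1) * qNum q (r + s + 2))) := by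
  rcases hp.eq_or_lt with rfl | hp
  · rw [sixJ_eq_zero (by simp only [Triad, Int.even_iff]; omega), qNum_zero]
    simp
  rw [sixJ_mul_self_of_single (z := p + r + s)
    (by simp only [Triad, Int.even_iff]; omega) (by omega) (by omega)]
  simp only [triangleCoeff_mul_self hq hq1]
  have f := fun n => (qFact_pos hq hq1 n).ne'
  have g := fun {n : ℤ} (hn : 0 < n) => (qNum_pos hq hq1 hn).ne'
  have g1 := g (n := p + s) (by omega)
  have g2 := g (n := p + s + 1) (by omega)
  have g3 := g (n := r + s + 1) (by omega)
  have g4 := g (n := r + s + 2) (by omega)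
  have e1 : qFact q (p + s) = qFact q (p + s - 1) * qNum q (p + s) := by
    have := qFact_succ (q := q) (n := p + s - 1) (by omega)
    rwa [sub_add_cancel] at this
  have e2 : qFact q p = qFact q (p - 1) * qNum q p := by
    have := qFact_succ (q := q) (n := p - 1) (by omega)
    rwa [sub_add_cancel] at this
  rw [show (p + s + 1 - (p + s - 1)) / 2 = 1 by omega,
    show (p + s - 1 + 1 - (p + s)) / 2 = 0 by omega,
    show (p + s - 1 + (p + s) - 1) / 2 = p + s - 1 by omega,
    show (p + s - 1 + (p + s) + 1) / 2 = p + s by omega,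
    show (r + s + 1 + (p + r) - (p + s - 1)) / 2 = r + 1 by omega,
    show (p + s - 1 + (p + r) - (r + s + 1)) / 2 = p - 1 by omega,
    show (p + s - 1 + (r + s + 1) - (p + r)) / 2 = s by omega,
    show (p + s - 1 + (r + s + 1) + (p + r)) / 2 = p + r + s by omega,
    show (p + s + (p + r) - (r + s)) / 2 = p by omega,
    show (r + s + (p + r) - (p + s)) / 2 = r by omega,
    show (r + s + (p + s) - (p + r)) / 2 = s by omega,
    show (r + s + (p + s) + (p + r)) / 2 = p + r + s by omega,
    show (r + s + 1 + 1 - (r + s)) / 2 = 1 by omega,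
    show (r + s + 1 - (r + s + 1)) / 2 = 0 by omega,
    show (r + s + (r + s + 1) - 1) / 2 = r + s by omega,
    show (r + s + (r + s + 1) + 1) / 2 = r + s + 1 by omega,
    show p + r + s - (p + s) = r by omega,
    show p + r + s - (p + r + s) = 0 by omega,
    show p + r + s - (r + s + 1) = p - 1 by omega,
    show (p + s - 1 + (p + s) + (r + s) + (r + s + 1)) / 2 - (p + r + s) = s by omega,
    show (p + s - 1 + 1 + (r + s) + (p + r)) / 2 - (p + r + s) = 0 by omega,
    show (p + s + 1 + (r + s + 1) + (p + r)) / 2 - (p + r + s) = 1 by omega,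
    qFact_zero, qFact_one hq hq1,
    qFact_succ (n := p + s) (by omega), e1,
    qFact_succ (n := r + s + 1) (by omega), qFact_succ (n := r + s) (by omega),
    qFact_succ (n := r) (by omega), e2, show r + s + 1 + 1 = r + s + 2 by ring]
  have f1 := f (p + s - 1)
  have f2 := f (r + s)
  have f3 := f (p - 1)
  have f4 := f r
  have f5 := f s
  have f6 := f (p + r + s + 1)
  field_simp

/-- The sum of the squares of two `6j` symbols is larger than what the difference equations for
a triangle would require for the ordering `right`. -/
theorem one_lt_sum_sixJ_mul_self (hq : 0 < q) (hq1 : q ≠ 1) {x y c : ℤ} (h : Triad x y c)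
    (hy : 0 < y) :
    1 < qNum q 2 * qNum q (x + 1) * qNum q (y + 1) *
      (sixJ q (y + 1) y 1 x (x + 1) c * sixJ q (y + 1) y 1 x (x + 1) c +
        sixJ q (y - 1) y 1 x (x + 1) c * sixJ q (y - 1) y 1 x (x + 1) c) := by
  obtain ⟨p, r, s, hp, hr, hs, rfl, rfl, rfl⟩ : ∃ p r s : ℤ, 0 ≤ p ∧ 0 ≤ r ∧ 0 ≤ s ∧
      x = r + s ∧ y = p + s ∧ c = p + r := by
    obtain ⟨⟨m, hm⟩, h1, h2, h3⟩ := h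
    exact ⟨m - x, m - y, m - c, by omega, by omega, by omega, by omega, by omega, by omega⟩
  rw [sixJ_raise_mul_self hq hq1 hp hr hs, sixJ_lower_mul_self hq hq1 hp hr hs hy]
  have g := fun {n : ℤ} (hn : 0 < n) => qNum_pos hq hq1 hn
  have g0 := g hy
  have g1 := g (n := p + s + 1) (by omega)
  have g2 := g (n := p + s + 2) (by omega)
  have g3 := g (n := r + s + 1) (by omega)
  have g4 := g (n := r + s + 2) (by omega)
  have h2 := qNum_two_mul hq hq1 (p + s + 1)
  have hB : 0 ≤ qNum q (r + 1) * qNum q p :=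
    mul_nonneg (g (by omega)).le (qNum_nonneg hq hq1 hp)
  have hA : qNum q (p + r + s + 2) * qNum q (s + 1) + qNum q (r + 1) * qNum q p =
      qNum q (p + s + 1) * qNum q (r + s + 2) := by
    have := qNum_mul_add_mul hq p (s + 1) 0 (r + 1)
    rw [show p + (s + 1) + (r + 1) + 0 = p + r + s + 2 by ring, add_zero, ← add_assoc, add_zero,
      show s + 1 + (r + 1) = r + s + 2 by ring] at this
    linarith
  have hlt := qNum_lt_add_two hq hq1 (p + s)
  rw [add_assoc (p + s), add_sub_cancel_right] at h2
  norm_num at h2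
  generalize qNum q (p + r + s + 2) * qNum q (s + 1) = A at *
  generalize qNum q (r + 1) * qNum q p = B at *
  have hBB : B / qNum q (p + s + 2) ≤ B / qNum q (p + s) :=
    div_le_div_of_nonneg_left hB g0 hlt.le
  calc (1 : ℝ) < 1 + qNum q (p + s) / qNum q (p + s + 2) := lt_add_of_pos_right _ (div_pos g0 g2)
    _ = qNum q 2 * (A / qNum q (p + s + 2) + B / qNum q (p + s + 2)) / qNum q (r + s + 2) := by
      rw [← add_div, hA, one_add_div g2.ne', ← h2]
      field_simp
    _ ≤ qNum q 2 * (A / qNum q (p + s + 2) + B / qNum q (p + s)) / qNum q (r + s + 2) := by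
      have := (g (n := 2) (by norm_num)).le
      gcongr
    _ = _ := by
      field_simp

end SixJSquares

section Coefficients

variable {q : ℝ}

theorem unit_eq_neg_one_zpow (s : ℤˣ) (x : ℤ) :
    (-1 : ℝ) ^ ((x + x) / 2) * (-1 : ℝ) ^ ((x + (x - s) + 1) / 2) = ((s : ℤ) : ℝ) := by
  have key := unit_mul_neg_one_zpow s x
  have hss : ((s : ℤ) : ℝ) * ((s : ℤ) : ℝ) = 1 := by
    rcases Int.units_eq_one_or s with rfl | rfl <;> simp
  linear_combination ((s : ℤ) : ℝ) * key - (-1 : ℝ) ^ ((x + x) / 2) *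
    (-1 : ℝ) ^ ((x + (x - s) + 1) / 2) * hss

theorem coeffA_right_from_zero (hq : 0 < q) (hq1 : q ≠ 1) (s : ℤˣ) {x : ℤ} (hx : 0 ≤ x)
    (h : 0 ≤ x - s) :
    coeffA .right q 1 (-1) s 0 x x = -(((s : ℤ) : ℝ) / (Real.sqrt (qNum q 2) *
      Real.sqrt (qNum q (x + 1)))) := by
  have e : coeffA .right q 1 (-1) s 0 x x =
      -((-1 : ℝ) ^ ((x + x) / 2) * sixJ q 0 1 1 (x - s) x x) := by
    simp [coeffA, qNum_one hq hq1]
  rw [e, sixJ_zero_first hq hq1 (triad_sub_unit hx h), ← mul_assoc, unit_eq_neg_one_zpow,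
    div_eq_mul_inv]

theorem coeffA_right_to_zero (hq : 0 < q) (hq1 : q ≠ 1) (s : ℤˣ) {x : ℤ} (hx : 0 ≤ x)
    (h : 0 ≤ x - s) :
    coeffA .right q 1 s (-1) x 0 x = qNum q (x + 1) / (Real.sqrt (qNum q 2) *
      Real.sqrt (qNum q (x + 1))) := by
  have key := unit_mul_neg_one_zpow s x
  have e : coeffA .right q 1 s (-1) x 0 x =
      ((s : ℤ) : ℝ) * qNum q (x + 1) * (-1 : ℝ) ^ ((x + x) / 2) *
        sixJ q x (x - s) 1 1 0 x := by
    simp [coeffA]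
  rw [e, sixJ_zero_middle hq hq1 (triad_sub_unit hx h), div_eq_mul_inv]
  linear_combination (qNum q (x + 1) * (Real.sqrt (qNum q 2) *
      Real.sqrt (qNum q (x + 1)))⁻¹) * key

theorem neg_one_zpow_mul_self (n : ℤ) : (-1 : ℝ) ^ n * (-1 : ℝ) ^ n = 1 := by
  rw [← zpow_add₀ (by norm_num), Even.neg_one_zpow ⟨n, rfl⟩]

theorem triad_succ {x : ℤ} (hx : 0 ≤ x) : Triad x (x + 1) 1 := by
  simp only [Triad, Int.even_iff]; omega

theorem coeffA_right_to_one (hq : 0 < q) (hq1 : q ≠ 1) {x : ℤ} (hx : 0 ≤ x) :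
    coeffA .right q 1 1 1 (x + 1) 1 x = qNum q (x + 2) / (Real.sqrt (qNum q 2) *
      Real.sqrt (qNum q (x + 1))) := by
  have e : coeffA .right q 1 1 1 (x + 1) 1 x =
      qNum q (x + 2) * (-1 : ℝ) ^ ((x + (x + 1) + 1) / 2) * sixJ q (x + 1) x 1 0 1 x := by
    simp only [coeffA, Units.val_one, Int.cast_one, one_mul, add_sub_cancel_right, sub_self]
    rw [show x + 1 + 1 = x + 2 by ring, show x + 2 + x = x + (x + 1) + 1 by ring]
  rw [e, sixJ_swap12, sixJ_zero_middle hq hq1 (triad_succ hx), div_eq_mul_inv]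
  linear_combination (qNum q (x + 2) * (Real.sqrt (qNum q 2) *
      Real.sqrt (qNum q (x + 1)))⁻¹) * neg_one_zpow_mul_self ((x + (x + 1) + 1) / 2)

theorem coeffA_right_from_one (hq : 0 < q) (hq1 : q ≠ 1) {x : ℤ} (hx : 0 ≤ x) :
    coeffA .right q 1 1 1 1 (x + 1) x = qNum q 2 / (Real.sqrt (qNum q 2) *
      Real.sqrt (qNum q (x + 1))) := by
  have e : coeffA .right q 1 1 1 1 (x + 1) x =
      qNum q 2 * (-1 : ℝ) ^ ((x + (x + 1) + 1) / 2) * sixJ q 1 0 1 x (x + 1) x := by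
    simp only [coeffA, Units.val_one, Int.cast_one, one_mul, add_sub_cancel_right, sub_self]
    rw [show 1 + (x + 1) + x = x + (x + 1) + 1 by ring, one_add_one_eq_two]
  rw [e, sixJ_swap12, sixJ_zero_first hq hq1 (triad_succ hx), div_eq_mul_inv]
  linear_combination (qNum q 2 * (Real.sqrt (qNum q 2) *
      Real.sqrt (qNum q (x + 1)))⁻¹) * neg_one_zpow_mul_self ((x + (x + 1) + 1) / 2)

theorem neg_one_zpow_succ (n : ℤ) : (-1 : ℝ) ^ (n + 1) = -(-1 : ℝ) ^ n := by
  rw [zpow_add_one₀ (by norm_num)]; ring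

theorem eq_zero_of_one_lt {u v₁ v₂ P : ℂ} {Z X Y N S₁ S₂ : ℝ} (hP : P * P = 1) (hZ : Z * Z = 1)
    (h : u = -(P * (Z * X * Y : ℝ)) * (S₁ * v₁ + S₂ * v₂))
    (h₁ : v₁ = -(P * (Z * S₁ * (N * X * Y) : ℝ)) * u)
    (h₂ : v₂ = -(P * (Z * S₂ * (N * X * Y) : ℝ)) * u)
    (hlt : 1 < N * (X * X) * (Y * Y) * (S₁ * S₁ + S₂ * S₂)) : u = 0 := by
  have hZ' : (Z : ℂ) * Z = 1 := by rw [← Complex.ofReal_mul, hZ, Complex.ofReal_one]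
  have key : (1 - (N * (X * X) * (Y * Y) * (S₁ * S₁ + S₂ * S₂) : ℝ)) * u = 0 := by
    rw [h₁, h₂] at h
    push_cast at h ⊢
    linear_combination h + (N * X ^ 2 * Y ^ 2 * (S₁ ^ 2 + S₂ ^ 2) : ℂ) * u * P ^ 2 * hZ' +
      (N * X ^ 2 * Y ^ 2 * (S₁ ^ 2 + S₂ ^ 2) : ℂ) * u * hP
  refine (mul_eq_zero.1 key).resolve_left fun h0 => hlt.ne' ?_
  exact_mod_cast (sub_eq_zero.1 h0).symm

end Coefficients

namespace TrivalentMap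

variable {D : Type*} [DecidableEq D] {G : TrivalentMap D} {d₀ : D}

namespace Triangle

variable {a b c e₃ e₄ : D} (T : Triangle G d₀ a b c e₃ e₄) (hG : G.FacesEmbedded)
include T

theorem labels_of_zero {K : D → ℤ} (hK : G.Admissible K) (k0 : K d₀ = 0) :
    K e₄ = K a ∧ K e₃ = K b ∧ Triad (K a) (K b) (K c) := by
  obtain ⟨h1, h2, h3, -⟩ := T.triad_iff.1 hK
  rw [h1, k0] at h3
  rw [h1, k0] at h2
  have h4 := hK.2 (G.rev a)
  rw [T.rot_rev_a, T.rot_b, h1] at h4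
  exact ⟨(eq_of_triad_zero h3).symm, eq_of_triad_zero h2, h4⟩

include hG

variable [Fintype D] (h : G.Removable d₀) (htri : G.faceDegree d₀ = 3) {q : ℝ}
    (hq : 0 < q) (hq1 : q ≠ 1) {o : D → ℤˣ} {ψ : G.State} (hψ : G.IsPhysical .right q o ψ)
    {K : D → ℤ} (hK : G.Admissible K) (k0 : K d₀ = 0)
include h htri hq hq1 hψ hK k0

theorem coeff_right (s t : ℤˣ) :
    ψ.coeff (G.setTriangle d₀ a b K 1 (K a + s) (K b + t)) =
      (((o a : ℤ) : ℂ) * ((o b : ℤ) : ℂ) * ((o d₀ : ℤ) : ℂ)) *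
        ((((s : ℤ) : ℝ) * ((t : ℤ) : ℝ) * (-1 : ℝ) ^ ((K b + t + (K a + s) + K c) / 2) *
          sixJ q (K b + t) (K b) 1 (K a) (K a + s) (K c) * (qNum q 2 *
          Real.sqrt (qNum q (K a + 1)) * Real.sqrt (qNum q (K b + 1))) : ℝ) : ℂ) * ψ.coeff K := by
  obtain ⟨m4, m3, mT⟩ := T.labels_of_zero hK k0
  by_cases hL : G.Admissible (G.setTriangle d₀ a b K 1 (K a + s) (K b + t))
  · obtain ⟨s1, s2, s3, s4, s5, s6, s7, s8, s9⟩ :=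
      T.setTriangle_apply hG (h := h) K 1 (K a + s) (K b + t)
    obtain ⟨f1, -, -, f2, -⟩ := T.faceLabels_triangle hG h htri hL.1 (K a) (K b) 0
    obtain ⟨f3, -⟩ := T.faceLabels_triangle hG h htri hL.1 (K a + s) (K b + t) 1
    obtain ⟨d1, d2, d3, -⟩ := T.distinct hG h
    have key := hψ.triangle f2 T.next_a T.next_b T.next_d₀ d3 d1.symm d2.symm hL s t 1
    rw [T.rot_b, T.rot_d₀, T.rot_a, s1, s3, s5, s7, s8, s9, m3, m4] at key
    have hself := setTriangle_self hK.1 (d₀ := d₀) (a := a) (b := b)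
    rw [k0] at hself
    simp only [Units.val_one, sub_self, zero_add, coeffA_zero_pos, zero_mul, Complex.ofReal_zero,
      add_sub_cancel_right] at key
    rw [f1, f3, setTriangle_setTriangle, setTriangle_setTriangle, hself] at key
    have hy := hL.nonneg b
    have hx := hL.nonneg a
    rw [s3] at hx
    rw [s5] at hy
    have hx' := hK.nonneg a
    have hy' := hK.nonneg b
    rw [coeffA_right_from_zero hq hq1 _ hy' (by simpa using hy),
      coeffA_right_to_zero hq hq1 _ hx' (by simpa using hx)] at key
    have eA : coeffA .right q 1 t s (K b + t) (K a + s) (K c) = ((t : ℤ) : ℝ) *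
        qNum q (K b + t + 1) * (-1 : ℝ) ^ ((K b + t + (K a + s) + K c) / 2) *
          sixJ q (K b + t) (K b) 1 (K a) (K a + s) (K c) := by
      simp [coeffA]
    have eα : coeffAlpha .right q s t (K a + s) (K b + t) = ((s : ℤ) : ℝ) * ((t : ℤ) : ℝ) *
        (qNum q (K b + t + 1) / qNum q (K a + 1)) := by
      simp [coeffAlpha]
    rw [eA, eα] at key
    have n2 := (Real.sqrt_pos.2 (qNum_pos hq hq1 (show 0 < 2 by norm_num))).ne'
    have nx := (Real.sqrt_pos.2 (qNum_pos hq hq1 (show 0 < K a + 1 by omega))).ne'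
    have ny := (Real.sqrt_pos.2 (qNum_pos hq hq1 (show 0 < K b + 1 by omega))).ne'
    have nY := (qNum_pos hq hq1 (show 0 < K b + t + 1 by omega)).ne'
    have hs := unit_cast_mul_self s
    have ht := unit_cast_mul_self t
    have hoa := unit_cast_mul_self (o a)
    have hob := unit_cast_mul_self (o b)
    have hod := unit_cast_mul_self (o d₀)
    have sqx := congrArg Complex.ofReal
      (Real.mul_self_sqrt (qNum_pos hq hq1 (show 0 < K a + 1 by omega)).le)
    have sq2 := congrArg Complex.ofReal
      (Real.mul_self_sqrt (qNum_pos hq hq1 (show 0 < 2 by norm_num)).le)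
    replace nY := Complex.ofReal_ne_zero.2 nY
    replace n2 := Complex.ofReal_ne_zero.2 n2
    replace nx := Complex.ofReal_ne_zero.2 nx
    replace ny := Complex.ofReal_ne_zero.2 ny
    generalize sixJ q (K b + t) (K b) 1 (K a) (K a + s) (K c) = S at *
    generalize (-1 : ℝ) ^ ((K b + t + (K a + s) + K c) / 2) = Z at *
    simp only [Units.val_neg, Int.cast_neg] at key
    push_cast at key sqx sq2 ⊢
    rw [← sqx] at key
    rw [← sq2]
    generalize ((Real.sqrt (qNum q 2) : ℝ) : ℂ) = R at *
    generalize ((Real.sqrt (qNum q (K a + 1)) : ℝ) : ℂ) = X at *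
    generalize ((Real.sqrt (qNum q (K b + 1)) : ℝ) : ℂ) = Y at *
    generalize ((qNum q (K b + t + 1) : ℝ) : ℂ) = N at *
    generalize ψ.coeff (G.setTriangle d₀ a b K 1 (K a + s) (K b + t)) = v at *
    generalize ((s : ℤ) : ℂ) = s at *
    generalize ((t : ℤ) : ℂ) = t at *
    generalize ((o a : ℤ) : ℂ) = oa at *
    generalize ((o b : ℤ) : ℂ) = ob at *
    generalize ((o d₀ : ℤ) : ℂ) = od at *
    generalize ψ.coeff K = u at *
    field_simp at key
    have e : t * t * (s * s) * (oa * oa) * (ob * ob) * (od * od) = 1 := by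
      rw [hs, ht, hoa, hob, hod]; norm_num
    linear_combination -(oa * ob * od * s) * key - v * e
  · rw [State.coeff_of_not hL, sixJ_eq_zero]
    · simp
    · rintro ⟨h1, h2, -, h4⟩
      refine hL (T.admissible_setTriangle hG (h := h) hK ?_ ?_ (Triad.swap12.1 h2))
      · rw [m3]; exact Triad.rotate.2 (Triad.swap12.1 h1)
      · rw [m4]; exact Triad.rotate.2 (Triad.swap12.1 h4)

theorem coeff_eq_zero_of_right_pos (hb : 0 < K b) : ψ.coeff K = 0 := by
  obtain ⟨m4, m3, mT⟩ := T.labels_of_zero hK k0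
  have hx' := hK.nonneg a
  have hL : G.Admissible (G.setTriangle d₀ a b K 1 (K a + 1) (K b + 1)) := by
    apply T.admissible_setTriangle hG (h := h) hK
    · rw [m3]; exact Triad.rotate.2 (triad_succ hb.le)
    · rw [m4]; exact Triad.rotate.2 (Triad.swap12.1 (triad_succ hx'))
    · simp only [Triad, Int.even_iff] at mT ⊢; omega
  obtain ⟨s1, s2, s3, s4, s5, s6, s7, s8, s9⟩ :=
    T.setTriangle_apply hG (h := h) K 1 (K a + 1) (K b + 1)
  obtain ⟨-, f1, -⟩ := T.faceLabels_triangle hG h htri hL.1 0 (K a) (K b)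
  obtain ⟨-, f2, -⟩ := T.faceLabels_triangle hG h htri hL.1 1 (K a + 1) (K b - 1)
  obtain ⟨-, f3, -⟩ := T.faceLabels_triangle hG h htri hL.1 1 (K a + 1) (K b + 1)
  obtain ⟨d1, d2, d3, -⟩ := T.distinct hG h
  have key := hψ.triangle htri T.next_d₀ T.next_a T.next_b d1 d2 d3 hL 1 1 1
  have hself := setTriangle_self hK.1 (d₀ := d₀) (a := a) (b := b)
  rw [k0] at hself
  rw [T.rot_b, T.rot_d₀, T.rot_a, s1, s3, s5, s7, s8, s9, m3, m4] at key
  simp only [Units.val_one, sub_self, add_sub_cancel_right] at key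
  rw [f1, f2, f3, setTriangle_setTriangle, setTriangle_setTriangle, setTriangle_setTriangle,
    hself, coeffA_right_to_one hq hq1 hx'] at key
  have g1 := T.coeff_right hG h htri hq hq1 hψ hK k0 1 1
  have g2 := T.coeff_right hG h htri hq hq1 hψ hK k0 1 (-1)
  have c1 := coeffA_right_from_zero hq hq1 1 hb.le (by simp; omega)
  have c2 := coeffA_right_from_zero hq hq1 (-1) hb.le (by simp; omega)
  have eA : ∀ s : ℤˣ, coeffA .right q 1 s (-1) (K b) (K a) (K c) = ((s : ℤ) : ℝ) *
      qNum q (K b + 1) * (-1 : ℝ) ^ ((K b + K a + K c) / 2) *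
        sixJ q (K b - s) (K b) 1 (K a) (K a + 1) (K c) := fun s => by
    rw [sixJ_swap12]
    simp [coeffA]
  have eα : coeffAlpha .right q 1 1 1 (K a + 1) = qNum q (K a + 2) := by
    simp [coeffAlpha, qNum_one hq hq1, add_assoc]
  have hP : (((o a : ℤ) : ℂ) * ((o b : ℤ) : ℂ) * ((o d₀ : ℤ) : ℂ)) *
      (((o a : ℤ) : ℂ) * ((o b : ℤ) : ℂ) * ((o d₀ : ℤ) : ℂ)) = 1 := by
    have e : ((o a : ℤ) : ℂ) * ((o a : ℤ) : ℂ) * (((o b : ℤ) : ℂ) * ((o b : ℤ) : ℂ)) *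
      (((o d₀ : ℤ) : ℂ) * ((o d₀ : ℤ) : ℂ)) = 1 := by
      simp only [unit_cast_mul_self, mul_one]
    linear_combination e
  have hZ := neg_one_zpow_mul_self ((K b + K a + K c) / 2)
  have hlt := one_lt_sum_sixJ_mul_self hq hq1 mT hb
  have posx := qNum_pos hq hq1 (show 0 < K a + 1 by omega)
  have posy := qNum_pos hq hq1 (show 0 < K b + 1 by omega)
  have sqx := Real.mul_self_sqrt posx.le
  have sqy := Real.mul_self_sqrt posy.le
  rw [eA, eA, eα, c1, c2] at key
  simp only [Units.val_one, Units.val_neg, Int.cast_one, Int.cast_neg, ← sub_eq_add_neg,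
    sub_neg_eq_add] at key g1 g2
  rw [show (K b + 1 + (K a + 1) + K c) / 2 = (K b + K a + K c) / 2 + 1 by omega,
    neg_one_zpow_succ] at g1
  rw [show (K b - 1 + (K a + 1) + K c) / 2 = (K b + K a + K c) / 2 by omega] at g2
  refine eq_zero_of_one_lt (v₁ := ψ.coeff (G.setTriangle d₀ a b K 1 (K a + 1) (K b + 1)))
    (v₂ := ψ.coeff (G.setTriangle d₀ a b K 1 (K a + 1) (K b - 1))) hP hZ
    (Z := (-1 : ℝ) ^ ((K b + K a + K c) / 2)) (N := qNum q 2)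
    (X := Real.sqrt (qNum q (K a + 1))) (Y := Real.sqrt (qNum q (K b + 1)))
    (S₁ := sixJ q (K b + 1) (K b) 1 (K a) (K a + 1) (K c))
    (S₂ := sixJ q (K b - 1) (K b) 1 (K a) (K a + 1) (K c))
    ?_ ?_ ?_ (by rw [sqx, sqy]; exact hlt)
  · have n2 := Complex.ofReal_ne_zero.2
      (Real.sqrt_pos.2 (qNum_pos hq hq1 (show 0 < 2 by norm_num))).ne'
    have nx := Complex.ofReal_ne_zero.2 (Real.sqrt_pos.2 posx).ne'
    have ny := Complex.ofReal_ne_zero.2 (Real.sqrt_pos.2 posy).ne'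
    have nX := Complex.ofReal_ne_zero.2 (qNum_pos hq hq1 (show 0 < K a + 2 by omega)).ne'
    replace sqy := congrArg Complex.ofReal sqy
    push_cast at key sqy ⊢
    rw [← sqy] at key
    clear g1 g2 c1 c2 eA eα hlt
    generalize ((Real.sqrt (qNum q 2) : ℝ) : ℂ) = R at *
    generalize ((Real.sqrt (qNum q (K a + 1)) : ℝ) : ℂ) = X at *
    generalize ((Real.sqrt (qNum q (K b + 1)) : ℝ) : ℂ) = Y at *
    generalize ((qNum q (K a + 2) : ℝ) : ℂ) = N at *
    field_simp at key
    linear_combination key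
  · rw [g1]; push_cast; ring
  · rw [g2]; push_cast; ring

end Triangle

end TrivalentMap

theorem coeffA_right_one_one_zero_ne {q : ℝ} (hq : 0 < q) (hq1 : q ≠ 1) :
    coeffA .right q 1 1 1 1 1 0 ≠ 0 := by
  have h := coeffA_right_from_one hq hq1 le_rfl
  rw [zero_add] at h
  rw [h]
  have h2 := qNum_pos hq hq1 (show 0 < 2 by norm_num)
  have h1 := qNum_pos hq hq1 (show 0 < 1 by norm_num)
  exact (div_pos h2 (mul_pos (Real.sqrt_pos.2 h2) (Real.sqrt_pos.2 h1))).ne'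

namespace TrivalentMap

variable {D : Type*} [DecidableEq D] [Fintype D] {G : TrivalentMap D} {d₀ : D}

namespace Triangle

variable {a b c e₃ e₄ : D} (T : Triangle G d₀ a b c e₃ e₄) (hG : G.FacesEmbedded)
  (h : G.Removable d₀) (htri : G.faceDegree d₀ = 3) {q : ℝ} (hq : 0 < q) (hq1 : q ≠ 1)
  {o : D → ℤˣ} {ψ : G.State} (hψ : G.IsPhysical .right q o ψ)
include T hG h htri hq hq1 hψ

/-- For the ordering `right`, the coefficients of a physical state vanish when the label of the
edge `d₀` of a triangular face vanishes. -/
theorem coeff_eq_zero_of_right {K : D → ℤ} (hK : G.Admissible K) (k0 : K d₀ = 0) :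
    ψ.coeff K = 0 := by
  rcases (hK.nonneg b).lt_or_eq with hb | hb
  · exact T.coeff_eq_zero_of_right_pos hG h htri hq hq1 hψ hK k0 hb
  obtain ⟨n1, n2, n3, n4, n5, n6⟩ := T.class_ne hG
  obtain ⟨m4, m3, mT⟩ := T.labels_of_zero hK k0
  set d := G.rev b with hd
  have hcl : ∀ i, G.faceClass (G.around d i) = G.faceClass c := fun i => by
    rw [faceClass_around, hd, T.class_rev_b]
  have hne : ∀ x, G.faceClass x ≠ G.faceClass c → ∀ i < G.faceDegree d, G.around d i ≠ x :=
    fun x hx i _ e => hx (by rw [← e, hcl])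
  obtain ⟨r, hr⟩ : ∃ r, G.faceDegree d = r + 1 :=
    Nat.exists_eq_succ_of_ne_zero (G.faceDegree_pos d).ne'
  have hlast : G.around d r = G.rev e₃ := by
    have h1 : G.next (G.around d r) = d := by rw [← around_succ, ← hr, around_faceDegree]
    exact eq_rev_iff.1 (G.rot.injective (h1.trans T.rot_e₃.symm))
  have hr0 : 0 < r := by
    rcases Nat.eq_zero_or_pos r with rfl | h0
    · have e : b = e₃ := G.rev.injective hlast
      exact absurd (by rw [← T.class_b, e]) n1
    · exact h0
  have key := (G.constraint_eq_zero_iff .right q o ψ d (r := r) (by omega) (fun _ => -1) K).1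
    (hψ d r hr0 (by omega) _ _ hK)
  have hself : G.faceLabels d K (fun i => K (G.around d i)) = K := by
    funext x
    simp [faceLabels]
  have kd : K d = 0 := by rw [hd, hK.1, ← hb]
  have kr : K (G.rev e₃) = 0 := by rw [hK.1, m3, ← hb]
  have klast : K (G.rot d) = 0 := by rw [hd, T.rot_rev_b, k0]
  have hzero : arcSum .right q (fun i => K (G.rot (G.around d i))) (fun i => K (G.around d i))
      (fun _ => -1) 0 r (fun κ => ψ.coeff (G.faceLabels d K κ)) = 0 := by
    refine sum_eq_zero fun σ hσ => ?_
    dsimp only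
    have hσ0 : σ 0 = -1 := mem_seqSigns.1 hσ 0 (by simp)
    by_cases hL : G.Admissible (G.faceLabels d K fun i => K (G.around d i) - σ i)
    · rw [T.coeff_eq_zero_of_right_pos hG h htri hq hq1 hψ hL, mul_zero]
      · rw [faceLabels_of_notMem (hne _ n3) (hne _ (by rw [T.class_rev_d₀]; exact n5)), k0]
      · have e := faceLabels_around (k := K) (κ := fun i => K (G.around d i) - σ i)
          (G.faceDegree_pos d) (hne _ (by
            rw [around_zero, hd, G.rev_rev, T.class_b]; exact n3))
        rw [around_zero, kd, hσ0, hd, hL.1] at e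
        rw [hd, e]
        norm_num
    · rw [State.coeff_of_not hL, mul_zero]
  rw [hzero, hr, arcSum_succ, ← hr, around_faceDegree, around_zero, hlast, kd, kr, klast] at key
  simp only [neg_neg, Units.val_neg, Units.val_one, sub_neg_eq_add, add_sub_cancel_right, zero_add,
    hself] at key
  have hP : (∏ i ∈ range (G.faceDegree d), ((o (G.around d i) : ℤ) : ℂ)) ≠ 0 :=
    prod_ne_zero_iff.2 fun i _ => by simp
  have hA := coeffA_right_one_one_zero_ne hq hq1
  have hα : coeffAlpha .right q (-1) (-1) 0 0 ≠ 0 := by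
    have h2 := qNum_pos hq hq1 (show 0 < 2 by norm_num)
    simp [coeffAlpha, qNum_one hq hq1, one_add_one_eq_two, h2.ne']
  simpa [hP, hA, hα] using key

theorem isPhysical_right (o' : G.Kept d₀ → ℤˣ) :
    (G.removeEdge h).IsPhysical .right q o' (G.reducedState q o a b ψ h) := by
  have hz : ∀ k, (G.reducedState q o a b ψ h).coeff k = 0 := fun k => by
    by_cases hk : (G.removeEdge h).Admissible k
    · rw [State.coeff, dif_pos hk]
      simp only [reducedState]
      rw [T.coeff_eq_zero_of_right hG h htri hq hq1 hψ
        ((T.admissible_extendLabels_iff hG h).2 hk) (extendLabels_d₀ k), mul_zero]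
    · exact State.coeff_of_not hk
  intro d r _ _ ε k _
  simp [constraint, hz]

end Triangle

end TrivalentMap

end LoopGravity

open LoopGravity in
theorem mainTheorem4 {D : Type*} [Fintype D] [DecidableEq D] (G : TrivalentMap D)
    (hG : G.FacesEmbedded) (w : LoopGravity.Ordering) (q : ℝ) (hq : 0 < q) (hq1 : q ≠ 1)
    (o : D → ℤˣ) (ho : G.IsOrientation o)
    (d₀ : D) (hrem : G.Removable d₀) (htri : G.faceDegree d₀ = 3)
    (ψi : G.State) (hψi : G.IsPhysical w q o ψi) :
    (G.removeEdge hrem).IsPhysical w q (G.removeOrientation d₀ o) (fun k =>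
      let j := G.extendLabels d₀ k.1
      let j₁ := j (G.around d₀ 1)
      let j₂ := j (G.around d₀ 2)
      let o₁ : ℤ := (o (G.around d₀ 1) : ℤ)
      let o₂ : ℤ := (o (G.around d₀ 2) : ℤ)
      (-1 : ℂ) ^ (((1 + o₁) * j₁ + (1 + o₂) * j₂) / 2) *
        ((Real.sqrt (qNum q (j₁ + 1) * qNum q (j₂ + 1)) : ℝ) : ℂ) * ψi.coeff j) := by
  have T := TrivalentMap.triangle_of_faceDegree htri
  cases w with
  | right => exact T.isPhysical_right hG hrem htri hq hq1 hψi _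
  | left => exact T.isPhysical_left hG hq hq1 ho hψi hrem htri
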